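/- **Setting.** Let $d\in\mathbb N$ and let $\mathcal S(\mathbb R^{m})$ be the complex Schwartz space, $\mathcal S'(\mathbb R^m)$ its strong dual, with bilinear pairing $\langle\cdot,\cdot\rangle$; $\mathcal L(E,F)$ denotes continuous linear maps. A map $f$ between real topological vector spaces is smooth ($C^\infty$) if all iterated directional (Gâteaux) derivatives $f^{(r)}(x;v_1,\dots,v_r)$ exist and are jointly continuous in $(x;v_1,\dots,v_r)$; $df[x](v)=\lim_{t\to0}t^{-1}(f(x+tv)-f(x))$. **NLS phase space.** On $\mathcal S(\mathbb R^d)$ put $\omega_{L^2}(f,g)=2\,\mathrm{Im}\int\overline{f}\,g\,dx$. The symplectic gradient $\nabla_sF(\phi)\in\mathcal S(\mathbb R^d)$ of a functional $F$ is, if it exists, the unique element with $dF[\phi](\delta)=\omega_{L^2}(\nabla_sF(\phi),\delta)$ for all $\delta\in\mathcal S(\mathbb R^d)$. Let $\mathcal A_{\mathcal S}$ be the set of $H\in C^\infty(\mathcal S(\mathbb R^d);\mathbb R)$ such that $\nabla_sH$ exists everywhere and is a smooth map $\mathcal S(\mathbb R^d)\to\mathcal S(\mathbb R^d)$, and let $\{F,G\}_{L^2}=\omega_{L^2}(\nabla_sF,\nabla_sG)$.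 **Observable hierarchies.** An operator $A\in\mathcal L(\mathcal S(\mathbb R^{dk}),\mathcal S'(\mathbb R^{dk}))$ has the *good mapping property* if for every $\alpha\le k$ there is a continuous bilinear map $\Phi_\alpha:\mathcal S(\mathbb R^{dk})^2\to\mathcal S(\mathbb R^{d}\times\mathbb R^d)$ with $$\big\langle Af,\ \underline y\mapsto\varphi(y_\alpha)\,g(y_1,\dots,y_{\alpha-1},x',y_{\alpha+1},\dots,y_k)\big\rangle=\int_{\mathbb R^d}\Phi_\alpha(f,g)(x,x')\,\varphi(x)\,dx$$ for all $f,g\in\mathcal S(\mathbb R^{dk})$, $\varphi\in\mathcal S(\mathbb R^d)$, $x'\in\mathbb R^d$. A bosonic operator, i.e. an operator from the symmetric functions $\mathcal S_s(\mathbb R^{dk})$ to the symmetric distributions $\mathcal S_s'(\mathbb R^{dk})$, is identified with its extension obtained by precomposition with the symmetrization of functions. Let $\mathfrak g_{k,gmp}$ be the set of bosonic operators with the good mapping property that are skew-adjoint, $\langle Ag,\overline f\rangle=-\overline{\langle Af,\overline g\rangle}$, and $\mathfrak G_\infty=\bigoplus_{k\ge1}\mathfrak g_{k,gmp}$. For $A\in\mathcal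 L(\mathcal S(\mathbb R^{dk}),\mathcal S'(\mathbb R^{dk}))$ let $K_A\in\mathcal S'(\mathbb R^{dk}\times\mathbb R^{dk})$ be its Schwartz kernel, $\langle K_A,g\otimes f\rangle=\langle Af,g\rangle$, and for $T\in\mathcal S(\mathbb R^{dk}\times\mathbb R^{dk})$ let $T^t(x;x')=T(x';x)$. Let $A$ be an $i$-particle and $B$ a $j$-particle operator, both with the good mapping property, and let $k=i+j-1$, $\alpha\le i$, $\beta\le j$. The contraction $A\circ_\alpha^\beta B=A_{(1,\dots,i)}B_{(i+1,\dots,i+\beta-1,\alpha,i+\beta,\dots,k)}$ is the operator in $\mathcal L(\mathcal S(\mathbb R^{dk}),\mathcal S'(\mathbb R^{dk}))$ given by $\langle(A\circ_\alpha^\beta B)f,g\rangle=\langle K_A,\Phi(f,g)^t\rangle$. Here $\Phi(f,g)\in\mathcal S(\mathbb R^{di}\times\mathbb R^{di})$ is the function of $(\underline x_i;\underline x_i')$ obtained by applying $B$ to $f$ in the coordinates $(i+1,\dots,i+\beta-1,\alpha,i+\beta,\dots,k)$, evaluating the first $i$ variables of the result at $\underline x_i$, and pairing the remaining $j-1$ with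 $g(\underline x_i',\cdot)$; by the good mapping property this is a Schwartz function. Put $$[A,B]_1=\sum_{\alpha=1}^i\sum_{\beta=1}^j\big(A\circ_\alpha^\beta B-B\circ_\beta^\alpha A\big),\qquad [A,B]_{\mathfrak G_\infty}^{(k)}=\mathrm{Sym}_k\Big(\sum_{\ell+j-1=k}[A^{(\ell)},B^{(j)}]_1\Big)$$ for $A,B\in\mathfrak G_\infty$, where $\mathrm{Sym}_k(C)=\frac1{k!}\sum_{\pi\in\mathbb S_k}\pi C\pi^{-1}$, regarded as a bosonic operator. **GP phase space.** Let $\mathfrak G_\infty^*$ be the real topological vector space (product topology) of sequences $\Gamma=(\gamma^{(k)})_{k\ge1}$ of self-adjoint operators in $\mathcal L(\mathcal S_s'(\mathbb R^{dk}),\mathcal S_s(\mathbb R^{dk}))$, i.e. integral operators with kernels $\gamma^{(k)}(\underline x_k;\underline x_k')\in\mathcal S(\mathbb R^{dk}\times\mathbb R^{dk})$ that are separately permutation invariant in $\underline x_k$ and in $\underline x_k'$ and satisfy $\gamma^{(k)}(\underline x_k';\underline x_k)=\overline{\gamma^{(k)}(\underline x_k;\underline x_k')}$. With the generalized trace $\mathrm{Tr}_{1,\dots,k}(A^{(k)}\gamma^{(k)})=\langle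 K_{A^{(k)}},(\gamma^{(k)})^t\rangle$ put $\mathrm{Tr}(A\cdot\Gamma)=\sum_k\mathrm{Tr}_{1,\dots,k}(A^{(k)}\gamma^{(k)})$ for $A\in\mathfrak G_\infty$. Let $\mathcal A_\infty$ be the real algebra, under pointwise product, generated by the smooth functionals $\Gamma\mapsto i\,\mathrm{Tr}(A\cdot\Gamma)$, $A\in\mathfrak G_\infty$, and the constants. For $F\in\mathcal A_\infty$ identify the Gâteaux derivative of $F$ at $\Gamma$ with the element $dF[\Gamma]\in\mathfrak G_\infty$ such that the derivative in direction $v$ is $i\,\mathrm{Tr}(dF[\Gamma]\cdot v)$ for all $v\in\mathfrak G_\infty^*$, and put $$\{F,G\}_{\mathfrak G_\infty^*}(\Gamma)=i\,\mathrm{Tr}\big([dF[\Gamma],dG[\Gamma]]_{\mathfrak G_\infty}\cdot\Gamma\big).$$ **Theorem 2.3.** The map $\iota:\mathcal S(\mathbb R^d)\to\mathfrak G_\infty^*$, $\iota(\phi)=(|\phi^{\otimes k}\rangle\langle\phi^{\otimes k}|)_{k\ge1}$ (with kernels $\prod_{m=1}^k\phi(x_m)\overline{\phi(x_m')}$), is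 a Poisson morphism of $(\mathcal S(\mathbb R^d),\mathcal A_{\mathcal S},\{\cdot,\cdot\}_{L^2})$ into $(\mathfrak G_\infty^*,\mathcal A_\infty,\{\cdot,\cdot\}_{\mathfrak G_\infty^*})$. That is: $\iota$ is smooth; $F\circ\iota\in\mathcal A_{\mathcal S}$ for every $F\in\mathcal A_\infty$; and $$\{F\circ\iota,G\circ\iota\}_{L^2}(\phi)=\{F,G\}_{\mathfrak G_\infty^*}(\iota(\phi))\qquad\text{for all }\phi\in\mathcal S(\mathbb R^d),\ F,G\in\mathcal A_\infty .$$ -/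

import Mathlib

open SchwartzMap Filter Topology MeasureTheory

noncomputable section

namespace GPPoisson

/-! ### Calculus on topological vector spaces (Gâteaux derivatives) -/

section Calculus

variable {X Y : Type*} [AddCommGroup X] [Module ℝ X] [TopologicalSpace X]
  [AddCommGroup Y] [Module ℝ Y] [TopologicalSpace Y]

/-- The Gâteaux derivative `df[x](v)` exists and equals `y`. -/
def HasGateauxDeriv (f : X → Y) (x v : X) (y : Y) : Prop :=
  Tendsto (fun t : ℝ => t⁻¹ • (f (x + t • v) - f x)) (𝓝[≠] 0) (𝓝 y)

/-- `C^∞` maps in the Gâteaux sense: all iterated directional derivatives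
`f^{(r)}(x; v₁, …, v_r)` exist and are jointly continuous in `(x; v₁, …, v_r)`.
Here `D r x v` is `f^{(r)}(x; v 0, …, v (r-1))`. -/
def IsSmooth (f : X → Y) : Prop :=
  ∃ D : (r : ℕ) → X → (Fin r → X) → Y,
    (∀ x v, D 0 x v = f x) ∧
    (∀ r, Continuous fun p : X × (Fin r → X) => D r p.1 p.2) ∧
    ∀ r x (v : Fin r → X) (w : X),
      HasGateauxDeriv (fun z => D r z v) x w (D (r + 1) x (Fin.snoc v w))

end Calculus

/-! ### Schwartz functions: tensor products, conjugation, permutations -/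

section Schwartz

variable {E F : Type*} [NormedAddCommGroup E] [NormedSpace ℝ E]
  [NormedAddCommGroup F] [NormedSpace ℝ F]

theorem norm_iteratedFDeriv_comp_fst_le (f : 𝓢(E, ℂ)) (n : ℕ) (p : E × F) :
    ‖iteratedFDeriv ℝ n (fun q : E × F => f q.1) p‖ ≤ ‖iteratedFDeriv ℝ n f p.1‖ := by
  have h := (ContinuousLinearMap.fst ℝ E F).iteratedFDeriv_comp_right (f := f) (f.smooth ⊤) p
    (i := n) (by exact_mod_cast le_top)
  have h' : (fun q : E × F => f q.1) = f ∘ (ContinuousLinearMap.fst ℝ E F) := rfl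
  rw [h', h]
  refine (ContinuousMultilinearMap.norm_compContinuousLinearMap_le _ _).trans ?_
  refine mul_le_of_le_one_right (norm_nonneg _) ?_
  exact Finset.prod_le_one (fun _ _ => norm_nonneg _)
    (fun _ _ => ContinuousLinearMap.norm_fst_le ℝ E F)

theorem norm_iteratedFDeriv_comp_snd_le (g : 𝓢(F, ℂ)) (n : ℕ) (p : E × F) :
    ‖iteratedFDeriv ℝ n (fun q : E × F => g q.2) p‖ ≤ ‖iteratedFDeriv ℝ n g p.2‖ := by
  have h := (ContinuousLinearMap.snd ℝ E F).iteratedFDeriv_comp_right (f := g) (g.smooth ⊤) p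
    (i := n) (by exact_mod_cast le_top)
  have h' : (fun q : E × F => g q.2) = g ∘ (ContinuousLinearMap.snd ℝ E F) := rfl
  rw [h', h]
  refine (ContinuousMultilinearMap.norm_compContinuousLinearMap_le _ _).trans ?_
  refine mul_le_of_le_one_right (norm_nonneg _) ?_
  exact Finset.prod_le_one (fun _ _ => norm_nonneg _)
    (fun _ _ => ContinuousLinearMap.norm_snd_le ℝ E F)

/-- The tensor product `(f ⊗ g)(x, y) = f(x) g(y)` of two Schwartz functions. -/
def tensor (f : 𝓢(E, ℂ)) (g : 𝓢(F, ℂ)) : 𝓢(E × F, ℂ) where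
  toFun p := f p.1 * g p.2
  smooth' := ((f.smooth ⊤).comp contDiff_fst).mul ((g.smooth ⊤).comp contDiff_snd)
  decay' := by
    intro k n
    choose Cf hCf using fun a b => f.decay a b
    choose Cg hCg using fun a b => g.decay a b
    refine ⟨∑ i ∈ Finset.range (n + 1), (n.choose i : ℝ) *
      (Cf k i * Cg 0 (n - i) + Cf 0 i * Cg k (n - i)), fun p => ?_⟩
    have hmul := norm_iteratedFDeriv_mul_le (𝕜 := ℝ) (f := fun q : E × F => f q.1)
      (g := fun q : E × F => g q.2) ((f.smooth ⊤).comp contDiff_fst)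
      ((g.smooth ⊤).comp contDiff_snd) p (n := n) (by exact_mod_cast le_top)
    have hk : ‖p‖ ^ k ≤ ‖p.1‖ ^ k + ‖p.2‖ ^ k := by
      rcases max_choice ‖p.1‖ ‖p.2‖ with h | h
      · rw [Prod.norm_def, h]
        exact le_add_of_nonneg_right (by positivity)
      · rw [Prod.norm_def, h]
        exact le_add_of_nonneg_left (by positivity)
    refine (mul_le_mul_of_nonneg_left hmul (by positivity)).trans ?_
    rw [Finset.mul_sum]
    refine Finset.sum_le_sum fun i _ => ?_
    set a := ‖iteratedFDeriv ℝ i f p.1‖ with ha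
    set b := ‖iteratedFDeriv ℝ (n - i) g p.2‖ with hb
    have h1 : ‖p.1‖ ^ k * a ≤ Cf k i := (hCf k i).2 p.1
    have h2 : a ≤ Cf 0 i := by simpa using (hCf 0 i).2 p.1
    have h3 : ‖p.2‖ ^ k * b ≤ Cg k (n - i) := (hCg k (n - i)).2 p.2
    have h4 : b ≤ Cg 0 (n - i) := by simpa using (hCg 0 (n - i)).2 p.2
    have ha0 : 0 ≤ a := norm_nonneg _
    have hb0 : 0 ≤ b := norm_nonneg _
    have hfst := norm_iteratedFDeriv_comp_fst_le f i p
    have hsnd := norm_iteratedFDeriv_comp_snd_le g (n - i) p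
    have e1 : ‖p.1‖ ^ k * a * b ≤ Cf k i * Cg 0 (n - i) :=
      mul_le_mul h1 h4 hb0 ((by positivity : (0 : ℝ) ≤ ‖p.1‖ ^ k * a).trans h1)
    have e2 : a * (‖p.2‖ ^ k * b) ≤ Cf 0 i * Cg k (n - i) :=
      mul_le_mul h2 h3 (by positivity) (ha0.trans h2)
    calc ‖p‖ ^ k * ((n.choose i : ℝ) * ‖iteratedFDeriv ℝ i (fun q : E × F => f q.1) p‖ *
          ‖iteratedFDeriv ℝ (n - i) (fun q : E × F => g q.2) p‖)
        ≤ (‖p.1‖ ^ k + ‖p.2‖ ^ k) * ((n.choose i : ℝ) * a * b) := by gcongr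
      _ = (n.choose i : ℝ) * (‖p.1‖ ^ k * a * b + a * (‖p.2‖ ^ k * b)) := by ring
      _ ≤ _ := by gcongr

@[simp] theorem tensor_apply (f : 𝓢(E, ℂ)) (g : 𝓢(F, ℂ)) (p : E × F) :
    tensor f g p = f p.1 * g p.2 := rfl

/-- The complex conjugate of a Schwartz function. -/
def conjS (f : 𝓢(E, ℂ)) : 𝓢(E, ℂ) :=
  SchwartzMap.postcompCLM (𝕜 := ℝ) (Complex.conjCLE : ℂ →L[ℝ] ℂ) f

@[simp] theorem conjS_apply (f : 𝓢(E, ℂ)) (x : E) : conjS f x = (starRingEnd ℂ) (f x) := rfl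

/-- The transpose `K^t(x; x') = K(x'; x)` of a Schwartz kernel. -/
def transposeS (K : 𝓢(E × E, ℂ)) : 𝓢(E × E, ℂ) :=
  SchwartzMap.compCLMOfContinuousLinearEquiv ℂ (ContinuousLinearEquiv.prodComm ℝ E E) K

@[simp] theorem transposeS_apply (K : 𝓢(E × E, ℂ)) (x y : E) :
    transposeS K (x, y) = K (y, x) := rfl

end Schwartz

/-- One-particle space `ℝ^d`. -/
abbrev Pt (d : ℕ) : Type := EuclideanSpace ℝ (Fin d)

/-- `k`-particle configuration space `(ℝ^d)^k = ℝ^{dk}`. -/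
abbrev Conf (d k : ℕ) : Type := Fin k → Pt d

/-- `𝓢(ℝ^{dk})`. -/
abbrev Sch (d k : ℕ) : Type := 𝓢(Conf d k, ℂ)

/-- `𝓢(ℝ^{dk} × ℝ^{dk})`, the Schwartz-class integral kernels `K(x_k; x_k')`. -/
abbrev Ker (d k : ℕ) : Type := 𝓢(Conf d k × Conf d k, ℂ)

variable {d : ℕ}

/-- `(π f)(x₁, …, x_k) = f(x_{π(1)}, …, x_{π(k)})`. -/
def permS {k : ℕ} (π : Equiv.Perm (Fin k)) : Sch d k →L[ℂ] Sch d k :=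
  SchwartzMap.compCLMOfContinuousLinearEquiv ℂ
    (LinearEquiv.funCongrLeft ℝ (Pt d) π).toContinuousLinearEquiv

@[simp] theorem permS_apply {k : ℕ} (π : Equiv.Perm (Fin k)) (f : Sch d k) (x : Conf d k) :
    permS π f x = f (fun i => x (π i)) := rfl

/-- The symmetrization `Sym_k(f) = (1/k!) ∑_π π f` of a function. -/
def symS (k : ℕ) : Sch d k →L[ℂ] Sch d k :=
  ((k.factorial : ℂ)⁻¹) • ∑ π : Equiv.Perm (Fin k), permS π

/-- The function `1` on the one-point space `(ℝ^d)^0`. -/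
def oneS : Sch d 0 :=
  HasCompactSupport.toSchwartzMap (f := fun _ : Conf d 0 => (1 : ℂ))
    (HasCompactSupport.of_compactSpace _) contDiff_const

/-- `φ^{⊗k}(x₁, …, x_k) = φ(x₁) ⋯ φ(x_k)`. -/
def tensorPow (φ : 𝓢(Pt d, ℂ)) : (k : ℕ) → Sch d k
  | 0 => oneS
  | k + 1 => SchwartzMap.compCLMOfContinuousLinearEquiv ℂ
      (Fin.consEquivL ℝ (fun _ : Fin (k + 1) => Pt d)).symm (tensor φ (tensorPow φ k))

theorem tensorPow_apply (φ : 𝓢(Pt d, ℂ)) (k : ℕ) (x : Conf d k) :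
    tensorPow φ k x = ∏ i, φ (x i) := by
  induction k with
  | zero => simp [tensorPow, oneS]
  | succ k ih =>
    rw [Fin.prod_univ_succ, ← ih (fun i => x i.succ)]
    rfl

/-! ### Distribution-valued operators -/

/-- Distribution-valued operators `𝓛(𝓢(ℝ^{dk}), 𝓢'(ℝ^{dk}))`: continuous linear maps into the
strong dual. `A f g` is the (bilinear) distributional pairing `⟨A f, g⟩`. -/
abbrev DVO (d k : ℕ) : Type := Sch d k →L[ℂ] (Sch d k →L[ℂ] ℂ)

open scoped Classical in
/-- The Schwartz kernel `K_A ∈ 𝓢'(ℝ^{dk} × ℝ^{dk})` of `A`, i.e. the unique tempered distribution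
with `⟨K_A, g ⊗ f⟩ = ⟨A f, g⟩` (it exists by the Schwartz kernel theorem). -/
def schwartzKernel {k : ℕ} (A : DVO d k) : Ker d k →L[ℂ] ℂ :=
  if h : ∃ K : Ker d k →L[ℂ] ℂ, ∀ f g : Sch d k, K (tensor g f) = A f g then h.choose else 0

/-- Generalized trace `Tr(A γ) = ⟨K_A, γ^t⟩`; for `γ = |f⟩⟨h|` this is `⟨A f, conj h⟩`. -/
def genTrace {k : ℕ} (A : DVO d k) (γ : Ker d k) : ℂ := schwartzKernel A (transposeS γ)

theorem contDiff_and_growth_of_affine {V W : Type*} [NormedAddCommGroup V] [NormedSpace ℝ V]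
    [NormedAddCommGroup W] [NormedSpace ℝ W] (L : V →L[ℝ] W) (c : W) :
    (fun v => L v + c).HasTemperateGrowth :=
  L.hasTemperateGrowth.add (Function.HasTemperateGrowth.const c)

/-- Pull-back of a Schwartz function along an affine map `v ↦ L v + c` bounded below. -/
def pullAffine {V W : Type*} [NormedAddCommGroup V] [NormedSpace ℝ V]
    [NormedAddCommGroup W] [NormedSpace ℝ W] (L : V →L[ℝ] W) (c : W)
    (h : ∀ v, ‖v‖ ≤ ‖L v + c‖) (f : 𝓢(W, ℂ)) : 𝓢(V, ℂ) :=
  SchwartzMap.compCLM ℂ (g := fun v => L v + c) (contDiff_and_growth_of_affine L c)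
    ⟨1, 1, fun v => by
      have := h v
      have h0 := norm_nonneg (L v + c)
      simp only [pow_one, one_mul]
      linarith⟩ f

@[simp] theorem pullAffine_apply {V W : Type*} [NormedAddCommGroup V] [NormedSpace ℝ V]
    [NormedAddCommGroup W] [NormedSpace ℝ W] (L : V →L[ℝ] W) (c : W)
    (h : ∀ v, ‖v‖ ≤ ‖L v + c‖) (f : 𝓢(W, ℂ)) (v : V) :
    pullAffine L c h f v = f (L v + c) := rfl

/-- The linear map that sets the coordinate `α` to zero. -/
def zeroAt {k : ℕ} (α : Fin k) : Conf d k →L[ℝ] Conf d k :=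
  ContinuousLinearMap.pi fun i => if i = α then 0 else ContinuousLinearMap.proj i

/-- `φ ⊗_α g(·, x', ·)`, the Schwartz function
`y ↦ φ(y_α) g(y₁, …, y_{α-1}, x', y_{α+1}, …, y_k)` on `ℝ^{dk}`. -/
def slot {k : ℕ} (α : Fin k) (φ : 𝓢(Pt d, ℂ)) (g : Sch d k) (x' : Pt d) : Sch d k :=
  pullAffine ((ContinuousLinearMap.proj α).prod (zeroAt α)) (0, Pi.single α x')
    (by
      intro v
      refine (pi_norm_le_iff_of_nonneg (norm_nonneg _)).2 fun i => ?_
      by_cases hi : i = α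
      · subst hi
        refine le_trans ?_ (norm_fst_le _)
        simp
      · refine le_trans ?_ (norm_snd_le _)
        refine le_trans ?_ (norm_le_pi_norm _ i)
        simp [zeroAt, hi])
    (tensor φ g)

theorem slot_apply {k : ℕ} (α : Fin k) (φ : 𝓢(Pt d, ℂ)) (g : Sch d k) (x' : Pt d)
    (y : Conf d k) : slot α φ g x' y = φ (y α) * g (Function.update y α x') := by
  simp only [slot, pullAffine_apply, tensor_apply]
  congr 2
  · simp
  · funext i
    by_cases hi : i = α
    · subst hi; simp [zeroAt]
    · simp [zeroAt, hi]

/-- The good mapping property: for each coordinate `α` the bilinear map sending `(f, g)` to the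
partial pairing
`∫ dx₁ … dx_{α-1} dx_{α+1} … dx_k (A f)(x₁, …, x_k) g(x₁, …, x_α', …, x_k)`,
a priori a distribution in `x_α` depending on `x_α'`, is a continuous bilinear map into
`𝓢(ℝ^d × ℝ^d)`. -/
def HasGMP {k : ℕ} (A : DVO d k) : Prop :=
  ∀ α : Fin k, ∃ Φ : Sch d k →ₗ[ℂ] Sch d k →ₗ[ℂ] 𝓢(Pt d × Pt d, ℂ),
    (Continuous fun p : Sch d k × Sch d k => Φ p.1 p.2) ∧
    ∀ (f g : Sch d k) (φ : 𝓢(Pt d, ℂ)) (x' : Pt d),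
      A f (slot α φ g x') = ∫ x, Φ f g (x, x') * φ x

open scoped Classical in
/-- For `B` with the good mapping property, the Schwartz function of `(x_β, x_β')` obtained by
pairing `B f` with `g` in all coordinates but the `β`-th. -/
def partialKernel {k : ℕ} (B : DVO d k) (β : Fin k) (f g : Sch d k) : 𝓢(Pt d × Pt d, ℂ) :=
  if h : ∃ Ψ : 𝓢(Pt d × Pt d, ℂ), ∀ (φ : 𝓢(Pt d, ℂ)) (x' : Pt d),
      B f (slot β φ g x') = ∫ x, Ψ (x, x') * φ x then h.choose else 0

/-! ### The contraction `A ∘_α^β B`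

Hierarchies are indexed by `n : ℕ`, the component `n` living on `n + 1` particles. Thus for an
`(a+1)`-particle and a `(b+1)`-particle operator, `(a+1) + (b+1) - 1 = n + 1` is `a + b = n`. -/

/-- For a `(b+1)`-particle operator acting on the coordinates
`(a+2, …, a+β, α, a+β+1, …)` of `n + 1 = a + b + 1` particles (the entry `α` standing at the
`β`-th place), with `x ∈ (ℝ^d)^{a+1}` in the first `a+1` coordinates: the linear part, in
`y ∈ (ℝ^d)^{b+1}`, of the joint configuration. -/
def glueL {a b n : ℕ} (h : a + b = n) (α : Fin (a + 1)) (β : Fin (b + 1)) :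
    Conf d (b + 1) →L[ℝ] Conf d (n + 1) :=
  ContinuousLinearMap.pi fun i =>
    if hi : (i : ℕ) < a + 1 then
      if (⟨i, hi⟩ : Fin (a + 1)) = α then ContinuousLinearMap.proj β else 0
    else ContinuousLinearMap.proj (β.succAbove ⟨(i : ℕ) - (a + 1), by omega⟩)

/-- The part of the joint configuration that depends on `x`. -/
def glueC {a b n : ℕ} (_h : a + b = n) (α : Fin (a + 1)) (x : Conf d (a + 1)) :
    Conf d (n + 1) := fun i =>
  if hi : (i : ℕ) < a + 1 then
    if (⟨i, hi⟩ : Fin (a + 1)) = α then 0 else x ⟨i, hi⟩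
  else 0

/-- The joint configuration of `n + 1` particles: its first `a + 1` coordinates are those of `x`
with the `α`-th one replaced by `y_β`, the last `b` are the `y_j`, `j ≠ β`, in order. -/
def glue {a b n : ℕ} (h : a + b = n) (α : Fin (a + 1)) (β : Fin (b + 1))
    (x : Conf d (a + 1)) (y : Conf d (b + 1)) : Conf d (n + 1) := fun i =>
  if hi : (i : ℕ) < a + 1 then
    if (⟨i, hi⟩ : Fin (a + 1)) = α then y β else x ⟨i, hi⟩
  else y (β.succAbove ⟨(i : ℕ) - (a + 1), by omega⟩)

theorem glue_eq {a b n : ℕ} (h : a + b = n) (α : Fin (a + 1)) (β : Fin (b + 1))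
    (x : Conf d (a + 1)) (y : Conf d (b + 1)) :
    glueL h α β y + glueC h α x = glue h α β x y := by
  funext i
  simp only [glueL, glueC, glue, Pi.add_apply, ContinuousLinearMap.coe_pi']
  split_ifs <;> simp

/-- `f` as a function of the coordinates `(a+2, …, a+β, α, a+β+1, …)` for fixed values `x` of
the other ones: `y ↦ f (glue x y)`. It does not depend on `x_α`. -/
def freeze {a b n : ℕ} (h : a + b = n) (α : Fin (a + 1)) (β : Fin (b + 1))
    (x : Conf d (a + 1)) (f : Sch d (n + 1)) : Sch d (b + 1) :=
  pullAffine (glueL h α β) (glueC h α x)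
    (by
      intro y
      rw [glue_eq]
      refine (pi_norm_le_iff_of_nonneg (norm_nonneg _)).2 fun j => ?_
      rcases eq_or_ne j β with hj | hj
      · subst hj
        have hα : (α : ℕ) < n + 1 := by omega
        refine le_trans (le_of_eq ?_) (norm_le_pi_norm _ (⟨α, hα⟩ : Fin (n + 1)))
        simp [glue, Nat.lt_succ_iff.1 α.2]
      · obtain ⟨m, rfl⟩ := Fin.exists_succAbove_eq hj
        have hm : a + 1 + (m : ℕ) < n + 1 := by omega
        refine le_trans (le_of_eq ?_) (norm_le_pi_norm _ (⟨a + 1 + m, hm⟩ : Fin (n + 1)))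
        have hm' : ¬ a + 1 + (m : ℕ) ≤ a := by omega
        simp [glue, hm'])
    f

theorem freeze_apply {a b n : ℕ} (h : a + b = n) (α : Fin (a + 1)) (β : Fin (b + 1))
    (x : Conf d (a + 1)) (f : Sch d (n + 1)) (y : Conf d (b + 1)) :
    freeze h α β x f y = f (glue h α β x y) := by
  simp only [freeze, pullAffine_apply, glue_eq]

open scoped Classical in
/-- The function `Φ_{B,α,β}(f, g) ∈ 𝓢(ℝ^{d(a+1)} × ℝ^{d(a+1)})` of `(x; x')` obtained by applying
`B` to `f` in the coordinates `(a+2, …, a+β, α, a+β+1, …)`, evaluating the first `a + 1` output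
variables at `x`, and pairing the remaining `b` of them with `g(x', ·)`. -/
def contrKernel {a b n : ℕ} (h : a + b = n) (B : DVO d (b + 1)) (α : Fin (a + 1))
    (β : Fin (b + 1)) (f g : Sch d (n + 1)) : Ker d (a + 1) :=
  if H : ∃ T : Ker d (a + 1), ∀ x x' : Conf d (a + 1), T (x, x') =
      partialKernel B β (freeze h α β x f) (freeze h α β x' g) (x α, x' α)
  then H.choose else 0

open scoped Classical in
/-- The contraction
`A ∘_α^β B = A_{(1, …, i)} B_{(i+1, …, i+β-1, α, i+β, …, k)}`, `i = a + 1`, `k = n + 1`, given by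
`⟨(A ∘_α^β B) f, g⟩ = ⟨K_A, Φ_{B,α,β}(f, g)^t⟩`. -/
def contraction {a b n : ℕ} (h : a + b = n) (A : DVO d (a + 1)) (B : DVO d (b + 1))
    (α : Fin (a + 1)) (β : Fin (b + 1)) : DVO d (n + 1) :=
  if H : ∃ C : DVO d (n + 1), ∀ f g : Sch d (n + 1),
      C f g = schwartzKernel A (transposeS (contrKernel h B α β f g))
  then H.choose else 0

/-- `[A, B]₁ = ∑_{α,β} (A ∘_α^β B - B ∘_β^α A)`. -/
def comm1 {a b n : ℕ} (h : a + b = n) (A : DVO d (a + 1)) (B : DVO d (b + 1)) :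
    DVO d (n + 1) :=
  ∑ α : Fin (a + 1), ∑ β : Fin (b + 1),
    (contraction h A B α β - contraction ((Nat.add_comm b a).trans h) B A β α)

/-- `π A π⁻¹`, i.e. `⟨π A π⁻¹ f, g⟩ = ⟨A (π⁻¹ f), π⁻¹ g⟩`. -/
def permOp {k : ℕ} (π : Equiv.Perm (Fin k)) (A : DVO d k) : DVO d k :=
  ((ContinuousLinearMap.precomp ℂ (permS π⁻¹ : Sch d k →L[ℂ] Sch d k)).comp A).comp (permS π⁻¹)

@[simp] theorem permOp_apply {k : ℕ} (π : Equiv.Perm (Fin k)) (A : DVO d k) (f g : Sch d k) :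
    permOp π A f g = A (permS π⁻¹ f) (permS π⁻¹ g) := rfl

/-- The bosonic symmetrization `Sym_k(A) = (1/k!) ∑_π π A π⁻¹`, restricted to symmetric
functions. As everywhere below, an operator on symmetric functions is represented by its
canonical extension to all functions, its composition with `symS k`. -/
def symOp {k : ℕ} (A : DVO d k) : DVO d k :=
  (((k.factorial : ℂ)⁻¹) • ∑ π : Equiv.Perm (Fin k), permOp π A).comp (symS k)

/-- The bracket `[A, B]^{(k)} = Sym_k (∑_{ℓ + j - 1 = k} [A^{(ℓ)}, B^{(j)}]₁)`. -/
def hierBracket (A B : ∀ n, DVO d (n + 1)) (n : ℕ) : DVO d (n + 1) :=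
  symOp (∑ p ∈ (Finset.HasAntidiagonal.antidiagonal n).attach,
    comm1 (Finset.HasAntidiagonal.mem_antidiagonal.1 p.2) (A p.1.1) (B p.1.2))

/-! ### Observable hierarchies and density matrix hierarchies -/

/-- `A ∈ 𝔤_{k,gmp}`: a skew-adjoint operator in `𝓛_gmp(𝓢_s(ℝ^{dk}), 𝓢_s'(ℝ^{dk}))`. The bosonic
operator (an operator on symmetric functions with symmetric distributions as values) is
represented by its canonical extension `A ∘ Sym_k`, i.e. by an operator on all functions such
that `A f` depends only on the symmetrization of `f` and is a symmetric distribution. -/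
structure IsObservable {k : ℕ} (A : DVO d k) : Prop where
  gmp : HasGMP A
  symm_right : ∀ (π : Equiv.Perm (Fin k)) (f g : Sch d k), A (permS π f) g = A f g
  symm_left : ∀ (π : Equiv.Perm (Fin k)) (f g : Sch d k), A f (permS π g) = A f g
  /-- With `⟨f | A g⟩ = A g (conj f)`, this is `⟨f | A g⟩ = - conj ⟨g | A f⟩`. -/
  skew : ∀ f g : Sch d k, A g (conjS f) = -(starRingEnd ℂ) (A f (conjS g))

variable (d) in
/-- Observable `∞`-hierarchies `𝔊_∞ = ⨁_k 𝔤_{k,gmp}`. -/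
def GInf : Set (∀ n, DVO d (n + 1)) :=
  {A | (∀ n, IsObservable (A n)) ∧ {n | A n ≠ 0}.Finite}

variable (d) in
/-- Density matrix `∞`-hierarchies `𝔊_∞^*`: sequences of self-adjoint operators with kernels in
`𝓢_{s,s}(ℝ^{dk} × ℝ^{dk})`, with the product topology. -/
def GInfStar : Submodule ℝ (∀ n, Ker d (n + 1)) where
  carrier := {Γ | ∀ (n : ℕ) (x x' : Conf d (n + 1)),
    (∀ π : Equiv.Perm (Fin (n + 1)),
      Γ n (fun i => x (π i), x') = Γ n (x, x') ∧ Γ n (x, fun i => x' (π i)) = Γ n (x, x')) ∧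
    Γ n (x', x) = (starRingEnd ℂ) (Γ n (x, x'))}
  add_mem' := by
    intro a b ha hb n x x'
    refine ⟨fun π => ⟨?_, ?_⟩, ?_⟩
    · simp [((ha n x x').1 π).1, ((hb n x x').1 π).1]
    · simp [((ha n x x').1 π).2, ((hb n x x').1 π).2]
    · simp [(ha n x x').2, (hb n x x').2]
  zero_mem' := by
    intro n x x'
    simp
  smul_mem' := by
    intro c a ha n x x'
    refine ⟨fun π => ⟨?_, ?_⟩, ?_⟩
    · simp [((ha n x x').1 π).1]
    · simp [((ha n x x').1 π).2]
    · simp [(ha n x x').2]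

/-- `Tr(A · Γ) = ∑_k Tr_{1,…,k}(A^{(k)} γ^{(k)})` (a finite sum when `A` has finitely many nonzero
components). -/
def traceHier (A : ∀ n, DVO d (n + 1)) (Γ : GInfStar d) : ℂ :=
  ∑ᶠ n, genTrace (A n) (Γ.1 n)

variable (d) in
/-- `𝒜_∞`: the algebra generated by the trace functionals `i Tr(A ·)`, `A ∈ 𝔊_∞`, and the
constants. -/
def AInf : Subalgebra ℝ (GInfStar d → ℝ) :=
  Algebra.adjoin ℝ
    ({F | IsSmooth F ∧ ∃ A ∈ GInf d, ∀ Γ, (F Γ : ℂ) = Complex.I * traceHier A Γ} ∪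
      {F | IsSmooth F ∧ ∃ c : ℝ, ∀ Γ, F Γ = c})

open scoped Classical in
/-- The Gâteaux derivative `dF[Γ]` as an observable `∞`-hierarchy, through the trace pairing:
`dF[Γ](v) = i Tr(dF[Γ] · v)`. -/
def diffRep (F : GInfStar d → ℝ) (Γ : GInfStar d) : ∀ n, DVO d (n + 1) :=
  if h : ∃ D ∈ GInf d, ∀ v : GInfStar d,
      HasGateauxDeriv (fun Γ => (F Γ : ℂ)) Γ v (Complex.I * traceHier D v)
  then h.choose else 0

/-- The Lie–Poisson bracket `{F, G}(Γ) = i Tr([dF[Γ], dG[Γ]] · Γ)` on `𝔊_∞^*`. -/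
def poissonInf (F G : GInfStar d → ℝ) (Γ : GInfStar d) : ℂ :=
  Complex.I * traceHier (hierBracket (diffRep F Γ) (diffRep G Γ)) Γ

/-! ### The phase space of the nonlinear Schrödinger equation -/

/-- The symplectic form `ω(f, g) = 2 Im ∫ conj(f) g`. -/
def omegaL2 (f g : 𝓢(Pt d, ℂ)) : ℝ := 2 * (∫ x, (starRingEnd ℂ) (f x) * g x).im

variable (d) in
/-- `𝒜_𝒮`: the smooth real functionals `H` on `𝓢(ℝ^d)` with a smooth symplectic gradient
`X : 𝓢(ℝ^d) → 𝓢(ℝ^d)`, `dH[φ](δ) = ω(X(φ), δ)`. -/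
def AS : Set (𝓢(Pt d, ℂ) → ℝ) :=
  {H | IsSmooth H ∧ ∃ X : 𝓢(Pt d, ℂ) → 𝓢(Pt d, ℂ), IsSmooth X ∧
    ∀ φ δ, HasGateauxDeriv H φ δ (omegaL2 (X φ) δ)}

open scoped Classical in
/-- The symplectic `L²` gradient `∇_s F(φ)`, determined by `dF[φ](δ) = ω(∇_s F(φ), δ)`. -/
def symGrad (F : 𝓢(Pt d, ℂ) → ℝ) (φ : 𝓢(Pt d, ℂ)) : 𝓢(Pt d, ℂ) :=
  if h : ∃ g : 𝓢(Pt d, ℂ), ∀ δ, HasGateauxDeriv F φ δ (omegaL2 g δ) then h.choose else 0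

/-- The bracket `{F, G}_{L²}(φ) = ω(∇_s F(φ), ∇_s G(φ))`. -/
def poissonL2 (F G : 𝓢(Pt d, ℂ) → ℝ) (φ : 𝓢(Pt d, ℂ)) : ℝ :=
  omegaL2 (symGrad F φ) (symGrad G φ)

/-- The embedding `ι(φ) = (|φ^{⊗k}⟩⟨φ^{⊗k}|)_k`, where `|f⟩⟨g|` has kernel `f(x) conj(g(x'))`. -/
def iota (φ : 𝓢(Pt d, ℂ)) : GInfStar d :=
  ⟨fun n => tensor (tensorPow φ (n + 1)) (conjS (tensorPow φ (n + 1))), by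
    intro n x x'
    refine ⟨fun π => ⟨?_, ?_⟩, ?_⟩
    · simp only [tensor_apply, conjS_apply, tensorPow_apply,
        Equiv.prod_comp π fun i => φ (x i)]
    · simp only [tensor_apply, conjS_apply, tensorPow_apply,
        Equiv.prod_comp π fun i => φ (x' i)]
    · simp only [tensor_apply, conjS_apply, map_mul, Complex.conj_conj]
      ring⟩

end GPPoisson

end

/-! On a factorized state everything reduces to one-particle functions. For a skew-adjoint bosonic
k-particle operator A, the good mapping property in one slot gives a Schwartz function u_A(φ)
(`oneBody`) with ⟨A φ^{⊗k}, ψ ⊗ conj(φ)^{⊗(k-1)}⟩ = ∫ u_A(φ) ψ. Differentiating i⟨A φ^{⊗k},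
conj(φ)^{⊗k}⟩ produces k terms of this kind and k terms that skew-adjointness turns into minus their
conjugates. Hence the symplectic gradient is k u_A(φ) (`IsObservable.hasGateauxDeriv`), and it is
smooth because u_A(φ) is a continuous bilinear map evaluated on tensor powers.

For the bracket, the kernel entering A ∘_α^β B is, on factorized states, |φ ⊗ … ⊗ u_B ⊗ … ⊗
φ⟩⟨φ^{⊗i}| with u_B at place α (`IsObservable.contrKernel_tensorPow`). Pairing with A and using
skew-adjointness gives -∫ u_B conj(u_A), whatever α and β are. The i·j commutator terms therefore
add up to ω(i u_A, j u_B), up to the factor i of the trace pairing (`IsObservable.comm1_tensorPow`).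
Symmetrization does nothing on tensor powers, so summing over particle numbers gives ω of the two
gradients (`trace_hierBracket_iota`).

The passage to the algebra is an induction whose invariant is `HasGradient`: it couples the gradient
of F ∘ ι with some hierarchy representing dF[ι(φ)]. The representative picked by `diffRep` may be
another one, but its gradient is the same, since the gradient depends only on the functional Γ ↦
Tr(D · Γ) (`gradField_congr`).

Kernels, contractions and derivatives are defined by choice with default 0, so their existence has
to be proved. The main tool is the kernel theorem (`exists_tensor_lift`). Schwartz functions are
expanded in Gabor-type atoms with rapidly decreasing coefficients and polynomially growing
seminorms; atoms and coefficients factor on products, so a continuous bilinear map is extended by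
summing its values on pairs of atoms. Smoothness is handled by a recursive notion `IsCk`, stable
under continuous linear and bilinear maps, from which the iterated derivatives of `IsSmooth` are
extracted. -/

open SchwartzMap Filter Topology MeasureTheory

noncomputable section

namespace GPPoisson

/-! ### Seminorm estimates on Schwartz spaces -/

section Seminorms

variable {E F H : Type*} [NormedAddCommGroup E] [NormedSpace ℝ E]
  [NormedAddCommGroup F] [NormedSpace ℝ F] [NormedAddCommGroup H] [NormedSpace ℝ H]

variable (E) in
/-- The supremum of the Schwartz seminorms with both indices at most `N`. -/
def supSeminorm (N : ℕ) : Seminorm ℂ 𝓢(E, ℂ) :=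
  (Finset.Iic (N, N)).sup (schwartzSeminormFamily ℂ E ℂ)

theorem seminorm_le_supSeminorm {k n N : ℕ} (hk : k ≤ N) (hn : n ≤ N) (f : 𝓢(E, ℂ)) :
    SchwartzMap.seminorm ℂ k n f ≤ supSeminorm E N f := by
  have : (k, n) ∈ Finset.Iic (N, N) := by simp [hk, hn]
  exact Finset.le_sup (f := schwartzSeminormFamily ℂ E ℂ) this f

theorem supSeminorm_le_of_forall {N : ℕ} {f : 𝓢(E, ℂ)} {M : ℝ} (hM : 0 ≤ M)
    (h : ∀ k n, k ≤ N → n ≤ N → SchwartzMap.seminorm ℂ k n f ≤ M) : supSeminorm E N f ≤ M := by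
  refine Seminorm.finset_sup_apply_le hM fun i hi => ?_
  simp only [Finset.mem_Iic, Prod.le_def] at hi
  exact h _ _ hi.1 hi.2

theorem supSeminorm_mono {N M : ℕ} (h : N ≤ M) (f : 𝓢(E, ℂ)) :
    supSeminorm E N f ≤ supSeminorm E M f :=
  supSeminorm_le_of_forall (apply_nonneg _ _) fun _ _ hk hn =>
    seminorm_le_supSeminorm (hk.trans h) (hn.trans h) f

theorem one_add_pow_mul_le_supSeminorm {k n N : ℕ} (hk : k ≤ N) (hn : n ≤ N) (f : 𝓢(E, ℂ))
    (x : E) : (1 + ‖x‖) ^ k * ‖iteratedFDeriv ℝ n f x‖ ≤ 2 ^ N * supSeminorm E N f :=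
  SchwartzMap.one_add_le_sup_seminorm_apply (𝕜 := ℂ) (m := (N, N)) hk hn f x

theorem norm_le_supSeminorm (N : ℕ) (f : 𝓢(E, ℂ)) (x : E) : ‖f x‖ ≤ supSeminorm E N f :=
  (SchwartzMap.norm_le_seminorm ℂ f x).trans
    (seminorm_le_supSeminorm (Nat.zero_le _) (Nat.zero_le _) f)

theorem eq_zero_of_supSeminorm_eq_zero {N : ℕ} {f : 𝓢(E, ℂ)} (h : supSeminorm E N f = 0) :
    f = 0 := by
  ext x
  simpa [h] using norm_le_supSeminorm N f x

theorem continuous_supSeminorm (N : ℕ) : Continuous (supSeminorm E N) :=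
  Seminorm.continuous_finsetSup fun i _ => (schwartz_withSeminorms ℂ E ℂ).continuous_seminorm i

/-- The increasing family `supSeminorm` defines the topology. -/
theorem finset_sup_le_supSeminorm (s : Finset (ℕ × ℕ)) :
    ∃ N, ∀ f : 𝓢(E, ℂ), s.sup (schwartzSeminormFamily ℂ E ℂ) f ≤ supSeminorm E N f := by
  refine ⟨s.sup fun i => max i.1 i.2, fun f => ?_⟩
  refine Seminorm.finset_sup_apply_le (apply_nonneg _ _) fun i hi => ?_
  have : max i.1 i.2 ≤ s.sup fun i => max i.1 i.2 :=
    Finset.le_sup (f := fun i : ℕ × ℕ => max i.1 i.2) hi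
  exact seminorm_le_supSeminorm ((le_max_left _ _).trans this) ((le_max_right _ _).trans this) f

theorem exists_le_supSeminorm_of_continuous {p : Seminorm ℂ 𝓢(E, ℂ)} (hp : Continuous p) :
    ∃ (N : ℕ) (C : ℝ), 0 ≤ C ∧ ∀ f, p f ≤ C * supSeminorm E N f := by
  obtain ⟨s, C, -, h⟩ := Seminorm.bound_of_continuous (schwartz_withSeminorms ℂ E ℂ) p hp
  obtain ⟨N, hN⟩ := finset_sup_le_supSeminorm (E := E) s
  refine ⟨N, C, C.2, fun f => (h f).trans ?_⟩
  exact mul_le_mul_of_nonneg_left (hN f) C.2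

theorem exists_supSeminorm_map_le (L : 𝓢(E, ℂ) →L[ℂ] 𝓢(F, ℂ)) (N : ℕ) :
    ∃ (M : ℕ) (C : ℝ), 0 ≤ C ∧ ∀ f, supSeminorm F N (L f) ≤ C * supSeminorm E M f :=
  exists_le_supSeminorm_of_continuous
    (p := (supSeminorm F N).comp (L : 𝓢(E, ℂ) →ₗ[ℂ] 𝓢(F, ℂ)))
    ((continuous_supSeminorm N).comp L.continuous)

theorem tendsto_nhds_of_supSeminorm {ι : Type*} {l : Filter ι} {u : ι → 𝓢(E, ℂ)} {f : 𝓢(E, ℂ)}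
    (h : ∀ N, Tendsto (fun i => supSeminorm E N (u i - f)) l (𝓝 0)) : Tendsto u l (𝓝 f) := by
  rw [(schwartz_withSeminorms ℂ E ℂ).tendsto_nhds]
  rintro ⟨k, n⟩ ε hε
  filter_upwards [(h (max k n)).eventually_lt_const hε] with i hi
  exact (seminorm_le_supSeminorm (le_max_left _ _) (le_max_right _ _) _).trans_lt hi

theorem tendsto_supSeminorm_sub {ι : Type*} {l : Filter ι} {u : ι → 𝓢(E, ℂ)} {f : 𝓢(E, ℂ)}
    (h : Tendsto u l (𝓝 f)) (N : ℕ) : Tendsto (fun i => supSeminorm E N (u i - f)) l (𝓝 0) := by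
  have := ((continuous_supSeminorm (E := E) N).tendsto (f - f)).comp (h.sub_const f)
  simpa [Function.comp_def] using this

/-- A linear map that is bounded in terms of the seminorms is continuous. -/
theorem continuous_of_supSeminorm_bound (L : 𝓢(E, ℂ) →ₗ[ℂ] 𝓢(F, ℂ))
    (h : ∀ N, ∃ (M : ℕ) (C : ℝ), ∀ f, supSeminorm F N (L f) ≤ C * supSeminorm E M f) :
    Continuous L := by
  refine continuous_iff_continuousAt.2 fun f => tendsto_nhds_of_supSeminorm fun N => ?_
  obtain ⟨M, C, hC⟩ := h N
  have h0 := (tendsto_supSeminorm_sub (f := f) tendsto_id M).const_mul C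
  rw [mul_zero] at h0
  exact squeeze_zero (fun _ => apply_nonneg _ _)
    (fun g => by rw [← map_sub]; exact hC (g - f)) h0

/-- Pull-back along a linear isomorphism. -/
abbrev pullEquiv (g : E ≃L[ℝ] F) : 𝓢(F, ℂ) →L[ℂ] 𝓢(E, ℂ) :=
  SchwartzMap.compCLMOfContinuousLinearEquiv ℂ g

theorem pullEquiv_apply (g : E ≃L[ℝ] F) (f : 𝓢(F, ℂ)) (x : E) : pullEquiv g f x = f (g x) := rfl

variable (E) in
/-- Evaluation at a point. -/
def evalS (x : E) : 𝓢(E, ℂ) →L[ℂ] ℂ :=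
  SchwartzMap.mkCLMtoNormedSpace (fun f => f x) (fun _ _ => rfl) (fun _ _ => rfl)
    ⟨{(0, 0)}, 1, zero_le_one, fun f => by
      simpa using SchwartzMap.norm_le_seminorm ℂ f x⟩

@[simp] theorem evalS_apply (x : E) (f : 𝓢(E, ℂ)) : evalS E x f = f x := rfl

/-! ### Jointly continuous bilinear maps -/

theorem exists_supSeminorm_ball_subset {U : Set 𝓢(E, ℂ)} (hU : U ∈ 𝓝 (0 : 𝓢(E, ℂ))) :
    ∃ (N : ℕ) (δ : ℝ), 0 < δ ∧ ∀ f, supSeminorm E N f < δ → f ∈ U := by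
  obtain ⟨s, δ, hδ, h⟩ := ((schwartz_withSeminorms ℂ E ℂ).mem_nhds_iff _ _).1 hU
  obtain ⟨N, hN⟩ := finset_sup_le_supSeminorm (E := E) s
  exact ⟨N, δ, hδ, fun f hf => h (by
    rw [Seminorm.mem_ball_zero]; exact (hN f).trans_lt hf)⟩

/-- Continuity at the origin maps a product of seminorm balls into the unit ball of `q`; homogeneity
in each variable does the rest. Since `supSeminorm` is a norm, the case where it vanishes is
trivial. -/
theorem exists_bilinear_bound {Y : Type*} [AddCommGroup Y] [Module ℂ Y] [TopologicalSpace Y]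
    (B : 𝓢(E, ℂ) →ₗ[ℂ] 𝓢(F, ℂ) →ₗ[ℂ] Y)
    (hB : Continuous fun p : 𝓢(E, ℂ) × 𝓢(F, ℂ) => B p.1 p.2) {q : Seminorm ℂ Y}
    (hq : Continuous q) :
    ∃ (N : ℕ) (C : ℝ), 0 ≤ C ∧ ∀ f g, q (B f g) ≤ C * supSeminorm E N f * supSeminorm F N g := by
  have h0 : Tendsto (fun p : 𝓢(E, ℂ) × 𝓢(F, ℂ) => q (B p.1 p.2)) (𝓝 (0, 0)) (𝓝 0) := by
    have := (hq.comp hB).tendsto (0, 0)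
    simpa [Function.comp_def] using this
  have h1 := h0.eventually_lt_const zero_lt_one
  rw [nhds_prod_eq, eventually_prod_iff] at h1
  obtain ⟨pa, ha, pb, hb, hab⟩ := h1
  obtain ⟨N₁, δ₁, hδ₁, h₁⟩ := exists_supSeminorm_ball_subset ha
  obtain ⟨N₂, δ₂, hδ₂, h₂⟩ := exists_supSeminorm_ball_subset hb
  -- Each argument is rescaled to size at most half its radius, which keeps the ball conditions
  -- strict; the two halves give the 4.
  refine ⟨max N₁ N₂, 4 / (δ₁ * δ₂), by positivity, fun f g => ?_⟩
  set a := supSeminorm E (max N₁ N₂) f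
  set b := supSeminorm F (max N₁ N₂) g
  have ha0 : 0 ≤ a := apply_nonneg _ _
  have hb0 : 0 ≤ b := apply_nonneg _ _
  rcases ha0.eq_or_lt with hfa | hfa
  · rw [← hfa, eq_zero_of_supSeminorm_eq_zero hfa.symm]; simp
  rcases hb0.eq_or_lt with hgb | hgb
  · rw [← hgb, eq_zero_of_supSeminorm_eq_zero hgb.symm]; simp
  have e₁ : supSeminorm E N₁ (((δ₁ / (2 * a) : ℝ) : ℂ) • f) < δ₁ := by
    rw [map_smul_eq_mul, Complex.norm_real, Real.norm_of_nonneg (by positivity)]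
    calc δ₁ / (2 * a) * supSeminorm E N₁ f ≤ δ₁ / (2 * a) * a := by
          gcongr; exact supSeminorm_mono (le_max_left _ _) f
      _ = δ₁ / 2 := by have := hfa.ne'; field_simp
      _ < δ₁ := by linarith
  have e₂ : supSeminorm F N₂ (((δ₂ / (2 * b) : ℝ) : ℂ) • g) < δ₂ := by
    rw [map_smul_eq_mul, Complex.norm_real, Real.norm_of_nonneg (by positivity)]
    calc δ₂ / (2 * b) * supSeminorm F N₂ g ≤ δ₂ / (2 * b) * b := by
          gcongr; exact supSeminorm_mono (le_max_right _ _) g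
      _ = δ₂ / 2 := by have := hgb.ne'; field_simp
      _ < δ₂ := by linarith
  have e₃ := hab (h₁ _ e₁) (h₂ _ e₂)
  simp only [map_smul, LinearMap.smul_apply, map_smul_eq_mul, Complex.norm_real,
    Real.norm_eq_abs] at e₃
  rw [abs_of_pos (by positivity), abs_of_pos (by positivity)] at e₃
  have e₄ : δ₁ / (2 * a) * (δ₂ / (2 * b)) * q (B f g) < 1 := by linarith
  rw [show δ₁ / (2 * a) * (δ₂ / (2 * b)) = δ₁ * δ₂ / (4 * a * b) by field_simp; ring,
    div_mul_eq_mul_div, div_lt_one (by positivity)] at e₄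
  rw [show 4 / (δ₁ * δ₂) * a * b = 4 * a * b / (δ₁ * δ₂) by ring, le_div_iff₀ (by positivity)]
  linarith

theorem continuous_of_bilinear_bound {Y ι : Type*} [AddCommGroup Y] [Module ℂ Y]
    [TopologicalSpace Y] [IsTopologicalAddGroup Y] {q : SeminormFamily ℂ Y ι} (hq : WithSeminorms q)
    (B : 𝓢(E, ℂ) →ₗ[ℂ] 𝓢(F, ℂ) →ₗ[ℂ] Y)
    (h : ∀ i, ∃ (N : ℕ) (C : ℝ), ∀ f g,
      q i (B f g) ≤ C * supSeminorm E N f * supSeminorm F N g) :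
    Continuous fun p : 𝓢(E, ℂ) × 𝓢(F, ℂ) => B p.1 p.2 := by
  refine continuous_iff_continuousAt.2 fun p => ?_
  rw [ContinuousAt, hq.tendsto_nhds]
  intro i ε hε
  obtain ⟨N, C, hC⟩ := h i
  have key : ∀ x : 𝓢(E, ℂ) × 𝓢(F, ℂ), q i (B x.1 x.2 - B p.1 p.2) ≤
      C * supSeminorm E N (x.1 - p.1) * supSeminorm F N x.2 +
      C * supSeminorm E N p.1 * supSeminorm F N (x.2 - p.2) := by
    intro x
    have : B x.1 x.2 - B p.1 p.2 = B (x.1 - p.1) x.2 + B p.1 (x.2 - p.2) := by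
      simp
    rw [this]
    exact (map_add_le_add _ _ _).trans (add_le_add (hC _ _) (hC _ _))
  have hlim : Tendsto (fun x : 𝓢(E, ℂ) × 𝓢(F, ℂ) =>
      C * supSeminorm E N (x.1 - p.1) * supSeminorm F N x.2 +
      C * supSeminorm E N p.1 * supSeminorm F N (x.2 - p.2)) (𝓝 p) (𝓝 0) := by
    have c : Continuous (fun x : 𝓢(E, ℂ) × 𝓢(F, ℂ) =>
      C * supSeminorm E N (x.1 - p.1) * supSeminorm F N x.2 +
      C * supSeminorm E N p.1 * supSeminorm F N (x.2 - p.2)) := by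
      have h1 := continuous_supSeminorm (E := E) N
      have h2 := continuous_supSeminorm (E := F) N
      fun_prop
    simpa using c.tendsto p
  filter_upwards [hlim.eventually_lt_const hε] with x hx using (key x).trans_lt hx

/-! ### The tensor product as a continuous bilinear map -/

/-- Leibniz rule, with the weight of the pair dominated by the product of the weights so that each
factor keeps its own; the binomial coefficients sum to 2^n. -/
theorem supSeminorm_tensor_le (N : ℕ) : ∃ C : ℝ, ∀ (f : 𝓢(E, ℂ)) (g : 𝓢(F, ℂ)),
    supSeminorm (E × F) N (tensor f g) ≤ C * supSeminorm E N f * supSeminorm F N g := by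
  refine ⟨2 ^ N * 2 * (2 ^ N * 2 ^ N), fun f g => ?_⟩
  set a := supSeminorm E N f
  set b := supSeminorm F N g
  have ha : 0 ≤ a := apply_nonneg _ _
  have hb : 0 ≤ b := apply_nonneg _ _
  refine supSeminorm_le_of_forall (by positivity) fun k n hk hn => ?_
  refine SchwartzMap.seminorm_le_bound ℂ k n _ (by positivity) fun p => ?_
  have hmul := norm_iteratedFDeriv_mul_le (𝕜 := ℝ) (f := fun q : E × F => f q.1)
    (g := fun q : E × F => g q.2) ((f.smooth ⊤).comp contDiff_fst)
    ((g.smooth ⊤).comp contDiff_snd) p (n := n) (by exact_mod_cast le_top)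
  have hk' : ‖p‖ ^ k ≤ (1 + ‖p.1‖) ^ k * (1 + ‖p.2‖) ^ k := by
    rw [← mul_pow]
    refine pow_le_pow_left₀ (norm_nonneg _) ?_ k
    rw [Prod.norm_def]
    have h1 := norm_nonneg p.1
    have h2 := norm_nonneg p.2
    exact max_le (by nlinarith) (by nlinarith)
  have hterm : ∀ i ∈ Finset.range (n + 1), (n.choose i : ℝ) *
      ‖iteratedFDeriv ℝ i (fun q : E × F => f q.1) p‖ *
      ‖iteratedFDeriv ℝ (n - i) (fun q : E × F => g q.2) p‖ ≤
      (n.choose i : ℝ) * (‖iteratedFDeriv ℝ i f p.1‖ * ‖iteratedFDeriv ℝ (n - i) g p.2‖) := by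
    intro i _
    rw [mul_assoc]
    gcongr
    · exact norm_iteratedFDeriv_comp_fst_le f i p
    · exact norm_iteratedFDeriv_comp_snd_le g (n - i) p
  calc ‖p‖ ^ k * ‖iteratedFDeriv ℝ n (tensor f g) p‖
      ≤ ((1 + ‖p.1‖) ^ k * (1 + ‖p.2‖) ^ k) * ∑ i ∈ Finset.range (n + 1), (n.choose i : ℝ) *
        (‖iteratedFDeriv ℝ i f p.1‖ * ‖iteratedFDeriv ℝ (n - i) g p.2‖) := by
        gcongr
        exact hmul.trans (Finset.sum_le_sum hterm)
    _ = ∑ i ∈ Finset.range (n + 1), (n.choose i : ℝ) *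
        (((1 + ‖p.1‖) ^ k * ‖iteratedFDeriv ℝ i f p.1‖) *
          ((1 + ‖p.2‖) ^ k * ‖iteratedFDeriv ℝ (n - i) g p.2‖)) := by
        rw [Finset.mul_sum]
        exact Finset.sum_congr rfl fun i _ => by ring
    _ ≤ ∑ i ∈ Finset.range (n + 1), (n.choose i : ℝ) * ((2 ^ N * a) * (2 ^ N * b)) := by
        refine Finset.sum_le_sum fun i hi => ?_
        have hi' : i ≤ n := Nat.lt_succ_iff.1 (Finset.mem_range.1 hi)
        exact mul_le_mul_of_nonneg_left (mul_le_mul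
          (one_add_pow_mul_le_supSeminorm hk (hi'.trans hn) f _)
          (one_add_pow_mul_le_supSeminorm hk ((Nat.sub_le _ _).trans hn) g _)
          (by positivity) (by positivity)) (by positivity)
    _ = 2 ^ n * ((2 ^ N * a) * (2 ^ N * b)) := by
        rw [← Finset.sum_mul]
        congr 1
        exact_mod_cast Nat.sum_range_choose n
    _ ≤ 2 ^ N * ((2 ^ N * a) * (2 ^ N * b)) := by
        gcongr
        norm_num
    _ ≤ 2 ^ N * 2 * (2 ^ N * 2 ^ N) * a * b := by
        have : 0 ≤ 2 ^ N * (2 ^ N * 2 ^ N) * a * b := by positivity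
        nlinarith

variable (E F) in
/-- The tensor product as a bilinear map. -/
def tensorLM : 𝓢(E, ℂ) →ₗ[ℂ] 𝓢(F, ℂ) →ₗ[ℂ] 𝓢(E × F, ℂ) :=
  LinearMap.mk₂ ℂ tensor
    (fun f f' g => by ext p; simp [add_mul])
    (fun c f g => by ext p; simp [mul_assoc])
    (fun f g g' => by ext p; simp [mul_add])
    (fun c f g => by ext p; simp [mul_left_comm])

theorem continuous_bilinear_of_supSeminorm (B : 𝓢(E, ℂ) →ₗ[ℂ] 𝓢(F, ℂ) →ₗ[ℂ] 𝓢(H, ℂ))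
    (h : ∀ M, ∃ (N : ℕ) (C : ℝ), ∀ f g,
      supSeminorm H M (B f g) ≤ C * supSeminorm E N f * supSeminorm F N g) :
    Continuous fun p : 𝓢(E, ℂ) × 𝓢(F, ℂ) => B p.1 p.2 := by
  refine continuous_of_bilinear_bound (schwartz_withSeminorms ℂ H ℂ) B fun i => ?_
  obtain ⟨N, C, hC⟩ := h (max i.1 i.2)
  exact ⟨N, C, fun f g => (seminorm_le_supSeminorm (le_max_left _ _) (le_max_right _ _) _).trans
    (hC f g)⟩

variable (E F) in
theorem continuous_tensor : Continuous fun p : 𝓢(E, ℂ) × 𝓢(F, ℂ) => tensor p.1 p.2 :=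
  continuous_bilinear_of_supSeminorm (tensorLM E F) fun M =>
    (supSeminorm_tensor_le M).imp' (fun _ => M) fun C hC => ⟨C, hC⟩

/-! ### Slices and translations -/

/-- The slice `f(·, z)` of a Schwartz function on a product. -/
def slice (z : F) (f : 𝓢(E × F, ℂ)) : 𝓢(E, ℂ) :=
  pullAffine (ContinuousLinearMap.inl ℝ E F) (0, z)
    (fun v => by simp) f

@[simp] theorem slice_apply (z : F) (f : 𝓢(E × F, ℂ)) (x : E) : slice z f x = f (x, z) := by
  simp [slice]

/-- Slices decay rapidly in `z` in every Schwartz seminorm. This is the source of the decay of the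
Gabor coefficients in the position index. -/
theorem pow_mul_supSeminorm_slice_le (a N : ℕ) (z : F) (f : 𝓢(E × F, ℂ)) :
    (1 + ‖z‖) ^ a * supSeminorm E N (slice z f) ≤
      2 ^ (a + N) * supSeminorm (E × F) (a + N) f := by
  rw [← le_div_iff₀' (by positivity)]
  refine supSeminorm_le_of_forall (by have := apply_nonneg (supSeminorm (E × F) (a + N)) f
                                      positivity) fun k n hk hn => ?_
  refine SchwartzMap.seminorm_le_bound ℂ k n _
    (by have := apply_nonneg (supSeminorm (E × F) (a + N)) f
        positivity) fun x => ?_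
  rw [le_div_iff₀' (by positivity)]
  have hder : ‖iteratedFDeriv ℝ n (slice z f) x‖ ≤ ‖iteratedFDeriv ℝ n f (x, z)‖ := by
    have e : (slice z f : E → ℂ) = (fun v => f (v + (0, z))) ∘ ContinuousLinearMap.inl ℝ E F := by
      ext v; simp
    have hsm : ContDiff ℝ (⊤ : ℕ∞) fun v : E × F => f (v + (0, z)) :=
      (f.smooth ⊤).comp (contDiff_id.add contDiff_const)
    rw [e, (ContinuousLinearMap.inl ℝ E F).iteratedFDeriv_comp_right hsm x
      (i := n) (by exact_mod_cast le_top), iteratedFDeriv_comp_add_right]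
    refine (ContinuousMultilinearMap.norm_compContinuousLinearMap_le _ _).trans ?_
    simp only [ContinuousLinearMap.inl_apply, Prod.mk_add_mk, add_zero, zero_add]
    refine mul_le_of_le_one_right (norm_nonneg _) ?_
    exact Finset.prod_le_one (fun _ _ => norm_nonneg _)
      (fun _ _ => ContinuousLinearMap.norm_inl_le_one ℝ E F)
  have hn1 : ‖x‖ ≤ 1 + ‖(x, z)‖ := (norm_fst_le (x, z)).trans (by simp)
  have hn2 : 1 + ‖z‖ ≤ 1 + ‖(x, z)‖ := by
    gcongr; exact norm_snd_le (x, z)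
  calc (1 + ‖z‖) ^ a * (‖x‖ ^ k * ‖iteratedFDeriv ℝ n (slice z f) x‖)
      ≤ (1 + ‖(x, z)‖) ^ a * ((1 + ‖(x, z)‖) ^ k * ‖iteratedFDeriv ℝ n f (x, z)‖) := by
        gcongr
    _ = (1 + ‖(x, z)‖) ^ (a + k) * ‖iteratedFDeriv ℝ n f (x, z)‖ := by ring
    _ ≤ _ := one_add_pow_mul_le_supSeminorm (by omega) (by omega) f _

/-- Translations cost only a polynomial factor, by 1 + |x| ≤ (1 + |z|)(1 + |x - z|). Used in
position space and, through the Fourier transform, for modulations. -/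
theorem supSeminorm_compSubConst_le (N : ℕ) (z : E) (f : 𝓢(E, ℂ)) :
    supSeminorm E N (SchwartzMap.compSubConstCLM ℂ z f) ≤
      (1 + ‖z‖) ^ N * (2 ^ N * supSeminorm E N f) := by
  have h0 := apply_nonneg (supSeminorm E N) f
  refine supSeminorm_le_of_forall (by positivity) fun k n hk hn => ?_
  refine SchwartzMap.seminorm_le_bound ℂ k n _ (by positivity) fun x => ?_
  have e : (SchwartzMap.compSubConstCLM ℂ z f : E → ℂ) = fun x => f (x - z) := by
    ext; simp
  rw [e, iteratedFDeriv_comp_sub]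
  have hx : ‖x‖ ≤ (1 + ‖z‖) * (1 + ‖x - z‖) := by
    have h1 := norm_sub_norm_le x z
    nlinarith [norm_nonneg z, norm_nonneg (x - z)]
  calc ‖x‖ ^ k * ‖iteratedFDeriv ℝ n f (x - z)‖
      ≤ ((1 + ‖z‖) * (1 + ‖x - z‖)) ^ k * ‖iteratedFDeriv ℝ n f (x - z)‖ := by gcongr
    _ = (1 + ‖z‖) ^ k * ((1 + ‖x - z‖) ^ k * ‖iteratedFDeriv ℝ n f (x - z)‖) := by
        rw [mul_pow, mul_assoc]
    _ ≤ _ := mul_le_mul (pow_le_pow_right₀ (by simp) hk)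
        (one_add_pow_mul_le_supSeminorm hk hn f _) (by positivity) (by positivity)

/-! ### Absolutely convergent series -/

theorem seminorm_le_tsum_of_hasSum {ι : Type*} {f : ι → 𝓢(H, ℂ)} {G : 𝓢(H, ℂ)}
    (hf : ∀ k n, Summable fun i => SchwartzMap.seminorm ℂ k n (f i))
    (hG : ∀ x, HasSum (fun i => f i x) (G x)) (k n : ℕ) :
    SchwartzMap.seminorm ℂ k n G ≤ ∑' i, SchwartzMap.seminorm ℂ k n (f i) := by
  refine SchwartzMap.seminorm_le_bound ℂ k n _ (tsum_nonneg fun i => apply_nonneg _ _) fun x => ?_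
  have e : (G : H → ℂ) = fun x => ∑' i, f i x := by
    ext x; exact (hG x).tsum_eq.symm
  have hs : ∀ m, ∀ i x, ‖iteratedFDeriv ℝ m (f i) x‖ ≤ SchwartzMap.seminorm ℂ 0 m (f i) :=
    fun m i x => SchwartzMap.norm_iteratedFDeriv_le_seminorm ℂ (f i) m x
  rw [e, iteratedFDeriv_tsum_apply (N := ⊤) (v := fun m i => SchwartzMap.seminorm ℂ 0 m (f i))
    (fun i => (f i).smooth ⊤) (fun m _ => hf 0 m) (fun m i x _ => hs m i x) le_top]
  have hsum : Summable fun i => ‖iteratedFDeriv ℝ n (f i) x‖ :=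
    (hf 0 n).of_nonneg_of_le (fun _ => norm_nonneg _) fun i => hs n i x
  calc ‖x‖ ^ k * ‖∑' i, iteratedFDeriv ℝ n (f i) x‖
      ≤ ‖x‖ ^ k * ∑' i, ‖iteratedFDeriv ℝ n (f i) x‖ := by
        gcongr; exact norm_tsum_le_tsum_norm hsum
    _ = ∑' i, ‖x‖ ^ k * ‖iteratedFDeriv ℝ n (f i) x‖ := tsum_mul_left.symm
    _ ≤ _ := (hsum.mul_left _).tsum_le_tsum
        (fun i => SchwartzMap.le_seminorm ℂ k n (f i) x) (hf k n)

/-- Pointwise convergence becomes convergence in the Schwartz topology: the error of a partial sum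
is the pointwise sum of the tail, whose seminorms are bounded by tails of convergent series. -/
theorem hasSum_of_hasSum_apply {ι : Type*} {f : ι → 𝓢(H, ℂ)} {G : 𝓢(H, ℂ)}
    (hf : ∀ k n, Summable fun i => SchwartzMap.seminorm ℂ k n (f i))
    (hG : ∀ x, HasSum (fun i => f i x) (G x)) : HasSum f G := by
  rw [HasSum, (schwartz_withSeminorms ℂ H ℂ).tendsto_nhds]
  rintro ⟨k, n⟩ ε hε
  have htail := tendsto_tsum_compl_atTop_zero fun i => SchwartzMap.seminorm ℂ k n (f i)
  filter_upwards [htail.eventually_lt_const hε] with s hs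
  refine lt_of_le_of_lt ?_ hs
  rw [schwartzSeminormFamily_apply, ← neg_sub, map_neg_eq_map]
  refine seminorm_le_tsum_of_hasSum (f := fun i : {i // i ∉ s} => f i)
    (fun k n => (hf k n).subtype _) (fun x => ?_) k n
  have h1 := (s.hasSum_compl_iff (f := fun i => f i x) (a := G x - ∑ i ∈ s, f i x)).2
    (by simpa using hG x)
  simpa [sum_apply] using h1

theorem exists_hasSum_of_summable {ι : Type*} {f : ι → 𝓢(H, ℂ)}
    (hf : ∀ k n, Summable fun i => SchwartzMap.seminorm ℂ k n (f i)) :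
    ∃ G : 𝓢(H, ℂ), HasSum f G := by
  have hs : ∀ m, ∀ i x, ‖iteratedFDeriv ℝ m (f i) x‖ ≤ SchwartzMap.seminorm ℂ 0 m (f i) :=
    fun m i x => SchwartzMap.norm_iteratedFDeriv_le_seminorm ℂ (f i) m x
  let G : 𝓢(H, ℂ) :=
    { toFun := fun x => ∑' i, f i x
      smooth' := contDiff_tsum (N := ⊤) (v := fun m i => SchwartzMap.seminorm ℂ 0 m (f i))
        (fun i => (f i).smooth ⊤) (fun m _ => hf 0 m) (fun m i x _ => hs m i x)
      decay' := fun k n => ⟨∑' i, SchwartzMap.seminorm ℂ k n (f i), fun x => by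
        rw [iteratedFDeriv_tsum_apply (N := ⊤) (v := fun m i => SchwartzMap.seminorm ℂ 0 m (f i))
          (fun i => (f i).smooth ⊤) (fun m _ => hf 0 m) (fun m i x _ => hs m i x) le_top]
        have hsum : Summable fun i => ‖iteratedFDeriv ℝ n (f i) x‖ :=
          (hf 0 n).of_nonneg_of_le (fun _ => norm_nonneg _) fun i => hs n i x
        calc ‖x‖ ^ k * ‖∑' i, iteratedFDeriv ℝ n (f i) x‖
            ≤ ‖x‖ ^ k * ∑' i, ‖iteratedFDeriv ℝ n (f i) x‖ := by
              gcongr; exact norm_tsum_le_tsum_norm hsum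
          _ = ∑' i, ‖x‖ ^ k * ‖iteratedFDeriv ℝ n (f i) x‖ := tsum_mul_left.symm
          _ ≤ _ := (hsum.mul_left _).tsum_le_tsum
              (fun i => SchwartzMap.le_seminorm ℂ k n (f i) x) (hf k n)⟩ }
  refine ⟨G, hasSum_of_hasSum_apply hf fun x => ?_⟩
  refine Summable.hasSum (Summable.of_norm ?_)
  exact (hf 0 0).of_nonneg_of_le (fun _ => norm_nonneg _)
    fun i => SchwartzMap.norm_le_seminorm ℂ (f i) x

end Seminorms

/-! ### A smooth partition of unity on the line and Fourier series on a cube -/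

section Bumps

/-- A smooth function supported in `[-1/4, 1/4]` whose translates by `ℤ/4` sum to one. -/
def partitionBump (s : ℝ) : ℝ := Real.smoothTransition (4 * s + 1) - Real.smoothTransition (4 * s)

/-- A smooth function supported in `[-1/2, 1/2]`, equal to one on `[-1/4, 1/4]`. -/
def plateauBump (s : ℝ) : ℝ := Real.smoothTransition (2 - 4 * s) * Real.smoothTransition (2 + 4 * s)

theorem contDiff_partitionBump : ContDiff ℝ (⊤ : ℕ∞) partitionBump :=
  (Real.smoothTransition.contDiff.comp (by fun_prop)).sub
    (Real.smoothTransition.contDiff.comp (by fun_prop))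

theorem contDiff_plateauBump : ContDiff ℝ (⊤ : ℕ∞) plateauBump :=
  (Real.smoothTransition.contDiff.comp (by fun_prop)).mul
    (Real.smoothTransition.contDiff.comp (by fun_prop))

theorem partitionBump_eq_zero {s : ℝ} (hs : 1 / 4 ≤ |s|) : partitionBump s = 0 := by
  unfold partitionBump
  rcases le_abs.1 hs with h | h
  · rw [Real.smoothTransition.one_of_one_le (by linarith),
      Real.smoothTransition.one_of_one_le (by linarith), sub_self]
  · rw [Real.smoothTransition.zero_of_nonpos (by linarith),
      Real.smoothTransition.zero_of_nonpos (by linarith), sub_self]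

theorem plateauBump_eq_zero {s : ℝ} (hs : 1 / 2 ≤ |s|) : plateauBump s = 0 := by
  unfold plateauBump
  rcases le_abs.1 hs with h | h
  · rw [Real.smoothTransition.zero_of_nonpos (by linarith), zero_mul]
  · rw [Real.smoothTransition.zero_of_nonpos (x := 2 + 4 * s) (by linarith), mul_zero]

theorem plateauBump_eq_one {s : ℝ} (hs : |s| ≤ 1 / 4) : plateauBump s = 1 := by
  unfold plateauBump
  obtain ⟨h1, h2⟩ := abs_le.1 hs
  rw [Real.smoothTransition.one_of_one_le (by linarith),
    Real.smoothTransition.one_of_one_le (by linarith), mul_one]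

/-- The translates telescope. Only j = ⌊4s⌋ and its successor can contribute at `s`, and the
intermediate smooth steps cancel. -/
theorem exists_finset_partitionBump (s : ℝ) : ∃ t : Finset ℤ,
    (∀ j ∉ t, partitionBump (s - (j : ℝ) / 4) = 0) ∧
    ∑ j ∈ t, partitionBump (s - (j : ℝ) / 4) = 1 := by
  have h1 := Int.floor_le (4 * s)
  have h2 := Int.lt_floor_add_one (4 * s)
  refine ⟨{⌊4 * s⌋, ⌊4 * s⌋ + 1}, fun j hj => partitionBump_eq_zero ?_, ?_⟩
  · simp only [Finset.mem_insert, Finset.mem_singleton, not_or] at hj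
    rcases lt_or_gt_of_ne hj.1 with h | h
    · have : (j : ℝ) + 1 ≤ ⌊4 * s⌋ := by exact_mod_cast h
      exact le_abs.2 (Or.inl (by linarith))
    · have h' : ⌊4 * s⌋ + 2 ≤ j := by omega
      have : ((⌊4 * s⌋ : ℤ) : ℝ) + 2 ≤ j := by exact_mod_cast h'
      exact le_abs.2 (Or.inr (by linarith))
  · rw [Finset.sum_pair (by omega)]
    unfold partitionBump
    push_cast
    rw [Real.smoothTransition.one_of_one_le (x := 4 * (s - (⌊4 * s⌋ : ℝ) / 4) + 1) (by linarith),
      Real.smoothTransition.zero_of_nonpos (x := 4 * (s - ((⌊4 * s⌋ : ℝ) + 1) / 4)) (by linarith)]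
    ring_nf

end Bumps

/-! ### Fourier series of functions supported in a small cube. -/

section Torus

variable {ι : Type*}

/-- The lattice point with coordinates `m`. -/
def latticePt (m : ι → ℤ) : EuclideanSpace ℝ ι := WithLp.toLp 2 fun i => (m i : ℝ)

@[simp] theorem latticePt_apply (m : ι → ℤ) (i : ι) : latticePt m i = m i := rfl

/-- The section of `ℝ^ι → (ℝ/ℤ)^ι` with values in `(-1/2, 1/2]^ι`. -/
def torusSection (t : UnitAddTorus ι) : EuclideanSpace ℝ ι :=
  WithLp.toLp 2 fun i => ((AddCircle.equivIoc 1 (-1 / 2 : ℝ) (t i) : Set.Ioc _ _) : ℝ)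

theorem torusSection_coe {x : ι → ℝ} (hx : ∀ i, x i ∈ Set.Ioc (-1 / 2 : ℝ) (-1 / 2 + 1)) :
    torusSection (fun i => (x i : UnitAddCircle)) = WithLp.toLp 2 x := by
  unfold torusSection
  congr 1
  funext i
  rw [AddCircle.equivIoc_coe_eq (hx i)]

variable [Fintype ι]

/-- The section jumps only where some coordinate is the class of 1/2, and there `g` vanishes in a
whole neighbourhood because of its small support. -/
theorem continuous_comp_torusSection (g : 𝓢(EuclideanSpace ℝ ι, ℂ))
    (hg : ∀ x, (∃ i, 1 / 4 ≤ |x i|) → g x = 0) : Continuous fun t => g (torusSection t) := by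
  refine continuous_iff_continuousAt.2 fun t => ?_
  by_cases ht : ∃ i, t i = ((-1 / 2 : ℝ) : UnitAddCircle)
  · obtain ⟨i, hi⟩ := ht
    let K : Set UnitAddCircle := (fun s : ℝ => (s : UnitAddCircle)) '' Set.Icc (-1 / 4 : ℝ) (1 / 4)
    have hK : IsClosed K := (isCompact_Icc.image (AddCircle.continuous_mk' 1)).isClosed
    have hiK : t i ∉ K := by
      rintro ⟨s, hs, hst⟩
      rw [hi] at hst
      have e1 := AddCircle.equivIoc_coe_eq (p := (1 : ℝ)) (a := (-1 / 2 : ℝ)) (x := s)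
        ⟨by linarith [hs.1], by linarith [hs.2]⟩
      have e2 := AddCircle.equivIoc_coe_eq (p := (1 : ℝ)) (a := (-1 / 2 : ℝ)) (x := (1 / 2 : ℝ))
        ⟨by norm_num, by norm_num⟩
      -- The fundamental domain (-1/2, 1/2] represents the class of -1/2 by +1/2, which is not in
      -- [-1/4, 1/4].
      have e3 : ((1 / 2 : ℝ) : UnitAddCircle) = ((-1 / 2 : ℝ) : UnitAddCircle) := by
        have := AddCircle.coe_add_period (1 : ℝ) (-1 / 2)
        rw [← this]
        norm_num
      simp only at hst
      rw [hst, ← e3, e2] at e1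
      have := congrArg Subtype.val e1
      simp only at this
      linarith [hs.2]
    have hev : ∀ᶠ t' in 𝓝 t, g (torusSection t') = 0 := by
      have : ∀ᶠ t' in 𝓝 t, t' i ∈ Kᶜ :=
        (continuous_apply i).continuousAt.eventually (hK.isOpen_compl.mem_nhds hiK)
      filter_upwards [this] with t' ht'
      refine hg _ ⟨i, ?_⟩
      by_contra hlt
      push Not at hlt
      refine ht' ⟨torusSection t' i, ⟨?_, ?_⟩, AddCircle.coe_equivIoc⟩
      · linarith [(abs_lt.1 hlt).1]
      · linarith [(abs_lt.1 hlt).2]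
    exact (continuousAt_const (y := (0 : ℂ))).congr (hev.mono fun _ h => h.symm)
  · push Not at ht
    refine g.continuous.continuousAt.comp ?_
    refine (PiLp.continuous_toLp 2 _).continuousAt.comp ?_
    refine continuousAt_pi.2 fun i => ?_
    exact continuous_subtype_val.continuousAt.comp
      (ContinuousAt.comp (f := fun t : UnitAddTorus ι => t i)
        (AddCircle.continuousAt_equivIoc 1 (-1 / 2 : ℝ) (ht i)) (continuous_apply i).continuousAt)

theorem summable_latticePt_pow (ι : Type*) [Fintype ι] :
    ∃ K : ℕ, Summable fun m : ι → ℤ => ((1 + ‖latticePt m‖) ^ K)⁻¹ := by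
  let b := (EuclideanSpace.basisFun ι ℝ).toBasis
  let L : Submodule ℤ (EuclideanSpace ℝ ι) := Submodule.span ℤ (Set.range b)
  refine ⟨Module.finrank ℤ L + 1, ?_⟩
  have hs := ZLattice.summable_norm_pow_inv L (Module.finrank ℤ L + 1) (Nat.lt_succ_self _)
  have hmem : ∀ m : ι → ℤ, latticePt m ∈ L := fun m => by
    have : latticePt m = ∑ i, m i • b i := by
      ext i
      classical
      simp [b, Pi.single_apply]
    rw [this]
    exact Submodule.sum_mem _ fun i _ => L.smul_mem _ (Submodule.subset_span ⟨i, rfl⟩)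
  have hinj : Function.Injective fun m : ι → ℤ => (⟨latticePt m, hmem m⟩ : L) := by
    intro m m' h
    funext i
    have := congrArg (fun z : L => (z : EuclideanSpace ℝ ι) i) h
    simpa using this
  have hs' := hs.comp_injective hinj
  -- The comparison fails only at m = 0, where the inverse norm is 0 by convention; one exceptional
  -- index does no harm.
  refine Summable.of_norm_bounded_eventually (g := fun m : ι → ℤ =>
    ‖latticePt m‖⁻¹ ^ (Module.finrank ℤ L + 1)) hs' ?_
  rw [Filter.eventually_cofinite]
  refine (Set.finite_singleton (0 : ι → ℤ)).subset fun m hm => ?_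
  by_contra h0
  apply hm
  have hpos : 0 < ‖latticePt m‖ := norm_pos_iff.2 fun h => h0 (by
    simp only [Set.mem_singleton_iff]
    funext i
    have := congrArg (fun z : EuclideanSpace ℝ ι => z i) h
    simpa using this)
  rw [norm_inv, norm_pow, Real.norm_of_nonneg (by positivity), inv_pow]
  gcongr
  linarith

theorem prod_fourierChar (a : ι → ℝ) :
    ∏ i, (Real.fourierChar (a i) : ℂ) = (Real.fourierChar (∑ i, a i) : ℂ) := by
  simp only [Real.fourierChar_apply, ← Complex.exp_sum]
  push_cast
  rw [Finset.mul_sum, Finset.sum_mul]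

theorem fourier_latticePt (g : 𝓢(EuclideanSpace ℝ ι, ℂ)) (m : ι → ℤ) :
    FourierTransform.fourier g (latticePt m) =
      ∫ y : ι → ℝ, (∏ i, (Real.fourierChar (-(m i * y i)) : ℂ)) * g (WithLp.toLp 2 y) := by
  rw [SchwartzMap.fourier_coe, Real.fourier_eq, ← (PiLp.volume_preserving_toLp ι).integral_comp
    (MeasurableEquiv.toLp 2 (ι → ℝ)).measurableEmbedding]
  refine integral_congr_ae (Eventually.of_forall fun y => ?_)
  simp only
  rw [prod_fourierChar, Circle.smul_def, smul_eq_mul]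
  simp [PiLp.inner_apply, Finset.sum_neg_distrib]

/-- The Fourier coefficients of the periodization are the values of the Fourier transform at lattice
points, hence absolutely summable. The series represents the periodization, so it equals `g` only
inside the unit cube. -/
theorem hasSum_fourier_latticePt (g : 𝓢(EuclideanSpace ℝ ι, ℂ))
    (hg : ∀ x, (∃ i, 1 / 4 ≤ |x i|) → g x = 0) {x : EuclideanSpace ℝ ι}
    (hx : ∀ i, |x i| < 1 / 2) :
    HasSum (fun m : ι → ℤ => FourierTransform.fourier g (latticePt m) *
      ∏ i, (Real.fourierChar (m i * x i) : ℂ)) (g x) := by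
  let G : C(UnitAddTorus ι, ℂ) := ⟨fun t => g (torusSection t), continuous_comp_torusSection g hg⟩
  have hcoe : ∀ (m : ι → ℤ) (y : ι → ℝ), UnitAddTorus.mFourier m (fun i => (y i : UnitAddCircle)) =
      ∏ i, (Real.fourierChar (m i * y i) : ℂ) := by
    intro m y
    simp only [UnitAddTorus.mFourier, ContinuousMap.coe_mk]
    refine Finset.prod_congr rfl fun i _ => ?_
    rw [fourier_coe_apply, Real.fourierChar_apply]
    push_cast
    congr 1
    ring
  have hcoeff : ∀ m, UnitAddTorus.mFourierCoeff G m = FourierTransform.fourier g (latticePt m) := by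
    intro m
    rw [UnitAddTorus.mFourierCoeff_eq_integral _ _ fun _ => (-1 / 2 : ℝ), fourier_latticePt]
    have hout : ∀ y : ι → ℝ, y ∉ {x : ι → ℝ | ∀ i, x i ∈ Set.Ioc (-1 / 2 : ℝ) (-1 / 2 + 1)} →
        g (WithLp.toLp 2 y) = 0 := by
      intro y hy
      simp only [Set.mem_ofPred_eq, not_forall, Set.mem_Ioc, not_and_or, not_lt, not_le] at hy
      obtain ⟨i, hi⟩ := hy
      refine hg _ ⟨i, ?_⟩
      rcases hi with hi | hi
      · exact le_abs.2 (Or.inr (by simp only; linarith))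
      · exact le_abs.2 (Or.inl (by simp only; linarith))
    rw [← setIntegral_eq_integral_of_forall_compl_eq_zero
      (f := fun y : ι → ℝ => (∏ i, (Real.fourierChar (-(m i * y i)) : ℂ)) * g (WithLp.toLp 2 y))
      (s := {x : ι → ℝ | ∀ i, x i ∈ Set.Ioc (-1 / 2 : ℝ) (-1 / 2 + 1)})]
    · refine setIntegral_congr_fun (MeasurableSet.univ_pi' fun i => (measurableSet_Ioc :
        MeasurableSet (Set.Ioc (-1 / 2 : ℝ) (-1 / 2 + 1)))) fun y hy => ?_
      simp only [G, ContinuousMap.coe_mk, torusSection_coe hy]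
      rw [hcoe, smul_eq_mul]
      simp
    · intro y hy
      rw [hout y hy, mul_zero]
  have hsum : Summable (UnitAddTorus.mFourierCoeff G) := by
    obtain ⟨K, hK⟩ := summable_latticePt_pow ι
    refine Summable.of_norm_bounded (hK.mul_left
      (2 ^ K * supSeminorm _ K (FourierTransform.fourier g))) fun m => ?_
    rw [hcoeff]
    have := one_add_pow_mul_le_supSeminorm (le_refl K) (Nat.zero_le K)
      (FourierTransform.fourier g) (latticePt m)
    rw [norm_iteratedFDeriv_zero] at this
    rw [← div_eq_mul_inv, le_div_iff₀ (by positivity), mul_comm]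
    exact this
  have h := UnitAddTorus.hasSum_mFourier_series_apply_of_summable hsum
    (fun i => (x i : UnitAddCircle))
  have hGx : G (fun i => (x i : UnitAddCircle)) = g x := by
    simp only [G, ContinuousMap.coe_mk]
    rw [torusSection_coe fun i => ?_]
    exact ⟨by linarith [(abs_lt.1 (hx i)).1], by linarith [(abs_lt.1 (hx i)).2]⟩
  rw [hGx] at h
  refine h.congr_fun fun m => ?_
  rw [hcoeff, hcoe, smul_eq_mul]

end Torus

/-! ### Gabor-type expansions of Schwartz functions on `ℝ^ι` -/

section Gabor

variable {ι : Type*} [Fintype ι]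

theorem hasCompactSupport_prod {u : ℝ → ℝ} (hu : ∀ s, 1 / 2 ≤ |s| → u s = 0) :
    HasCompactSupport fun x : EuclideanSpace ℝ ι => ((∏ i, u (x i) : ℝ) : ℂ) := by
  refine HasCompactSupport.intro (K := (EuclideanSpace.equiv ι ℝ).toHomeomorph ⁻¹'
    Set.pi Set.univ fun _ => Set.Icc (-1 / 2 : ℝ) (1 / 2))
    ((Homeomorph.isCompact_preimage _).2 (isCompact_univ_pi fun _ => isCompact_Icc)) ?_
  intro x hx
  simp only [Set.mem_preimage, Set.mem_pi, Set.mem_univ, forall_const, not_forall] at hx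
  obtain ⟨i, hi⟩ := hx
  rw [Finset.prod_eq_zero (Finset.mem_univ i), Complex.ofReal_zero]
  refine hu _ ?_
  by_contra h
  push Not at h
  exact hi ⟨by have := (abs_lt.1 h).1; simp; linarith, by
    have := (abs_lt.1 h).2; simp; linarith⟩

theorem contDiff_prod_coord {u : ℝ → ℝ} (hu : ContDiff ℝ (⊤ : ℕ∞) u) :
    ContDiff ℝ (⊤ : ℕ∞) fun x : EuclideanSpace ℝ ι => ((∏ i, u (x i) : ℝ) : ℂ) := by
  refine Complex.ofRealCLM.contDiff.comp (contDiff_prod fun i _ => hu.comp ?_)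
  exact (EuclideanSpace.proj (𝕜 := ℝ) i).contDiff

/-- The product function `∏ᵢ u(xᵢ)` for smooth `u` supported in `[-1/2, 1/2]`. -/
def prodBump (ι : Type*) [Fintype ι] (u : ℝ → ℝ) (h : ContDiff ℝ (⊤ : ℕ∞) u)
    (hu : ∀ s, 1 / 2 ≤ |s| → u s = 0) : 𝓢(EuclideanSpace ℝ ι, ℂ) :=
  (hasCompactSupport_prod hu).toSchwartzMap (contDiff_prod_coord h)

@[simp] theorem prodBump_apply {u : ℝ → ℝ} (h : ContDiff ℝ (⊤ : ℕ∞) u)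
    (hu : ∀ s, 1 / 2 ≤ |s| → u s = 0) (x : EuclideanSpace ℝ ι) :
    prodBump ι u h hu x = ((∏ i, u (x i) : ℝ) : ℂ) := rfl

variable (ι) in
/-- The analysis window. -/
def window : 𝓢(EuclideanSpace ℝ ι, ℂ) :=
  prodBump ι partitionBump contDiff_partitionBump fun _ hs => partitionBump_eq_zero (by linarith)

variable (ι) in
/-- The synthesis window. -/
def dualWindow : 𝓢(EuclideanSpace ℝ ι, ℂ) :=
  prodBump ι plateauBump contDiff_plateauBump fun _ hs => plateauBump_eq_zero hs

/-- Modulation `f ↦ e^{2πi⟨·, ξ⟩} f`. -/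
def modulate (ξ : EuclideanSpace ℝ ι) (f : 𝓢(EuclideanSpace ℝ ι, ℂ)) : 𝓢(EuclideanSpace ℝ ι, ℂ) :=
  FourierTransform.fourierInvCLM ℂ _
    (SchwartzMap.compSubConstCLM ℂ ξ (FourierTransform.fourierCLM ℂ _ f))

theorem modulate_apply (ξ : EuclideanSpace ℝ ι) (f : 𝓢(EuclideanSpace ℝ ι, ℂ))
    (x : EuclideanSpace ℝ ι) :
    modulate ξ f x = (Real.fourierChar (inner ℝ ξ x) : ℂ) * f x := by
  have h0 : f x = ∫ v, Real.fourierChar (inner ℝ v x) • FourierTransform.fourier f v := by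
    conv_lhs => rw [← FourierTransform.fourierInv_fourier_eq (E := 𝓢(EuclideanSpace ℝ ι, ℂ))
      (F := 𝓢(EuclideanSpace ℝ ι, ℂ)) f]
    rw [SchwartzMap.fourierInv_coe, Real.fourierInv_eq]
  simp only [modulate, FourierTransform.fourierInvCLM_apply, FourierTransform.fourierCLM_apply]
  rw [SchwartzMap.fourierInv_coe, Real.fourierInv_eq, h0, ← integral_const_mul,
    ← integral_add_right_eq_self _ ξ]
  refine integral_congr_ae (Eventually.of_forall fun v => ?_)
  simp only [SchwartzMap.compSubConstCLM_apply, add_sub_cancel_right, inner_add_left,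
    AddChar.map_add_eq_mul, Circle.smul_def, smul_eq_mul, Circle.coe_mul]
  ring

/-- The synthesis atoms `τ_{j/4} M_m η`. -/
def gaborAtom (p : (ι → ℤ) × (ι → ℤ)) : 𝓢(EuclideanSpace ℝ ι, ℂ) :=
  SchwartzMap.compSubConstCLM ℂ ((1 / 4 : ℝ) • latticePt p.1)
      (modulate (latticePt p.2) (dualWindow ι))

theorem gaborAtom_apply (p : (ι → ℤ) × (ι → ℤ)) (x : EuclideanSpace ℝ ι) :
    gaborAtom p x = ∏ i, ((Real.fourierChar (p.2 i * (x i - p.1 i / 4)) : ℂ) *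
      (plateauBump (x i - p.1 i / 4) : ℂ)) := by
  rw [gaborAtom, SchwartzMap.compSubConstCLM_apply, modulate_apply, Finset.prod_mul_distrib,
    prod_fourierChar, dualWindow, prodBump_apply]
  have e : ∀ i, (x - (1 / 4 : ℝ) • latticePt p.1) i = x i - p.1 i / 4 := by
    intro i; simp; ring
  push_cast
  congr 3
  · rw [PiLp.inner_apply]
    refine Finset.sum_congr rfl fun i _ => ?_
    rw [e]
    simp [mul_comm]
  · simp only [e]

/-- The shear `(x, z) ↦ (x, x + z)`. -/
def shear (V : Type*) [NormedAddCommGroup V] [NormedSpace ℝ V] : (V × V) ≃L[ℝ] V × V :=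
  ContinuousLinearEquiv.equivOfInverse
    ((ContinuousLinearMap.fst ℝ V V).prod
      (ContinuousLinearMap.fst ℝ V V + ContinuousLinearMap.snd ℝ V V))
    ((ContinuousLinearMap.fst ℝ V V).prod
      (ContinuousLinearMap.snd ℝ V V - ContinuousLinearMap.fst ℝ V V))
    (fun p => by ext <;> simp) (fun p => by ext <;> simp)

/-- The localized function `(x, z) ↦ χ(x) f(x + z)`. -/
def localize (f : 𝓢(EuclideanSpace ℝ ι, ℂ)) :
    𝓢(EuclideanSpace ℝ ι × EuclideanSpace ℝ ι, ℂ) :=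
  pullEquiv (shear _) (tensor (window ι) f)

theorem slice_localize_apply (f : 𝓢(EuclideanSpace ℝ ι, ℂ)) (z x : EuclideanSpace ℝ ι) :
    slice z (localize f) x = window ι x * f (x + z) := by
  rw [slice_apply]; rfl

/-- The analysis coefficients `𝓕(χ τ_{-j/4} f)(m)`. -/
def gaborCoeff (p : (ι → ℤ) × (ι → ℤ)) (f : 𝓢(EuclideanSpace ℝ ι, ℂ)) : ℂ :=
  FourierTransform.fourier (slice ((1 / 4 : ℝ) • latticePt p.1) (localize f)) (latticePt p.2)

/-- The analysis function is a product over coordinates; with Fubini this makes the coefficients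
multiplicative on tensor products (`gaborCoeff_sum`). -/
theorem gaborCoeff_eq (p : (ι → ℤ) × (ι → ℤ)) (f : 𝓢(EuclideanSpace ℝ ι, ℂ)) :
    gaborCoeff p f = ∫ y : ι → ℝ,
      (∏ i, ((Real.fourierChar (-(p.2 i * y i)) : ℂ) * (partitionBump (y i) : ℂ))) *
        f (WithLp.toLp 2 fun i => y i + p.1 i / 4) := by
  rw [gaborCoeff, fourier_latticePt]
  refine integral_congr_ae (Eventually.of_forall fun y => ?_)
  simp only
  rw [slice_localize_apply, Finset.prod_mul_distrib, window, prodBump_apply, mul_assoc]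
  congr 2
  · push_cast; rfl
  · congr 1
    ext i
    simp
    ring

theorem gaborCoeff_add (p : (ι → ℤ) × (ι → ℤ)) (f g : 𝓢(EuclideanSpace ℝ ι, ℂ)) :
    gaborCoeff p (f + g) = gaborCoeff p f + gaborCoeff p g := by
  have : slice ((1 / 4 : ℝ) • latticePt p.1) (localize (f + g)) =
      slice ((1 / 4 : ℝ) • latticePt p.1) (localize f) +
      slice ((1 / 4 : ℝ) • latticePt p.1) (localize g) := by
    ext x
    rw [add_apply, slice_localize_apply, slice_localize_apply, slice_localize_apply, add_apply,
      mul_add]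
  rw [gaborCoeff, this, FourierTransform.fourier_add]
  rfl

theorem gaborCoeff_smul (p : (ι → ℤ) × (ι → ℤ)) (c : ℂ) (f : 𝓢(EuclideanSpace ℝ ι, ℂ)) :
    gaborCoeff p (c • f) = c * gaborCoeff p f := by
  have : slice ((1 / 4 : ℝ) • latticePt p.1) (localize (c • f)) =
      c • slice ((1 / 4 : ℝ) • latticePt p.1) (localize f) := by
    ext x
    rw [smul_apply, slice_localize_apply, slice_localize_apply, smul_apply, smul_eq_mul,
      smul_eq_mul, mul_left_comm]
  rw [gaborCoeff, this, FourierTransform.fourier_smul]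
  rfl

/-- The size of a phase space lattice point. -/
def phaseWeight (p : (ι → ℤ) × (ι → ℤ)) : ℝ := (1 + ‖latticePt p.1‖) * (1 + ‖latticePt p.2‖)

theorem one_le_phaseWeight (p : (ι → ℤ) × (ι → ℤ)) : 1 ≤ phaseWeight p := by
  have h1 := norm_nonneg (latticePt p.1)
  have h2 := norm_nonneg (latticePt p.2)
  unfold phaseWeight
  nlinarith

variable (ι) in
theorem summable_phaseWeight :
    ∃ K : ℕ, Summable fun p : (ι → ℤ) × (ι → ℤ) => (phaseWeight p ^ K)⁻¹ := by
  obtain ⟨K, hK⟩ := summable_latticePt_pow ι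
  refine ⟨K, ?_⟩
  have := hK.mul_of_nonneg hK (fun _ => by positivity) (fun _ => by positivity)
  refine this.congr fun p => ?_
  rw [phaseWeight, mul_pow, mul_inv]

/-- A modulation is a translation conjugated by the Fourier transform, so the translation estimate
applies twice to one fixed window. -/
theorem supSeminorm_gaborAtom_le (N : ℕ) : ∃ (M : ℕ) (C : ℝ), 0 ≤ C ∧
    ∀ p : (ι → ℤ) × (ι → ℤ), supSeminorm _ N (gaborAtom p) ≤ C * phaseWeight p ^ M := by
  obtain ⟨M, C, hC, hM⟩ := exists_supSeminorm_map_le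
    (FourierTransform.fourierInvCLM ℂ 𝓢(EuclideanSpace ℝ ι, ℂ) (F := 𝓢(EuclideanSpace ℝ ι, ℂ))) N
  set s := supSeminorm _ M (FourierTransform.fourierCLM ℂ
    𝓢(EuclideanSpace ℝ ι, ℂ) (F := 𝓢(EuclideanSpace ℝ ι, ℂ)) (dualWindow ι))
  have hs : 0 ≤ s := apply_nonneg _ _
  refine ⟨N + M, 2 ^ N * (C * (2 ^ M * s)), by positivity, fun p => ?_⟩
  have h1 := supSeminorm_compSubConst_le N ((1 / 4 : ℝ) • latticePt p.1)
    (modulate (latticePt p.2) (dualWindow ι))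
  have h2 : supSeminorm _ N (modulate (latticePt p.2) (dualWindow ι)) ≤
      C * ((1 + ‖latticePt p.2‖) ^ M * (2 ^ M * s)) :=
    (hM _).trans (mul_le_mul_of_nonneg_left (supSeminorm_compSubConst_le M _ _) hC)
  have h3 : ‖(1 / 4 : ℝ) • latticePt p.1‖ ≤ ‖latticePt p.1‖ := by
    rw [norm_smul]
    norm_num
    linarith [norm_nonneg (latticePt p.1)]
  have h4 : (1 + ‖latticePt p.1‖) ≤ phaseWeight p := by
    unfold phaseWeight
    nlinarith [norm_nonneg (latticePt p.1), norm_nonneg (latticePt p.2)]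
  have h5 : (1 + ‖latticePt p.2‖) ≤ phaseWeight p := by
    unfold phaseWeight
    nlinarith [norm_nonneg (latticePt p.1), norm_nonneg (latticePt p.2)]
  have h6 : 0 ≤ phaseWeight p := zero_le_one.trans (one_le_phaseWeight p)
  calc supSeminorm _ N (gaborAtom p)
      ≤ (1 + ‖(1 / 4 : ℝ) • latticePt p.1‖) ^ N *
        (2 ^ N * supSeminorm _ N (modulate (latticePt p.2) (dualWindow ι))) := h1
    _ ≤ phaseWeight p ^ N * (2 ^ N * (C * (phaseWeight p ^ M * (2 ^ M * s)))) := by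
        gcongr
        · linarith
        · refine h2.trans ?_
          gcongr
    _ = _ := by ring

/-- All localized pieces of `f` are slices of the single Schwartz function χ(x) f(x + z). Decay in
frequency comes from the continuity of the Fourier transform on each slice, decay in position from
the slice estimate. -/
theorem phaseWeight_pow_mul_gaborCoeff_le (N : ℕ) : ∃ (M : ℕ) (C : ℝ), 0 ≤ C ∧
    ∀ (p : (ι → ℤ) × (ι → ℤ)) (f : 𝓢(EuclideanSpace ℝ ι, ℂ)),
      phaseWeight p ^ N * ‖gaborCoeff p f‖ ≤ C * supSeminorm _ M f := by
  obtain ⟨M₁, C₁, hC₁, h₁⟩ := exists_supSeminorm_map_le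
    (FourierTransform.fourierCLM ℂ 𝓢(EuclideanSpace ℝ ι, ℂ) (F := 𝓢(EuclideanSpace ℝ ι, ℂ))) N
  obtain ⟨M₂, C₂, hC₂, h₂⟩ := exists_supSeminorm_map_le
    (pullEquiv (shear (EuclideanSpace ℝ ι))) (N + M₁)
  obtain ⟨C₃, h₃⟩ := supSeminorm_tensor_le (E := EuclideanSpace ℝ ι) (F := EuclideanSpace ℝ ι) M₂
  refine ⟨M₂, 4 ^ N * (2 ^ N * C₁ * (2 ^ (N + M₁) * (C₂ * (|C₃| * supSeminorm _ M₂ (window ι))))),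
    by have := apply_nonneg (supSeminorm _ M₂) (window ι); positivity, fun p f => ?_⟩
  have hw := apply_nonneg (supSeminorm _ M₂) (window ι)
  have hf := apply_nonneg (supSeminorm _ M₂) f
  set z := (1 / 4 : ℝ) • latticePt p.1 with hz
  have e1 : (1 + ‖latticePt p.2‖) ^ N * ‖gaborCoeff p f‖ ≤
      2 ^ N * (C₁ * supSeminorm _ M₁ (slice z (localize f))) := by
    have := one_add_pow_mul_le_supSeminorm (le_refl N) (Nat.zero_le N)
      (FourierTransform.fourier (slice z (localize f))) (latticePt p.2)
    rw [norm_iteratedFDeriv_zero] at this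
    exact this.trans (mul_le_mul_of_nonneg_left (h₁ _) (by positivity))
  have e2 := pow_mul_supSeminorm_slice_le N M₁ z (localize f)
  have e3 : supSeminorm _ (N + M₁) (localize f) ≤
      C₂ * (|C₃| * supSeminorm _ M₂ (window ι) * supSeminorm _ M₂ f) := by
    refine (h₂ _).trans (mul_le_mul_of_nonneg_left ((h₃ _ _).trans ?_) hC₂)
    gcongr
    exact le_abs_self _
  -- The lattice of translations has mesh 1/4.
  have e4 : (1 + ‖latticePt p.1‖) ≤ 4 * (1 + ‖z‖) := by
    rw [hz, norm_smul]
    norm_num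
    linarith [norm_nonneg (latticePt p.1)]
  calc phaseWeight p ^ N * ‖gaborCoeff p f‖
      = (1 + ‖latticePt p.1‖) ^ N * ((1 + ‖latticePt p.2‖) ^ N * ‖gaborCoeff p f‖) := by
        rw [phaseWeight, mul_pow, mul_assoc]
    _ ≤ (4 * (1 + ‖z‖)) ^ N * (2 ^ N * (C₁ * supSeminorm _ M₁ (slice z (localize f)))) := by
        gcongr
    _ = 4 ^ N * (2 ^ N * C₁ * ((1 + ‖z‖) ^ N * supSeminorm _ M₁ (slice z (localize f)))) := by
        rw [mul_pow]; ring
    _ ≤ 4 ^ N * (2 ^ N * C₁ * (2 ^ (N + M₁) *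
          (C₂ * (|C₃| * supSeminorm _ M₂ (window ι) * supSeminorm _ M₂ f)))) := by
        refine mul_le_mul_of_nonneg_left (mul_le_mul_of_nonneg_left ?_ (by positivity))
          (by positivity)
        exact e2.trans (mul_le_mul_of_nonneg_left e3 (by positivity))
    _ = _ := by ring

/-- Coefficient decay of order M + K absorbs the growth of order M of the atoms and leaves the
summable weight of order -K. -/
theorem summable_gabor_seminorm (f : 𝓢(EuclideanSpace ℝ ι, ℂ)) (k n : ℕ) :
    Summable fun p : (ι → ℤ) × (ι → ℤ) =>
      SchwartzMap.seminorm ℂ k n (gaborCoeff p f • gaborAtom p) := by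
  obtain ⟨K, hK⟩ := summable_phaseWeight ι
  obtain ⟨M, C, hC, hM⟩ := supSeminorm_gaborAtom_le (ι := ι) (max k n)
  obtain ⟨M', C', hC', hM'⟩ := phaseWeight_pow_mul_gaborCoeff_le (ι := ι) (M + K)
  refine (hK.mul_left (C' * supSeminorm _ M' f * C)).of_nonneg_of_le
    (fun _ => apply_nonneg _ _) fun p => ?_
  have hw : 0 < phaseWeight p := zero_lt_one.trans_le (one_le_phaseWeight p)
  rw [map_smul_eq_mul]
  have h1 : SchwartzMap.seminorm ℂ k n (gaborAtom p) ≤ C * phaseWeight p ^ M :=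
    (seminorm_le_supSeminorm (le_max_left _ _) (le_max_right _ _) _).trans (hM p)
  rw [← div_eq_mul_inv, le_div_iff₀ (by positivity)]
  calc ‖gaborCoeff p f‖ * SchwartzMap.seminorm ℂ k n (gaborAtom p) * phaseWeight p ^ K
      ≤ ‖gaborCoeff p f‖ * (C * phaseWeight p ^ M) * phaseWeight p ^ K := by gcongr
    _ = (phaseWeight p ^ (M + K) * ‖gaborCoeff p f‖) * C := by rw [pow_add]; ring
    _ ≤ C' * supSeminorm _ M' f * C := mul_le_mul_of_nonneg_right (hM' p f) hC

theorem hasSum_partition (x : EuclideanSpace ℝ ι) :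
    HasSum (fun j : ι → ℤ => window ι (x - (1 / 4 : ℝ) • latticePt j)) 1 := by
  classical
  choose t ht0 ht1 using fun i => exists_finset_partitionBump (x i)
  have e : ∀ j : ι → ℤ, window ι (x - (1 / 4 : ℝ) • latticePt j) =
      ((∏ i, partitionBump (x i - (j i : ℝ) / 4) : ℝ) : ℂ) := by
    intro j
    rw [window, prodBump_apply]
    congr 2
    funext i
    congr 1
    simp
    ring
  have h1 : ∑ j ∈ Fintype.piFinset t, window ι (x - (1 / 4 : ℝ) • latticePt j) = 1 := by
    simp only [e]
    rw [← Complex.ofReal_sum, ← Finset.prod_univ_sum t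
      (fun i (j : ℤ) => partitionBump (x i - (j : ℝ) / 4))]
    simp [ht1]
  rw [← h1]
  refine hasSum_sum_of_ne_finset_zero fun j hj => ?_
  rw [Fintype.mem_piFinset, not_forall] at hj
  obtain ⟨i, hi⟩ := hj
  rw [e, Finset.prod_eq_zero (Finset.mem_univ i) (ht0 i _ hi), Complex.ofReal_zero]

/-- For a fixed translation the sum over frequencies is the Fourier series of one localized piece of
`f`, cut off by the dual window; it gives χ(x - j/4) f(x). The sum over translations is then the
partition of unity. -/
theorem hasSum_gabor_apply (f : 𝓢(EuclideanSpace ℝ ι, ℂ)) (x : EuclideanSpace ℝ ι) :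
    HasSum (fun p : (ι → ℤ) × (ι → ℤ) => gaborCoeff p f * gaborAtom p x) (f x) := by
  have hs : Summable fun p : (ι → ℤ) × (ι → ℤ) => gaborCoeff p f * gaborAtom p x :=
    Summable.of_norm_bounded (summable_gabor_seminorm f 0 0) fun p =>
      SchwartzMap.norm_le_seminorm ℂ (gaborCoeff p f • gaborAtom p) x
  have hinner : ∀ j : ι → ℤ, HasSum (fun m : ι → ℤ => gaborCoeff (j, m) f * gaborAtom (j, m) x)
      (window ι (x - (1 / 4 : ℝ) • latticePt j) * f x) := by
    intro j
    set g := slice ((1 / 4 : ℝ) • latticePt j) (localize f) with hg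
    set y := x - (1 / 4 : ℝ) • latticePt j with hy
    have hyi : ∀ i, y i = x i - j i / 4 := by
      intro i; rw [hy]; simp; ring
    have hg0 : ∀ x, (∃ i, 1 / 4 ≤ |x i|) → window ι x = 0 := by
      rintro x ⟨i, hi⟩
      rw [window, prodBump_apply, Finset.prod_eq_zero (Finset.mem_univ i)
        (partitionBump_eq_zero hi), Complex.ofReal_zero]
    have hgy : g y = window ι y * f x := by
      rw [hg, slice_localize_apply, hy, sub_add_cancel]
    have hat : ∀ m, gaborAtom (j, m) x =
        (∏ i, (Real.fourierChar (m i * y i) : ℂ)) * dualWindow ι y := by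
      intro m
      rw [gaborAtom_apply, Finset.prod_mul_distrib, dualWindow, prodBump_apply]
      push_cast
      simp only [hyi]
    -- Outside the small cube the expected value is 0: within the unit cube the Fourier series
    -- itself vanishes, beyond it the dual window removes the periodic copies. Inside the small cube
    -- the dual window equals 1.
    by_cases hin : ∃ i, 1 / 4 < |y i|
    · by_cases hlt : ∀ i, |y i| < 1 / 2
      · have h := hasSum_fourier_latticePt g (fun x hx => by
          rw [hg, slice_localize_apply, hg0 x hx, zero_mul]) hlt
        have h' := h.mul_right (dualWindow ι y)
        rw [hgy, hg0 y (hin.imp fun _ h => h.le), zero_mul, zero_mul] at h'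
        rw [hg0 y (hin.imp fun _ h => h.le), zero_mul]
        exact h'.congr_fun fun m => by rw [hat, ← mul_assoc]; rfl
      · push Not at hlt
        obtain ⟨i, hi⟩ := hlt
        rw [hg0 y (hin.imp fun _ h => h.le), zero_mul]
        have : dualWindow ι y = 0 := by
          rw [dualWindow, prodBump_apply, Finset.prod_eq_zero (Finset.mem_univ i)
            (plateauBump_eq_zero hi), Complex.ofReal_zero]
        simp only [hat, this, mul_zero]
        exact hasSum_zero
    · push Not at hin
      have h := hasSum_fourier_latticePt g (fun x hx => by
          rw [hg, slice_localize_apply, hg0 x hx, zero_mul])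
          (fun i => (hin i).trans_lt (by norm_num))
      have h1 : dualWindow ι y = 1 := by
        rw [dualWindow, prodBump_apply, Finset.prod_eq_one fun i _ => plateauBump_eq_one (hin i),
          Complex.ofReal_one]
      rw [hgy] at h
      exact h.congr_fun fun m => by rw [hat, h1, mul_one]; rfl
  have h1 := hs.hasSum.prod_fiberwise hinner
  have h2 := (hasSum_partition x).mul_right (f x)
  rw [one_mul] at h2
  rw [h2.unique h1]
  exact hs.hasSum

theorem hasSum_gabor (f : 𝓢(EuclideanSpace ℝ ι, ℂ)) :
    HasSum (fun p : (ι → ℤ) × (ι → ℤ) => gaborCoeff p f • gaborAtom p) f :=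
  hasSum_of_hasSum_apply (summable_gabor_seminorm f) fun x => hasSum_gabor_apply f x

end Gabor

/-! ### The kernel theorem: extension of bilinear maps from tensor products -/

section Kernel

/-! ### Factorization of atoms and coefficients over a product of Euclidean spaces. -/

section Coordinates

variable {ι κ : Type*}

variable (ι κ) in
/-- The identification `ℝ^ι × ℝ^κ ≃ ℝ^(ι ⊕ κ)`. -/
def euclideanSum :
    (EuclideanSpace ℝ ι × EuclideanSpace ℝ κ) ≃L[ℝ] EuclideanSpace ℝ (ι ⊕ κ) :=
  ((EuclideanSpace.equiv ι ℝ).prodCongr (EuclideanSpace.equiv κ ℝ)).trans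
    ((ContinuousLinearEquiv.sumPiEquivProdPi ℝ ι κ fun _ => ℝ).symm.trans
      (EuclideanSpace.equiv (ι ⊕ κ) ℝ).symm)

@[simp] theorem euclideanSum_apply_inl (p : EuclideanSpace ℝ ι × EuclideanSpace ℝ κ) (i : ι) :
    euclideanSum ι κ p (Sum.inl i) = p.1 i := rfl

@[simp] theorem euclideanSum_apply_inr (p : EuclideanSpace ℝ ι × EuclideanSpace ℝ κ) (i : κ) :
    euclideanSum ι κ p (Sum.inr i) = p.2 i := rfl

/-- Splitting of phase space lattice points. -/
def splitIndex (ι κ : Type*) : ((ι ⊕ κ → ℤ) × (ι ⊕ κ → ℤ)) ≃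
    ((ι → ℤ) × (ι → ℤ)) × ((κ → ℤ) × (κ → ℤ)) :=
  ((Equiv.sumArrowEquivProdArrow ι κ ℤ).prodCongr (Equiv.sumArrowEquivProdArrow ι κ ℤ)).trans
    (Equiv.prodProdProdComm _ _ _ _)

theorem splitIndex_apply (p : (ι ⊕ κ → ℤ) × (ι ⊕ κ → ℤ)) : splitIndex ι κ p =
    ((p.1 ∘ Sum.inl, p.2 ∘ Sum.inl), (p.1 ∘ Sum.inr, p.2 ∘ Sum.inr)) := rfl

variable [Fintype ι] [Fintype κ]

/-- The windows and characters are products over coordinates, so atoms in the joint variables are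
tensor products of atoms. -/
theorem gaborAtom_sum (p : (ι ⊕ κ → ℤ) × (ι ⊕ κ → ℤ)) :
    pullEquiv (euclideanSum ι κ) (gaborAtom p) =
      tensor (gaborAtom (splitIndex ι κ p).1) (gaborAtom (splitIndex ι κ p).2) := by
  ext x
  rw [pullEquiv_apply, tensor_apply, gaborAtom_apply, gaborAtom_apply, gaborAtom_apply,
    Fintype.prod_sum_type]
  rfl

theorem gaborCoeff_sum (p : (ι ⊕ κ → ℤ) × (ι ⊕ κ → ℤ)) (f : 𝓢(EuclideanSpace ℝ ι, ℂ))
    (g : 𝓢(EuclideanSpace ℝ κ, ℂ)) :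
    gaborCoeff p (pullEquiv (euclideanSum ι κ).symm (tensor f g)) =
      gaborCoeff (splitIndex ι κ p).1 f * gaborCoeff (splitIndex ι κ p).2 g := by
  rw [gaborCoeff_eq, gaborCoeff_eq, gaborCoeff_eq, ← integral_prod_mul,
    ← Measure.volume_eq_prod,
    ← (volume_measurePreserving_sumPiEquivProdPi fun _ : ι ⊕ κ => ℝ).integral_comp
      (MeasurableEquiv.measurableEmbedding _)]
  refine integral_congr_ae (Eventually.of_forall fun y => ?_)
  simp only
  rw [pullEquiv_apply, tensor_apply, Fintype.prod_sum_type, mul_mul_mul_comm]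
  rfl

theorem norm_latticePt_comp_inl_le (m : ι ⊕ κ → ℤ) : ‖latticePt (m ∘ Sum.inl)‖ ≤ ‖latticePt m‖ := by
  rw [EuclideanSpace.norm_eq, EuclideanSpace.norm_eq]
  refine Real.sqrt_le_sqrt ?_
  rw [Fintype.sum_sum_type]
  exact le_add_of_nonneg_right (Finset.sum_nonneg fun _ _ => by positivity)

theorem norm_latticePt_comp_inr_le (m : ι ⊕ κ → ℤ) : ‖latticePt (m ∘ Sum.inr)‖ ≤ ‖latticePt m‖ := by
  rw [EuclideanSpace.norm_eq, EuclideanSpace.norm_eq]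
  refine Real.sqrt_le_sqrt ?_
  rw [Fintype.sum_sum_type]
  exact le_add_of_nonneg_left (Finset.sum_nonneg fun _ _ => by positivity)

theorem phaseWeight_fst_le (p : (ι ⊕ κ → ℤ) × (ι ⊕ κ → ℤ)) :
    phaseWeight (splitIndex ι κ p).1 ≤ phaseWeight p := by
  unfold phaseWeight
  rw [splitIndex_apply]
  gcongr <;> exact norm_latticePt_comp_inl_le _

theorem phaseWeight_snd_le (p : (ι ⊕ κ → ℤ) × (ι ⊕ κ → ℤ)) :
    phaseWeight (splitIndex ι κ p).2 ≤ phaseWeight p := by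
  unfold phaseWeight
  rw [splitIndex_apply]
  gcongr <;> exact norm_latticePt_comp_inr_le _

end Coordinates

/-! ### Atomic expansions on finite-dimensional spaces and extension of bilinear maps. -/

variable {E F H : Type*} [NormedAddCommGroup E] [NormedSpace ℝ E] [FiniteDimensional ℝ E]
  [NormedAddCommGroup F] [NormedSpace ℝ F] [FiniteDimensional ℝ F]
  [NormedAddCommGroup H] [NormedSpace ℝ H]

/-- Phase space lattice points of a finite-dimensional space. -/
abbrev PhaseIndex (E : Type*) [NormedAddCommGroup E] [NormedSpace ℝ E] : Type :=
  (Fin (Module.finrank ℝ E) → ℤ) × (Fin (Module.finrank ℝ E) → ℤ)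

variable (E) in
/-- The atoms transported to a finite-dimensional space. -/
def atom (p : PhaseIndex E) : 𝓢(E, ℂ) := pullEquiv toEuclidean (gaborAtom p)

variable (E) in
/-- The coefficients transported to a finite-dimensional space. -/
def coeff (p : PhaseIndex E) (f : 𝓢(E, ℂ)) : ℂ := gaborCoeff p (pullEquiv toEuclidean.symm f)

theorem hasSum_atom (f : 𝓢(E, ℂ)) : HasSum (fun p => coeff E p f • atom E p) f := by
  have h := (hasSum_gabor (pullEquiv toEuclidean.symm f)).mapL (pullEquiv (toEuclidean (E := E)))
  have e : pullEquiv (toEuclidean (E := E)) (pullEquiv toEuclidean.symm f) = f := by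
    ext x; simp [pullEquiv_apply]
  rw [e] at h
  exact h.congr_fun fun p => by rw [map_smul]; rfl

theorem supSeminorm_atom_le (N : ℕ) : ∃ (M : ℕ) (C : ℝ), 0 ≤ C ∧
    ∀ p : PhaseIndex E, supSeminorm E N (atom E p) ≤ C * phaseWeight p ^ M := by
  obtain ⟨M₁, C₁, hC₁, h₁⟩ := exists_supSeminorm_map_le (pullEquiv (toEuclidean (E := E))) N
  obtain ⟨M, C, hC, h⟩ := supSeminorm_gaborAtom_le (ι := Fin (Module.finrank ℝ E)) M₁
  refine ⟨M, C₁ * C, by positivity, fun p => (h₁ _).trans ?_⟩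
  rw [mul_assoc]
  exact mul_le_mul_of_nonneg_left (h p) hC₁

variable (E F) in
/-- Joint coordinates on a product. -/
def prodCoord : (E × F) ≃L[ℝ]
    EuclideanSpace ℝ (Fin (Module.finrank ℝ E) ⊕ Fin (Module.finrank ℝ F)) :=
  (toEuclidean.prodCongr toEuclidean).trans (euclideanSum _ _)

variable (E F) in
/-- The coefficients of a function on a product in terms of tensor products of atoms. -/
def prodCoeff (p : PhaseIndex E × PhaseIndex F) (T : 𝓢(E × F, ℂ)) : ℂ :=
  gaborCoeff ((splitIndex _ _).symm p) (pullEquiv (prodCoord E F).symm T)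

theorem prodCoeff_tensor (p : PhaseIndex E × PhaseIndex F) (f : 𝓢(E, ℂ)) (g : 𝓢(F, ℂ)) :
    prodCoeff E F p (tensor f g) = coeff E p.1 f * coeff F p.2 g := by
  have e : pullEquiv (prodCoord E F).symm (tensor f g) =
      pullEquiv (euclideanSum _ _).symm
        (tensor (pullEquiv toEuclidean.symm f) (pullEquiv toEuclidean.symm g)) := rfl
  rw [prodCoeff, e, gaborCoeff_sum, Equiv.apply_symm_apply]
  rfl

theorem hasSum_prod_atom (T : 𝓢(E × F, ℂ)) :
    HasSum (fun p : PhaseIndex E × PhaseIndex F =>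
      prodCoeff E F p T • tensor (atom E p.1) (atom F p.2)) T := by
  have h := (hasSum_gabor (pullEquiv (prodCoord E F).symm T)).mapL (pullEquiv (prodCoord E F))
  have e : pullEquiv (prodCoord E F) (pullEquiv (prodCoord E F).symm T) = T := by
    ext x; simp [pullEquiv_apply]
  rw [e, ← (splitIndex _ _).symm.hasSum_iff] at h
  refine h.congr_fun fun p => ?_
  rw [Function.comp_apply, map_smul]
  congr 1
  have h1 := gaborAtom_sum ((splitIndex (Fin (Module.finrank ℝ E))
    (Fin (Module.finrank ℝ F))).symm p)
  rw [Equiv.apply_symm_apply] at h1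
  have h2 : pullEquiv (prodCoord E F) (gaborAtom ((splitIndex _ _).symm p)) =
    pullEquiv (toEuclidean.prodCongr toEuclidean) (pullEquiv (euclideanSum _ _)
      (gaborAtom ((splitIndex _ _).symm p))) := rfl
  rw [h2, h1]
  rfl

/-- Continuous linear maps on `𝓢(E × F)` are determined by their values on tensor products. -/
theorem clm_ext_tensor {Y : Type*} [AddCommGroup Y] [Module ℂ Y] [TopologicalSpace Y] [T2Space Y]
    {K K' : 𝓢(E × F, ℂ) →L[ℂ] Y} (h : ∀ f g, K (tensor f g) = K' (tensor f g)) : K = K' := by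
  ext T
  have h1 := (hasSum_prod_atom T).mapL K
  have h2 := (hasSum_prod_atom T).mapL K'
  simp only [map_smul, h] at h1 h2
  exact h1.unique h2

/-- The values of `B` on pairs of atoms grow at most polynomially in the phase space weight, while
the coefficients of `T` decay to any order. The bound is linear in one seminorm of `T`, which yields
both convergence and continuity of the extension. -/
theorem exists_bound_lift_term (B : 𝓢(E, ℂ) →ₗ[ℂ] 𝓢(F, ℂ) →ₗ[ℂ] 𝓢(H, ℂ))
    (hB : Continuous fun p : 𝓢(E, ℂ) × 𝓢(F, ℂ) => B p.1 p.2) (N : ℕ) :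
    ∃ (M : ℕ) (C : ℝ) (a : PhaseIndex E × PhaseIndex F → ℝ), Summable a ∧ ∀ p T,
      supSeminorm H N (prodCoeff E F p T • B (atom E p.1) (atom F p.2)) ≤
        C * supSeminorm (E × F) M T * a p := by
  obtain ⟨N₁, C₁, hC₁, h₁⟩ := exists_bilinear_bound B hB (continuous_supSeminorm (E := H) N)
  obtain ⟨M₂, C₂, hC₂, h₂⟩ := supSeminorm_atom_le (E := E) N₁
  obtain ⟨M₃, C₃, hC₃, h₃⟩ := supSeminorm_atom_le (E := F) N₁
  obtain ⟨K, hK⟩ := summable_phaseWeight (Fin (Module.finrank ℝ E) ⊕ Fin (Module.finrank ℝ F))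
  obtain ⟨M₄, C₄, hC₄, h₄⟩ := phaseWeight_pow_mul_gaborCoeff_le
    (ι := Fin (Module.finrank ℝ E) ⊕ Fin (Module.finrank ℝ F)) (M₂ + M₃ + K)
  obtain ⟨M₅, C₅, hC₅, h₅⟩ := exists_supSeminorm_map_le (pullEquiv (prodCoord E F).symm) M₄
  refine ⟨M₅, C₁ * C₂ * C₃ * (C₄ * C₅),
    (fun p => (phaseWeight p ^ K)⁻¹) ∘ (splitIndex _ _).symm,
    (splitIndex _ _).symm.summable_iff.2 hK, fun p T => ?_⟩
  obtain ⟨q, rfl⟩ := (splitIndex _ _).surjective p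
  rw [Function.comp_apply, Equiv.symm_apply_apply, map_smul_eq_mul]
  have hq : 1 ≤ phaseWeight q := one_le_phaseWeight q
  have hq0 : 0 < phaseWeight q := zero_lt_one.trans_le hq
  have e₂ : supSeminorm E N₁ (atom E (splitIndex _ _ q).1) ≤ C₂ * phaseWeight q ^ M₂ := by
    refine (h₂ _).trans ?_
    have := phaseWeight_fst_le q
    have := one_le_phaseWeight (splitIndex _ _ q).1
    gcongr
  have e₃ : supSeminorm F N₁ (atom F (splitIndex _ _ q).2) ≤ C₃ * phaseWeight q ^ M₃ := by
    refine (h₃ _).trans ?_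
    have := phaseWeight_snd_le q
    have := one_le_phaseWeight (splitIndex _ _ q).2
    gcongr
  have e₄ : phaseWeight q ^ (M₂ + M₃ + K) * ‖prodCoeff E F (splitIndex _ _ q) T‖ ≤
      C₄ * (C₅ * supSeminorm _ M₅ T) := by
    rw [prodCoeff, Equiv.symm_apply_apply]
    exact (h₄ q _).trans (mul_le_mul_of_nonneg_left (h₅ T) hC₄)
  have e₁ : supSeminorm H N (B (atom E (splitIndex _ _ q).1) (atom F (splitIndex _ _ q).2)) ≤
      C₁ * (C₂ * phaseWeight q ^ M₂) * (C₃ * phaseWeight q ^ M₃) := by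
    refine (h₁ _ _).trans ?_
    gcongr
  rw [← div_eq_mul_inv, le_div_iff₀ (by positivity)]
  calc ‖prodCoeff E F (splitIndex _ _ q) T‖ *
        supSeminorm H N (B (atom E (splitIndex _ _ q).1) (atom F (splitIndex _ _ q).2)) *
        phaseWeight q ^ K
      ≤ ‖prodCoeff E F (splitIndex _ _ q) T‖ *
        (C₁ * (C₂ * phaseWeight q ^ M₂) * (C₃ * phaseWeight q ^ M₃)) * phaseWeight q ^ K := by
        gcongr
    _ = C₁ * C₂ * C₃ *
        (phaseWeight q ^ (M₂ + M₃ + K) * ‖prodCoeff E F (splitIndex _ _ q) T‖) := by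
        rw [pow_add, pow_add]; ring
    _ ≤ C₁ * C₂ * C₃ * (C₄ * (C₅ * supSeminorm _ M₅ T)) := by gcongr
    _ = _ := by ring

/-- Jointly continuous bilinear maps into a Schwartz space extend from tensor products to all
Schwartz functions on the product. -/
theorem exists_tensor_lift (B : 𝓢(E, ℂ) →ₗ[ℂ] 𝓢(F, ℂ) →ₗ[ℂ] 𝓢(H, ℂ))
    (hB : Continuous fun p : 𝓢(E, ℂ) × 𝓢(F, ℂ) => B p.1 p.2) :
    ∃ K : 𝓢(E × F, ℂ) →L[ℂ] 𝓢(H, ℂ), ∀ f g, K (tensor f g) = B f g := by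
  have hsum : ∀ T : 𝓢(E × F, ℂ), ∀ k n, Summable fun p : PhaseIndex E × PhaseIndex F =>
      SchwartzMap.seminorm ℂ k n (prodCoeff E F p T • B (atom E p.1) (atom F p.2)) := by
    intro T k n
    obtain ⟨M, C, a, ha, h⟩ := exists_bound_lift_term B hB (max k n)
    exact (ha.mul_left _).of_nonneg_of_le (fun _ => apply_nonneg _ _) fun p =>
      (seminorm_le_supSeminorm (le_max_left _ _) (le_max_right _ _) _).trans (h p T)
  -- The extension is the sum of the values of `B` on pairs of atoms, weighted by the coefficients
  -- of `T`.
  choose K hK using fun T => exists_hasSum_of_summable (hsum T)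
  let KL : 𝓢(E × F, ℂ) →ₗ[ℂ] 𝓢(H, ℂ) :=
    { toFun := K
      map_add' := fun T T' => by
        refine (hK (T + T')).unique (((hK T).add (hK T')).congr_fun fun p => ?_)
        rw [prodCoeff, map_add, gaborCoeff_add, add_smul]
        rfl
      map_smul' := fun c T => by
        refine (hK (c • T)).unique (((hK T).const_smul c).congr_fun fun p => ?_)
        rw [prodCoeff, map_smul, gaborCoeff_smul, smul_smul]
        rfl }
  have hKL : Continuous KL := by
    refine continuous_of_supSeminorm_bound KL fun N => ?_
    obtain ⟨M, C, a, ha, h⟩ := exists_bound_lift_term B hB N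
    refine ⟨M, C * ∑' p, a p, fun T => ?_⟩
    have hnn : ∀ p, 0 ≤ C * supSeminorm (E × F) M T * a p :=
      fun p => (apply_nonneg _ _).trans (h p T)
    have hle : ∀ k n, k ≤ N → n ≤ N → SchwartzMap.seminorm ℂ k n (KL T) ≤
        ∑' p, C * supSeminorm (E × F) M T * a p := by
      intro k n hk hn
      refine (seminorm_le_tsum_of_hasSum (hsum T)
        (fun x => (hK T).mapL (evalS H x)) k n).trans ?_
      exact (hsum T k n).tsum_le_tsum (fun p => (seminorm_le_supSeminorm hk hn _).trans (h p T))
        (ha.mul_left _)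
    refine (supSeminorm_le_of_forall (tsum_nonneg hnn) hle).trans (le_of_eq ?_)
    rw [tsum_mul_left]
    ring
  refine ⟨⟨KL, hKL⟩, fun f g => ?_⟩
  -- On a tensor product the coefficients factor, so the double series can be summed first over the
  -- atoms of `F` and then over those of `E`; each summation uses continuity of `B` in one variable.
  have h0 := hK (tensor f g)
  simp only [prodCoeff_tensor] at h0
  have hright : ∀ u, Continuous fun g => B u g := fun u =>
    hB.comp (continuous_const.prodMk continuous_id)
  have hleft : Continuous fun f => B f g := hB.comp (continuous_id.prodMk continuous_const)
  have hinner : ∀ p : PhaseIndex E, HasSum (fun q : PhaseIndex F =>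
      (coeff E p f * coeff F q g) • B (atom E p) (atom F q)) (coeff E p f • B (atom E p) g) := by
    intro p
    have := ((hasSum_atom g).mapL (⟨B (atom E p), hright _⟩ : 𝓢(F, ℂ) →L[ℂ] 𝓢(H, ℂ))).const_smul
      (coeff E p f)
    refine this.congr_fun fun q => ?_
    rw [map_smul, smul_smul]
    rfl
  have h1 := h0.prod_fiberwise hinner
  have h2 := (hasSum_atom f).mapL (⟨B.flip g, hleft⟩ : 𝓢(E, ℂ) →L[ℂ] 𝓢(H, ℂ))
  refine (h1.unique (h2.congr_fun fun p => ?_))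
  rw [map_smul]
  rfl

/-- The kernel theorem: jointly continuous bilinear forms are given by tempered distributions. -/
theorem exists_tensor_lift_complex (B : 𝓢(E, ℂ) →ₗ[ℂ] 𝓢(F, ℂ) →ₗ[ℂ] ℂ)
    (hB : Continuous fun p : 𝓢(E, ℂ) × 𝓢(F, ℂ) => B p.1 p.2) :
    ∃ K : 𝓢(E × F, ℂ) →L[ℂ] ℂ, ∀ f g, K (tensor f g) = B f g := by
  -- The scalars are realized as Schwartz functions on a one-point space, which makes the
  -- Schwartz-valued extension theorem applicable.
  let one : Sch 0 0 := oneS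
  obtain ⟨K, hK⟩ := exists_tensor_lift
    (B.compr₂ (LinearMap.toSpanSingleton ℂ (Sch 0 0) one))
    (by
      simp only [LinearMap.compr₂_apply, LinearMap.toSpanSingleton_apply]
      exact hB.smul continuous_const)
  refine ⟨(evalS (Conf 0 0) 0).comp K, fun f g => ?_⟩
  rw [ContinuousLinearMap.comp_apply, hK, LinearMap.compr₂_apply, evalS_apply,
    LinearMap.toSpanSingleton_apply, smul_apply]
  simp [one, oneS]

end Kernel

/-! ### Iterated Gâteaux differentiability on products (Bastiani calculus) -/

section Bastiani

universe u

/-! ### Rules for single directional derivatives. -/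

section HasGateauxDeriv

variable {X Y Y₁ Y₂ : Type*} [AddCommGroup X] [Module ℝ X]
  [AddCommGroup Y] [Module ℝ Y] [TopologicalSpace Y]
  [AddCommGroup Y₁] [Module ℝ Y₁] [TopologicalSpace Y₁]
  [AddCommGroup Y₂] [Module ℝ Y₂] [TopologicalSpace Y₂]

theorem HasGateauxDeriv.unique [T2Space Y] {f : X → Y} {x v : X} {y y' : Y}
    (h : HasGateauxDeriv f x v y) (h' : HasGateauxDeriv f x v y') : y = y' :=
  tendsto_nhds_unique h h'

theorem hasGateauxDeriv_const (c : Y) (x v : X) : HasGateauxDeriv (fun _ : X => c) x v 0 := by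
  simpa [HasGateauxDeriv] using tendsto_const_nhds

theorem hasGateauxDeriv_clm [TopologicalSpace X] (L : X →L[ℝ] Y) (x v : X) :
    HasGateauxDeriv L x v (L v) := by
  refine tendsto_const_nhds.congr' ?_
  filter_upwards [self_mem_nhdsWithin] with t ht
  have ht' : t ≠ 0 := ht
  simp [ht']

theorem HasGateauxDeriv.add [ContinuousAdd Y] {f g : X → Y} {x v : X} {a b : Y}
    (hf : HasGateauxDeriv f x v a) (hg : HasGateauxDeriv g x v b) :
    HasGateauxDeriv (fun x => f x + g x) x v (a + b) := by
  refine (Tendsto.add hf hg).congr fun t => ?_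
  rw [← smul_add, add_sub_add_comm]

theorem HasGateauxDeriv.clm_comp {f : X → Y₁} {x v : X} {a : Y₁} (hf : HasGateauxDeriv f x v a)
    (L : Y₁ →L[ℝ] Y) : HasGateauxDeriv (fun x => L (f x)) x v (L a) := by
  refine ((L.continuous.tendsto a).comp hf).congr fun t => ?_
  simp

/-- The difference quotient splits into B(Δf, g(x + tv)) + B(f(x), Δg). Joint continuity of `B` and
continuity of `g` along the line give the limit. -/
theorem HasGateauxDeriv.bilinear [TopologicalSpace X] [ContinuousAdd X] [ContinuousSMul ℝ X]
    [ContinuousAdd Y]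
    (B : Y₁ →ₗ[ℝ] Y₂ →ₗ[ℝ] Y) (hB : Continuous fun p : Y₁ × Y₂ => B p.1 p.2) {f : X → Y₁}
    {g : X → Y₂} {x v : X} {a : Y₁} {b : Y₂} (hf : HasGateauxDeriv f x v a)
    (hg : HasGateauxDeriv g x v b) (hgc : Continuous g) :
    HasGateauxDeriv (fun x => B (f x) (g x)) x v (B a (g x) + B (f x) b) := by
  have hline : Tendsto (fun t : ℝ => g (x + t • v)) (𝓝[≠] 0) (𝓝 (g x)) := by
    have hc : Continuous fun t : ℝ => g (x + t • v) :=
      hgc.comp (continuous_const.add (continuous_id.smul continuous_const))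
    have := (hc.tendsto 0).mono_left (nhdsWithin_le_nhds (s := {0}ᶜ))
    simpa using this
  have h1 := (hB.tendsto (a, g x)).comp (hf.prodMk_nhds hline)
  have h2 := (hB.tendsto (f x, b)).comp ((tendsto_const_nhds (x := f x)).prodMk_nhds hg)
  refine (h1.add h2).congr fun t => ?_
  simp only [Function.comp_apply, map_smul, map_sub, LinearMap.smul_apply, LinearMap.sub_apply,
    smul_sub]
  abel

end HasGateauxDeriv

/-- `n`-fold Gâteaux differentiability with jointly continuous derivatives, each derivative being
regarded as a function on the product of base points and directions. -/
def IsCk {Y : Type*} [AddCommGroup Y] [Module ℝ Y] [TopologicalSpace Y] :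
    (n : ℕ) → {X : Type u} → [AddCommGroup X] → [Module ℝ X] → [TopologicalSpace X] →
      (f : X → Y) → Prop
  | 0, _, _, _, _, f => Continuous f
  | n + 1, X, _, _, _, f => Continuous f ∧ ∃ f' : X × X → Y,
      (∀ x v, HasGateauxDeriv f x v (f' (x, v))) ∧ IsCk n f'

variable {X Z : Type u} [AddCommGroup X] [Module ℝ X] [TopologicalSpace X]
  [AddCommGroup Z] [Module ℝ Z] [TopologicalSpace Z]
  {Y Y₁ Y₂ : Type*} [AddCommGroup Y] [Module ℝ Y] [TopologicalSpace Y]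
  [AddCommGroup Y₁] [Module ℝ Y₁] [TopologicalSpace Y₁]
  [AddCommGroup Y₂] [Module ℝ Y₂] [TopologicalSpace Y₂]

theorem IsCk.continuous {n : ℕ} {f : X → Y} (h : IsCk n f) : Continuous f := by
  cases n with
  | zero => exact h
  | succ n => exact h.1

theorem IsCk.of_succ {n : ℕ} {f : X → Y} (h : IsCk (n + 1) f) : IsCk n f := by
  induction n generalizing X with
  | zero => exact h.1
  | succ n ih =>
    obtain ⟨hc, f', hf', h'⟩ := h
    exact ⟨hc, f', hf', ih h'⟩

theorem isCk_const (n : ℕ) (c : Y) : IsCk n fun _ : X => c := by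
  induction n generalizing X c with
  | zero => exact continuous_const
  | succ n ih => exact ⟨continuous_const, fun _ => 0, hasGateauxDeriv_const c, ih 0⟩

theorem isCk_clm (n : ℕ) (L : X →L[ℝ] Y) : IsCk n L := by
  induction n generalizing X with
  | zero => exact L.continuous
  | succ n ih =>
    exact ⟨L.continuous, L.comp (ContinuousLinearMap.snd ℝ X X), hasGateauxDeriv_clm L, ih _⟩

theorem IsCk.comp_clm {n : ℕ} {f : X → Y} (h : IsCk n f) (L : Z →L[ℝ] X) :
    IsCk n fun z => f (L z) := by
  induction n generalizing X Z with
  | zero => exact Continuous.comp h L.continuous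
  | succ n ih =>
    obtain ⟨hc, f', hf', h'⟩ := h
    refine ⟨hc.comp L.continuous, fun p => f' (L.prodMap L p), fun x v => ?_, ih h' _⟩
    have := hf' (L x) (L v)
    simpa [HasGateauxDeriv] using this

theorem IsCk.add [ContinuousAdd Y] {n : ℕ} {f g : X → Y} (hf : IsCk n f) (hg : IsCk n g) :
    IsCk n fun x => f x + g x := by
  induction n generalizing X with
  | zero => exact Continuous.add hf hg
  | succ n ih =>
    obtain ⟨hfc, f', hf', hfn⟩ := hf
    obtain ⟨hgc, g', hg', hgn⟩ := hg
    exact ⟨hfc.add hgc, _, fun x v => (hf' x v).add (hg' x v), ih hfn hgn⟩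

theorem IsCk.clm_comp {n : ℕ} {f : X → Y₁} (hf : IsCk n f) (L : Y₁ →L[ℝ] Y) :
    IsCk n fun x => L (f x) := by
  induction n generalizing X with
  | zero => exact L.continuous.comp hf
  | succ n ih =>
    obtain ⟨hfc, f', hf', hfn⟩ := hf
    exact ⟨L.continuous.comp hfc, _, fun x v => (hf' x v).clm_comp L, ih hfn⟩

/-- The derivative is a sum of two expressions of the same bilinear form on X × X, with one
differentiability order fewer to prove; hence the induction over all domains at once. -/
theorem IsCk.bilinear [ContinuousAdd X] [ContinuousSMul ℝ X] [ContinuousAdd Y]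
    (B : Y₁ →ₗ[ℝ] Y₂ →ₗ[ℝ] Y) (hB : Continuous fun p : Y₁ × Y₂ => B p.1 p.2) {n : ℕ} {f : X → Y₁}
    {g : X → Y₂} (hf : IsCk n f) (hg : IsCk n g) : IsCk n fun x => B (f x) (g x) := by
  induction n generalizing X with
  | zero => exact hB.comp (Continuous.prodMk hf hg)
  | succ n ih =>
    obtain ⟨hfc, f', hf', hfn⟩ := id hf
    obtain ⟨hgc, g', hg', hgn⟩ := id hg
    refine ⟨hB.comp (hfc.prodMk hgc), fun p => B (f' p) (g p.1) + B (f p.1) (g' p),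
      fun x v => (hf' x v).bilinear B hB (hg' x v) hgc, ?_⟩
    exact (ih hfn (hg.of_succ.comp_clm (ContinuousLinearMap.fst ℝ X X))).add
      (ih (hf.of_succ.comp_clm (ContinuousLinearMap.fst ℝ X X)) hgn)

theorem isCk_pi {ι : Type*} {Y : ι → Type*} [∀ i, AddCommGroup (Y i)] [∀ i, Module ℝ (Y i)]
    [∀ i, TopologicalSpace (Y i)] {n : ℕ} {f : X → ∀ i, Y i} (h : ∀ i, IsCk n fun x => f x i) :
    IsCk n f := by
  induction n generalizing X with
  | zero => exact continuous_pi h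
  | succ n ih =>
    choose hc f' hf' hn using h
    exact ⟨continuous_pi hc, fun p i => f' i p, fun x v => tendsto_pi_nhds.2 fun i => hf' i x v,
      ih hn⟩

/-- Difference quotients stay in the subspace, and closedness keeps their limits there. -/
theorem IsCk.codRestrict {W : Submodule ℝ Y} (hW : IsClosed (W : Set Y)) {n : ℕ} {f : X → W}
    (h : IsCk n fun x => (f x : Y)) : IsCk n f := by
  induction n generalizing X with
  | zero => exact Continuous.subtype_mk h fun x => (f x).2
  | succ n ih =>
    obtain ⟨hc, f', hf', hn⟩ := h
    have hmem : ∀ p, f' p ∈ W := fun p =>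
      hW.mem_of_tendsto (hf' p.1 p.2) (Eventually.of_forall fun t =>
        W.smul_mem _ (W.sub_mem (f _).2 (f _).2))
    refine ⟨hc.subtype_mk fun x => (f x).2, fun p => ⟨f' p, hmem p⟩, fun x v => ?_, ih hn⟩
    exact tendsto_subtype_rng.2 (hf' x v)

/-- A priori the derivative supplied by `IsCk` depends on the order; uniqueness of limits makes it
one function valid for all orders. -/
theorem exists_deriv_of_forall_isCk [T2Space Y] {f : X → Y} (h : ∀ n, IsCk n f) :
    ∃ f' : X × X → Y, (∀ x v, HasGateauxDeriv f x v (f' (x, v))) ∧ ∀ n, IsCk n f' := by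
  obtain ⟨-, f', hf', -⟩ := h 1
  refine ⟨f', hf', fun n => ?_⟩
  obtain ⟨-, g, hg, hn⟩ := h (n + 1)
  have : f' = g := funext fun p => (hf' p.1 p.2).unique (hg p.1 p.2)
  exact this ▸ hn

theorem isSmooth_of_forall_isCk [T2Space Y] {f : X → Y} (h : ∀ n, IsCk n f) : IsSmooth f := by
  -- The next derivative moves only the base point and freezes the earlier directions: (x; v, w) is
  -- sent to the point (x, v) with direction (w, 0).
  let L : (r : ℕ) → (X × (Fin (r + 1) → X)) →L[ℝ] (X × (Fin r → X)) × (X × (Fin r → X)) :=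
    fun r => ((ContinuousLinearMap.fst ℝ X _).prod (ContinuousLinearMap.pi fun i =>
        (ContinuousLinearMap.proj i.castSucc).comp (ContinuousLinearMap.snd ℝ X _))).prod
      (((ContinuousLinearMap.proj (Fin.last r)).comp (ContinuousLinearMap.snd ℝ X _)).prod 0)
  let D : (r : ℕ) → {g : X × (Fin r → X) → Y // ∀ n, IsCk n g} := fun r =>
    Nat.rec (motive := fun r => {g : X × (Fin r → X) → Y // ∀ n, IsCk n g})
      ⟨fun p => f p.1, fun n =>
        (h n).comp_clm (Z := X × (Fin 0 → X)) (ContinuousLinearMap.fst ℝ X (Fin 0 → X))⟩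
      (fun r g => ⟨fun p => (exists_deriv_of_forall_isCk g.2).choose (L r p), fun n =>
        ((exists_deriv_of_forall_isCk g.2).choose_spec.2 n).comp_clm (L r)⟩) r
  refine ⟨fun r x v => (D r).1 (x, v), fun _ _ => rfl, fun r => ((D r).2 0).continuous,
    fun r x v w => ?_⟩
  have hd := (exists_deriv_of_forall_isCk (D r).2).choose_spec.1 (x, v) (w, 0)
  have e : (D (r + 1)).1 (x, Fin.snoc v w) =
      (exists_deriv_of_forall_isCk (D r).2).choose ((x, v), (w, 0)) := by
    change (exists_deriv_of_forall_isCk (D r).2).choose (L r (x, Fin.snoc v w)) = _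
    refine congrArg _ (Prod.ext (Prod.ext rfl ?_) (Prod.ext ?_ rfl))
    · funext i
      simp [L]
    · simp [L]
  simp only [e]
  simpa [HasGateauxDeriv] using hd

end Bastiani

variable {d : ℕ}

/-! ### Distribution-valued operators and jointly continuous bilinear forms -/

section Operators

/-- The bilinear form of a distribution-valued operator. -/
def DVO.bilin {k : ℕ} (A : DVO d k) : Sch d k →ₗ[ℂ] Sch d k →ₗ[ℂ] ℂ :=
  LinearMap.mk₂ ℂ (fun f g => A f g) (fun f f' g => by simp) (fun c f g => by simp)
    (fun f g g' => by simp) (fun c f g => by simp)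

/-- Convergence in the strong dual is uniform on bounded sets, and a convergent sequence has bounded
range. Sequences suffice because the spaces are first countable. -/
theorem DVO.continuous_uncurry {k : ℕ} (A : DVO d k) :
    Continuous fun p : Sch d k × Sch d k => A p.1 p.2 := by
  refine SeqContinuous.continuous fun u p hu => ?_
  have h1 : Tendsto (fun n => (u n).1) atTop (𝓝 p.1) := (continuous_fst.tendsto p).comp hu
  have h2 : Tendsto (fun n => (u n).2) atTop (𝓝 p.2) := (continuous_snd.tendsto p).comp hu
  have hb : Bornology.IsVonNBounded ℂ (Set.range fun n => (u n).2) := h2.isVonNBounded_range ℂ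
  have hA : Tendsto (fun n => A ((u n).1 - p.1)) atTop (𝓝 0) := by
    have := (A.continuous.tendsto (p.1 - p.1)).comp (h1.sub_const p.1)
    simpa [Function.comp_def] using this
  have e1 : Tendsto (fun n => A ((u n).1 - p.1) (u n).2) atTop (𝓝 0) := by
    rw [tendsto_def]
    intro V hV
    filter_upwards [hA.eventually (ContinuousLinearMap.eventually_nhds_zero_mapsTo hb hV)] with n hn
    exact hn ⟨n, rfl⟩
  have e2 : Tendsto (fun n => A p.1 (u n).2) atTop (𝓝 (A p.1 p.2)) :=
    ((A p.1).continuous.tendsto _).comp h2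
  have := e1.add e2
  rw [zero_add] at this
  refine this.congr fun n => ?_
  simp

/-- A bound by a product of seminorms is uniform over bounded sets of the second argument, which is
continuity into the strong dual. -/
theorem exists_dvo {k : ℕ} (B : Sch d k →ₗ[ℂ] Sch d k →ₗ[ℂ] ℂ)
    (hB : Continuous fun p : Sch d k × Sch d k => B p.1 p.2) :
    ∃ A : DVO d k, ∀ f g, A f g = B f g := by
  let L : Sch d k →ₗ[ℂ] (Sch d k →L[ℂ] ℂ) :=
    { toFun := fun f => ⟨B f, hB.comp (continuous_const.prodMk continuous_id)⟩
      map_add' := fun f f' => by ext g; simp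
      map_smul' := fun c f => by ext g; simp }
  have hL : Continuous L := by
    refine continuous_of_continuousAt_zero L ?_
    rw [ContinuousAt, map_zero, (ContinuousLinearMap.hasBasis_nhds_zero_of_basis
      Metric.nhds_basis_ball).tendsto_right_iff]
    rintro ⟨S, ε⟩ ⟨hS, hε⟩
    obtain ⟨N, C, hC, hN⟩ := exists_bilinear_bound B hB (q := normSeminorm ℂ ℂ) continuous_norm
    obtain ⟨r, hr, hrS⟩ :=
      ((schwartz_withSeminorms ℂ (Conf d k) ℂ).isVonNBounded_iff_finset_seminorm_bounded.1 hS)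
        (Finset.Iic (N, N))
    have hlim : Tendsto (fun f : Sch d k => C * supSeminorm _ N f * r) (𝓝 0) (𝓝 0) := by
      have hc : Continuous fun f : Sch d k => C * supSeminorm _ N f * r := by
        have := continuous_supSeminorm (E := Conf d k) N
        fun_prop
      simpa using hc.tendsto 0
    filter_upwards [hlim.eventually_lt_const hε] with f hf
    intro g hg
    rw [mem_ball_zero_iff]
    refine lt_of_le_of_lt ?_ hf
    refine (hN f g).trans ?_
    have : supSeminorm _ N g ≤ r := (hrS g hg).le
    have := apply_nonneg (supSeminorm (Conf d k) N) f
    gcongr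
  exact ⟨⟨L, hL⟩, fun _ _ => rfl⟩

/-- The kernel theorem rules out the default value 0. The form is flipped because the test function
`g` comes first in the kernel. -/
theorem schwartzKernel_tensor {k : ℕ} (A : DVO d k) (f g : Sch d k) :
    schwartzKernel A (tensor g f) = A f g := by
  have h : ∃ K : Ker d k →L[ℂ] ℂ, ∀ f g : Sch d k, K (tensor g f) = A f g := by
    obtain ⟨K, hK⟩ := exists_tensor_lift_complex (DVO.bilin A).flip
      ((DVO.continuous_uncurry A).comp continuous_swap)
    exact ⟨K, fun f g => hK g f⟩
  rw [schwartzKernel, dif_pos h]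
  exact h.choose_spec f g

theorem schwartzKernel_add {k : ℕ} (A B : DVO d k) :
    schwartzKernel (A + B) = schwartzKernel A + schwartzKernel B :=
  clm_ext_tensor fun f g => by simp [schwartzKernel_tensor]

theorem schwartzKernel_smul {k : ℕ} (c : ℂ) (A : DVO d k) :
    schwartzKernel (c • A) = c • schwartzKernel A :=
  clm_ext_tensor fun f g => by simp [schwartzKernel_tensor]

theorem schwartzKernel_zero {k : ℕ} : schwartzKernel (0 : DVO d k) = 0 :=
  clm_ext_tensor fun f g => by simp [schwartzKernel_tensor]

theorem genTrace_tensor {k : ℕ} (A : DVO d k) (f g : Sch d k) :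
    genTrace A (tensor f g) = A f g := by
  rw [genTrace, show transposeS (tensor f g) = tensor g f from by
    ext p; exact mul_comm _ _, schwartzKernel_tensor]

/-- The transposition of kernels as a continuous linear map. -/
def transposeCLM {E : Type*} [NormedAddCommGroup E] [NormedSpace ℝ E] :
    𝓢(E × E, ℂ) →L[ℂ] 𝓢(E × E, ℂ) :=
  SchwartzMap.compCLMOfContinuousLinearEquiv ℂ (ContinuousLinearEquiv.prodComm ℝ E E)

theorem genTrace_eq {k : ℕ} (A : DVO d k) (γ : Ker d k) :
    genTrace A γ = (schwartzKernel A).comp transposeCLM γ := rfl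

end Operators

/-! ### Partial pairings -/

section Partial

/-- Testing with conj(u - v) gives zero L² norm, and continuity upgrades almost everywhere to
everywhere. -/
theorem eq_of_forall_integral_mul_eq {u v : 𝓢(Pt d, ℂ)}
    (h : ∀ φ : 𝓢(Pt d, ℂ), ∫ x, u x * φ x = ∫ x, v x * φ x) : u = v := by
  have hint : ∀ w φ : 𝓢(Pt d, ℂ), Integrable fun x => w x * φ x := fun w φ => by
    have := (SchwartzMap.pairing (ContinuousLinearMap.mul ℂ ℂ) w φ).integrable (μ := volume)
    refine this.congr (Eventually.of_forall fun x => ?_)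
    simp
  have h0 : ∫ x, (u - v) x * conjS (u - v) x = 0 := by
    simp only [sub_apply, sub_mul]
    rw [integral_sub (hint u _) (hint v _), h, sub_self]
  have h1 : ∫ x, ‖(u - v) x‖ ^ 2 = 0 := by
    have e : ∀ x, (u - v) x * conjS (u - v) x = ((‖(u - v) x‖ ^ 2 : ℝ) : ℂ) := fun x => by
      rw [conjS_apply, Complex.mul_conj, Complex.normSq_eq_norm_sq]
    simp only [e] at h0
    rw [integral_complex_ofReal] at h0
    exact_mod_cast h0
  have hi : Integrable fun x => ‖(u - v) x‖ ^ 2 := by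
    refine ((hint (u - v) (conjS (u - v))).norm).congr (Eventually.of_forall fun x => ?_)
    simp only [norm_mul, conjS_apply, RCLike.norm_conj, sq]
  have h2 := (integral_eq_zero_iff_of_nonneg (fun x => by positivity) hi).1 h1
  have hc : Continuous fun x => ‖(u - v) x‖ ^ 2 := (u - v).continuous.norm.pow 2
  have h3 := hc.ae_eq_iff_eq volume continuous_const |>.1 h2
  rw [← sub_eq_zero]
  ext x
  have h4 : ‖(u - v) x‖ ^ 2 = 0 := congrFun h3 x
  exact norm_eq_zero.1 ((pow_eq_zero_iff two_ne_zero).1 h4)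

theorem partialKernel_eq {k : ℕ} {B : DVO d k} {β : Fin k} {f g : Sch d k}
    {Ψ : 𝓢(Pt d × Pt d, ℂ)} (h : ∀ (φ : 𝓢(Pt d, ℂ)) (x' : Pt d),
      B f (slot β φ g x') = ∫ x, Ψ (x, x') * φ x) : partialKernel B β f g = Ψ := by
  have hex : ∃ Ψ : 𝓢(Pt d × Pt d, ℂ), ∀ (φ : 𝓢(Pt d, ℂ)) (x' : Pt d),
      B f (slot β φ g x') = ∫ x, Ψ (x, x') * φ x := ⟨Ψ, h⟩
  rw [partialKernel, dif_pos hex]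
  ext ⟨x, x'⟩
  have : slice x' hex.choose = slice x' Ψ := eq_of_forall_integral_mul_eq fun φ => by
    simp only [slice_apply]
    rw [← hex.choose_spec φ x', ← h φ x']
  have := congrArg (fun u : 𝓢(Pt d, ℂ) => u x) this
  simpa using this

end Partial

/-! ### Existence of the contraction -/

section Contraction

variable {V W : Type*} [NormedAddCommGroup V] [NormedSpace ℝ V]
  [NormedAddCommGroup W] [NormedSpace ℝ W]

/-- Pull-back along a norm-nondecreasing linear map. -/
def pullLinear (L : V →L[ℝ] W) (h : ∀ v, ‖v‖ ≤ ‖L v‖) : 𝓢(W, ℂ) →L[ℂ] 𝓢(V, ℂ) :=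
  SchwartzMap.compCLM ℂ (g := L) L.hasTemperateGrowth ⟨1, 1, fun v => by
    have := h v
    simp only [pow_one, one_mul]
    linarith⟩

@[simp] theorem pullLinear_apply (L : V →L[ℝ] W) (h : ∀ v, ‖v‖ ≤ ‖L v‖) (f : 𝓢(W, ℂ)) (v : V) :
    pullLinear L h f v = f (L v) := rfl

variable (W) in
/-- The slice `f(z, ·)` as a continuous linear map. -/
def sliceFst (z : V) : 𝓢(V × W, ℂ) →L[ℂ] 𝓢(W, ℂ) :=
  SchwartzMap.compCLM ℂ (g := fun w => ContinuousLinearMap.inr ℝ V W w + (z, 0))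
    (contDiff_and_growth_of_affine _ _) ⟨1, 1, fun w => by
      simp only [pow_one, one_mul]
      have : ‖w‖ ≤ ‖ContinuousLinearMap.inr ℝ V W w + (z, 0)‖ := by simp
      linarith⟩

@[simp] theorem sliceFst_apply (z : V) (f : 𝓢(V × W, ℂ)) (w : W) : sliceFst W z f w = f (z, w) := by
  have : sliceFst W z f w = f (ContinuousLinearMap.inr ℝ V W w + (z, 0)) := rfl
  simp [this]

variable (W) in
/-- The slice `f(·, z)` as a continuous linear map. -/
def sliceSnd (z : V) : 𝓢(W × V, ℂ) →L[ℂ] 𝓢(W, ℂ) :=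
  (sliceFst W z).comp (pullEquiv (ContinuousLinearEquiv.prodComm ℝ V W))

@[simp] theorem sliceSnd_apply (z : V) (f : 𝓢(W × V, ℂ)) (w : W) :
    sliceSnd W z f w = f (w, z) := by
  rw [sliceSnd, ContinuousLinearMap.comp_apply, sliceFst_apply]
  rfl

/-- `x ↦ (x_j)_{j ≠ α}`. -/
def removeAt {a : ℕ} (α : Fin (a + 1)) : Conf d (a + 1) →L[ℝ] Conf d a :=
  ContinuousLinearMap.pi fun j => ContinuousLinearMap.proj (α.succAbove j)

@[simp] theorem removeAt_apply {a : ℕ} (α : Fin (a + 1)) (x : Conf d (a + 1)) (j : Fin a) :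
    removeAt α x j = x (α.succAbove j) := rfl

/-- The joint configuration as a linear function of `((x_j)_{j ≠ α}, y)`. -/
def glueLinear {a b n : ℕ} (h : a + b = n) (α : Fin (a + 1)) (β : Fin (b + 1)) :
    Conf d a × Conf d (b + 1) →L[ℝ] Conf d (n + 1) :=
  LinearMap.toContinuousLinearMap
    -- The value 0 at place α is a dummy: `glue` never reads that coordinate.
    { toFun := fun p => glue h α β (α.insertNth 0 p.1) p.2
      map_add' := fun p q => by
        funext i
        simp only [glue, Pi.add_apply, Prod.fst_add, Prod.snd_add]
        split_ifs with h1 h2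
        · rfl
        · obtain ⟨j, hj⟩ := Fin.exists_succAbove_eq h2
          simp only [← hj, Fin.insertNth_apply_succAbove, Pi.add_apply]
        · rfl
      map_smul' := fun c p => by
        funext i
        simp only [glue, Pi.smul_apply, Prod.smul_fst, Prod.smul_snd, RingHom.id_apply]
        split_ifs with h1 h2
        · rfl
        · obtain ⟨j, hj⟩ := Fin.exists_succAbove_eq h2
          simp only [← hj, Fin.insertNth_apply_succAbove, Pi.smul_apply]
        · rfl }

theorem glueLinear_apply {a b n : ℕ} (h : a + b = n) (α : Fin (a + 1)) (β : Fin (b + 1))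
    (p : Conf d a × Conf d (b + 1)) :
    glueLinear h α β p = glue h α β (α.insertNth 0 p.1) p.2 := rfl

theorem glue_insertNth_removeAt {a b n : ℕ} (h : a + b = n) (α : Fin (a + 1)) (β : Fin (b + 1))
    (x : Conf d (a + 1)) (y : Conf d (b + 1)) :
    glue h α β (α.insertNth 0 (removeAt α x)) y = glue h α β x y := by
  funext i
  simp only [glue]
  split_ifs with h1 h2
  · rfl
  · obtain ⟨j, hj⟩ := Fin.exists_succAbove_eq h2
    simp only [← hj, Fin.insertNth_apply_succAbove, removeAt_apply]
  · rfl

/-- Every free coordinate reappears among the glued ones, so pulling back along this map preserves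
Schwartz decay. -/
theorem norm_le_norm_glueLinear {a b n : ℕ} (h : a + b = n) (α : Fin (a + 1)) (β : Fin (b + 1))
    (p : Conf d a × Conf d (b + 1)) : ‖p‖ ≤ ‖glueLinear h α β p‖ := by
  rw [glueLinear_apply, Prod.norm_def]
  refine max_le ((pi_norm_le_iff_of_nonneg (norm_nonneg _)).2 fun j => ?_)
    ((pi_norm_le_iff_of_nonneg (norm_nonneg _)).2 fun j => ?_)
  · have hj := (α.succAbove j).2
    refine le_trans (le_of_eq ?_)
      (norm_le_pi_norm _ (⟨(α.succAbove j : ℕ), by omega⟩ : Fin (n + 1)))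
    have hne : α.succAbove j ≠ α := Fin.succAbove_ne α j
    simp only [glue, hj, dif_pos, Fin.eta, if_neg hne, Fin.insertNth_apply_succAbove]
  · rcases eq_or_ne j β with hj | hj
    · subst hj
      have hα : (α : ℕ) < n + 1 := by omega
      refine le_trans (le_of_eq ?_) (norm_le_pi_norm _ (⟨α, hα⟩ : Fin (n + 1)))
      simp [glue, Nat.lt_succ_iff.1 α.2]
    · obtain ⟨m, rfl⟩ := Fin.exists_succAbove_eq hj
      have hm : a + 1 + (m : ℕ) < n + 1 := by omega
      refine le_trans (le_of_eq ?_) (norm_le_pi_norm _ (⟨a + 1 + m, hm⟩ : Fin (n + 1)))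
      have hm' : ¬ a + 1 + (m : ℕ) ≤ a := by omega
      simp [glue, hm']

/-- `((x_j)_{j ≠ α}, (x'_j)_{j ≠ α}, y, y')` to the pair of joint configurations. -/
def gluePair {a b n : ℕ} (h : a + b = n) (α : Fin (a + 1)) (β : Fin (b + 1)) :
    (Conf d a × Conf d a) × (Conf d (b + 1) × Conf d (b + 1)) →L[ℝ]
      Conf d (n + 1) × Conf d (n + 1) :=
  ((glueLinear h α β).comp (((ContinuousLinearMap.fst ℝ _ _).comp
    (ContinuousLinearMap.fst ℝ _ _)).prod
      ((ContinuousLinearMap.fst ℝ _ _).comp (ContinuousLinearMap.snd ℝ _ _)))).prod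
    ((glueLinear h α β).comp (((ContinuousLinearMap.snd ℝ _ _).comp
      (ContinuousLinearMap.fst ℝ _ _)).prod
      ((ContinuousLinearMap.snd ℝ _ _).comp (ContinuousLinearMap.snd ℝ _ _))))

theorem gluePair_apply {a b n : ℕ} (h : a + b = n) (α : Fin (a + 1)) (β : Fin (b + 1))
    (u u' : Conf d a) (y y' : Conf d (b + 1)) : gluePair h α β ((u, u'), (y, y')) =
      (glueLinear h α β (u, y), glueLinear h α β (u', y')) := rfl

theorem norm_le_norm_gluePair {a b n : ℕ} (h : a + b = n) (α : Fin (a + 1)) (β : Fin (b + 1))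
    (p : (Conf d a × Conf d a) × (Conf d (b + 1) × Conf d (b + 1))) :
    ‖p‖ ≤ ‖gluePair h α β p‖ := by
  obtain ⟨⟨u, u'⟩, ⟨y, y'⟩⟩ := p
  rw [gluePair_apply]
  have h1 := norm_le_norm_glueLinear h α β (u, y)
  have h2 := norm_le_norm_glueLinear h α β (u', y')
  simp only [Prod.norm_def, max_le_iff] at h1 h2 ⊢
  exact ⟨⟨le_max_of_le_left h1.1, le_max_of_le_right h2.1⟩,
    ⟨le_max_of_le_left h1.2, le_max_of_le_right h2.2⟩⟩

/-- `(x, x') ↦ ((x_j)_{j ≠ α}, (x'_j)_{j ≠ α}, x_α, x'_α)`. -/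
def splitPair {a : ℕ} (α : Fin (a + 1)) :
    Conf d (a + 1) × Conf d (a + 1) →L[ℝ] (Conf d a × Conf d a) × (Pt d × Pt d) :=
  ((removeAt α).prodMap (removeAt α)).prod
    ((ContinuousLinearMap.proj α).prodMap (ContinuousLinearMap.proj α))

theorem splitPair_apply {a : ℕ} (α : Fin (a + 1)) (x x' : Conf d (a + 1)) :
    splitPair α (x, x') = ((removeAt α x, removeAt α x'), (x α, x' α)) := rfl

theorem norm_le_max_removeAt {a : ℕ} (α : Fin (a + 1)) (x : Conf d (a + 1)) :
    ‖x‖ ≤ max ‖removeAt α x‖ ‖x α‖ := by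
  refine (pi_norm_le_iff_of_nonneg (le_max_of_le_left (norm_nonneg _))).2 fun i => ?_
  rcases eq_or_ne i α with rfl | hi
  · exact le_max_right _ _
  · obtain ⟨j, rfl⟩ := Fin.exists_succAbove_eq hi
    exact le_max_of_le_left (norm_le_pi_norm (removeAt α x) j)

theorem norm_le_norm_splitPair {a : ℕ} (α : Fin (a + 1))
    (p : Conf d (a + 1) × Conf d (a + 1)) : ‖p‖ ≤ ‖splitPair α p‖ := by
  obtain ⟨x, x'⟩ := p
  rw [splitPair_apply]
  simp only [Prod.norm_def]
  refine max_le ((norm_le_max_removeAt α x).trans ?_) ((norm_le_max_removeAt α x').trans ?_)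
  · exact max_le_max (le_max_left _ _) (le_max_left _ _)
  · exact max_le_max (le_max_right _ _) (le_max_right _ _)

/-- For fixed outer variables the glued tensor product is a tensor product of frozen functions. -/
theorem sliceFst_gluePair {a b n : ℕ} (h : a + b = n) (α : Fin (a + 1)) (β : Fin (b + 1))
    (f g : Sch d (n + 1)) (x x' : Conf d (a + 1)) :
    sliceFst _ (removeAt α x, removeAt α x')
      (pullLinear (gluePair h α β) (norm_le_norm_gluePair h α β) (tensor f g)) =
      tensor (freeze h α β x f) (freeze h α β x' g) := by
  ext ⟨y, y'⟩
  rw [sliceFst_apply, pullLinear_apply, gluePair_apply, tensor_apply, tensor_apply, freeze_apply,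
    freeze_apply, glueLinear_apply, glueLinear_apply, glue_insertNth_removeAt,
    glue_insertNth_removeAt]

/-- In the variables ((x_j), (x'_j))_{j ≠ α} and (y, y'), the construction is identity ⊗ partial
pairing, preceded by gluing and followed by substitution of (x_α, x'_α). Two uses of the kernel
theorem make it a continuous linear map of f ⊗ g. -/
theorem exists_contrKernel {a b n : ℕ} (h : a + b = n) {B : DVO d (b + 1)} (hB : HasGMP B)
    (α : Fin (a + 1)) (β : Fin (b + 1)) :
    ∃ Θ : Ker d (n + 1) →L[ℂ] Ker d (a + 1), ∀ f g x x', Θ (tensor f g) (x, x') =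
      partialKernel B β (freeze h α β x f) (freeze h α β x' g) (x α, x' α) := by
  obtain ⟨Φ, hΦc, hΦ⟩ := hB β
  have hpk : ∀ f g, partialKernel B β f g = Φ f g := fun f g => partialKernel_eq (hΦ f g)
  obtain ⟨Φ', hΦ'⟩ := exists_tensor_lift Φ hΦc
  -- `Ξ` is id ⊗ Φ', the partial pairing with the outer variables as parameters.
  obtain ⟨Ξ, hΞ⟩ := exists_tensor_lift
    ((tensorLM (Conf d a × Conf d a) (Pt d × Pt d)).compl₂ (Φ' : Ker d (b + 1) →ₗ[ℂ] _))
    ((continuous_tensor _ _).comp (continuous_fst.prodMk (Φ'.continuous.comp continuous_snd)))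
  -- Applying `Ξ` and fixing the parameter agrees with fixing it before Φ'; both sides are
  -- continuous in `T`, so tensor products decide.
  have hslice : ∀ (u : Conf d a × Conf d a) (q : Pt d × Pt d)
      (T : 𝓢((Conf d a × Conf d a) × (Conf d (b + 1) × Conf d (b + 1)), ℂ)),
      Ξ T (u, q) = Φ' (sliceFst _ u T) q := by
    intro u q
    have : (evalS _ (u, q)).comp Ξ = (evalS _ q).comp (Φ'.comp (sliceFst _ u)) := by
      refine clm_ext_tensor fun U V => ?_
      have e : sliceFst _ u (tensor U V) = U u • V := by
        ext y; simp
      simp only [ContinuousLinearMap.comp_apply, evalS_apply, e, map_smul, hΞ]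
      rfl
    exact fun T => congrArg (fun L : _ →L[ℂ] ℂ => L T) this
  refine ⟨(pullLinear (splitPair α) (norm_le_norm_splitPair α)).comp (Ξ.comp
    (pullLinear (gluePair h α β) (norm_le_norm_gluePair h α β))), fun f g x x' => ?_⟩
  rw [ContinuousLinearMap.comp_apply, ContinuousLinearMap.comp_apply, pullLinear_apply,
    splitPair_apply, hslice, sliceFst_gluePair, hΦ', hpk]

theorem contrKernel_apply {a b n : ℕ} (h : a + b = n) {B : DVO d (b + 1)} (hB : HasGMP B)
    (α : Fin (a + 1)) (β : Fin (b + 1)) (f g : Sch d (n + 1)) (x x' : Conf d (a + 1)) :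
    contrKernel h B α β f g (x, x') =
      partialKernel B β (freeze h α β x f) (freeze h α β x' g) (x α, x' α) := by
  have H : ∃ T : Ker d (a + 1), ∀ x x' : Conf d (a + 1), T (x, x') =
      partialKernel B β (freeze h α β x f) (freeze h α β x' g) (x α, x' α) := by
    obtain ⟨Θ, hΘ⟩ := exists_contrKernel h hB α β
    exact ⟨_, hΘ f g⟩
  rw [contrKernel, dif_pos H]
  exact H.choose_spec x x'

/-- The right-hand side is a continuous functional of f ⊗ g, so it is the form of an operator and
the default value 0 does not occur. -/
theorem contraction_apply {a b n : ℕ} (h : a + b = n) (A : DVO d (a + 1)) {B : DVO d (b + 1)}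
    (hB : HasGMP B) (α : Fin (a + 1)) (β : Fin (b + 1)) (f g : Sch d (n + 1)) :
    contraction h A B α β f g = schwartzKernel A (transposeS (contrKernel h B α β f g)) := by
  have H : ∃ C : DVO d (n + 1), ∀ f g : Sch d (n + 1),
      C f g = schwartzKernel A (transposeS (contrKernel h B α β f g)) := by
    obtain ⟨Θ, hΘ⟩ := exists_contrKernel h hB α β
    have e : ∀ f g, contrKernel h B α β f g = Θ (tensor f g) := fun f g => by
      ext ⟨x, x'⟩
      rw [contrKernel_apply h hB, hΘ]
    let S := (schwartzKernel A).comp (transposeCLM.comp Θ)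
    obtain ⟨C, hC⟩ := exists_dvo ((tensorLM _ _).compr₂ (S : Ker d (n + 1) →ₗ[ℂ] ℂ))
      (S.continuous.comp (continuous_tensor _ _))
    refine ⟨C, fun f g => ?_⟩
    rw [hC, e]
    rfl
  rw [contraction, dif_pos H]
  exact H.choose_spec f g

end Contraction

/-! ### Products of one-particle functions -/

section Products

/-- `(ψ ⊗ g)(x₀, …, x_k) = ψ(x₀) g(x₁, …, x_k)`. -/
def consS {k : ℕ} (ψ : 𝓢(Pt d, ℂ)) (g : Sch d k) : Sch d (k + 1) :=
  pullEquiv (Fin.consEquivL ℝ (fun _ : Fin (k + 1) => Pt d)).symm (tensor ψ g)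

theorem consS_apply {k : ℕ} (ψ : 𝓢(Pt d, ℂ)) (g : Sch d k) (x : Conf d (k + 1)) :
    consS ψ g x = ψ (x 0) * g (fun i => x i.succ) := rfl

theorem conjS_tensorPow (φ : 𝓢(Pt d, ℂ)) (k : ℕ) :
    conjS (tensorPow φ k) = tensorPow (conjS φ) k := by
  ext x
  simp [tensorPow_apply]

/-- `consS` as a real bilinear map. -/
def consLM (d k : ℕ) : 𝓢(Pt d, ℂ) →ₗ[ℝ] Sch d k →ₗ[ℝ] Sch d (k + 1) :=
  LinearMap.mk₂ ℝ consS
    (fun f f' g => by ext x; simp [consS_apply, add_mul])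
    (fun c f g => by ext x; simp [consS_apply, mul_assoc])
    (fun f g g' => by ext x; simp [consS_apply, mul_add])
    (fun c f g => by ext x; simp [consS_apply, mul_left_comm])

theorem continuous_consLM (d k : ℕ) :
    Continuous fun p : 𝓢(Pt d, ℂ) × Sch d k => consLM d k p.1 p.2 :=
  (pullEquiv _).continuous.comp (continuous_tensor _ _)

/-- `ψ₁ ⊗ ⋯ ⊗ ψ_k`. -/
def prodT : (k : ℕ) → (Fin k → 𝓢(Pt d, ℂ)) → Sch d k
  | 0, _ => oneS
  | k + 1, ψ => consS (ψ 0) (prodT k fun i => ψ i.succ)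

theorem prodT_apply {k : ℕ} (ψ : Fin k → 𝓢(Pt d, ℂ)) (x : Conf d k) :
    prodT k ψ x = ∏ i, ψ i (x i) := by
  induction k with
  | zero => simp [prodT, oneS]
  | succ k ih => rw [prodT, consS_apply, ih, Fin.prod_univ_succ]

/-- `φ ⊗ ⋯ ⊗ δ ⊗ ⋯ ⊗ φ` with `δ` at the place `α`. -/
def insertPow (φ : 𝓢(Pt d, ℂ)) {k : ℕ} (α : Fin k) (δ : 𝓢(Pt d, ℂ)) : Sch d k :=
  prodT k (Function.update (fun _ => φ) α δ)

theorem insertPow_apply (φ : 𝓢(Pt d, ℂ)) {k : ℕ} (α : Fin (k + 1)) (δ : 𝓢(Pt d, ℂ))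
    (x : Conf d (k + 1)) :
    insertPow φ α δ x = δ (x α) * ∏ j, φ (x (α.succAbove j)) := by
  rw [insertPow, prodT_apply, Fin.prod_univ_succAbove _ α]
  simp

theorem conjS_insertPow (φ : 𝓢(Pt d, ℂ)) {k : ℕ} (α : Fin (k + 1)) (δ : 𝓢(Pt d, ℂ)) :
    conjS (insertPow φ α δ) = insertPow (conjS φ) α (conjS δ) := by
  ext x
  simp [insertPow_apply]

theorem insertPow_zero (φ : 𝓢(Pt d, ℂ)) (k : ℕ) (δ : 𝓢(Pt d, ℂ)) :
    insertPow φ (0 : Fin (k + 1)) δ = consS δ (tensorPow φ k) := by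
  ext x
  simp [insertPow_apply, consS_apply, tensorPow_apply]

theorem consS_insertPow (φ : 𝓢(Pt d, ℂ)) {k : ℕ} (α : Fin k) (δ : 𝓢(Pt d, ℂ)) :
    consS φ (insertPow φ α δ) = insertPow φ α.succ δ := by
  ext x
  rw [insertPow, insertPow, consS_apply, prodT_apply, prodT_apply, Fin.prod_univ_succ]
  rw [Function.update_of_ne (Fin.succ_ne_zero α).symm]
  congr 1
  refine Finset.prod_congr rfl fun i _ => ?_
  simp only [Function.update_apply, Fin.succ_inj]

theorem permS_insertPow (φ : 𝓢(Pt d, ℂ)) {k : ℕ} (α : Fin k) (δ : 𝓢(Pt d, ℂ))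
    (π : Equiv.Perm (Fin k)) : permS π (insertPow φ α δ) = insertPow φ (π α) δ := by
  ext x
  rw [permS_apply, insertPow, insertPow, prodT_apply, prodT_apply,
    ← Equiv.prod_comp π fun i => (Function.update (fun _ => φ) (π α) δ : _ → 𝓢(Pt d, ℂ)) i (x i)]
  refine Finset.prod_congr rfl fun i _ => ?_
  simp only [Function.update_apply, EmbeddingLike.apply_eq_iff_eq]

theorem permS_tensorPow (φ : 𝓢(Pt d, ℂ)) {k : ℕ} (π : Equiv.Perm (Fin k)) :
    permS π (tensorPow φ k) = tensorPow φ k := by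
  ext x
  rw [permS_apply, tensorPow_apply, tensorPow_apply, Equiv.prod_comp π fun i => φ (x i)]

theorem symS_tensorPow (φ : 𝓢(Pt d, ℂ)) (k : ℕ) : symS k (tensorPow φ k) = tensorPow φ k := by
  have h : (k.factorial : ℂ) ≠ 0 := by exact_mod_cast k.factorial_ne_zero
  simp only [symS, smul_apply, sum_apply, permS_tensorPow,
    Finset.sum_const, Finset.card_univ, Fintype.card_perm, Fintype.card_fin]
  rw [← Nat.cast_smul_eq_nsmul ℂ, smul_smul, inv_mul_cancel₀ h, one_smul]

theorem symOp_tensorPow {k : ℕ} (A : DVO d k) (φ ψ : 𝓢(Pt d, ℂ)) :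
    symOp A (tensorPow φ k) (tensorPow ψ k) = A (tensorPow φ k) (tensorPow ψ k) := by
  have h : (k.factorial : ℂ) ≠ 0 := by exact_mod_cast k.factorial_ne_zero
  simp only [symOp, ContinuousLinearMap.comp_apply, symS_tensorPow, smul_apply,
    sum_apply, permOp_apply, permS_tensorPow,
    Finset.sum_const, Finset.card_univ, Fintype.card_perm, Fintype.card_fin]
  rw [← Nat.cast_smul_eq_nsmul ℂ, smul_smul, inv_mul_cancel₀ h, one_smul]

theorem slot_tensorPow (φ ψ : 𝓢(Pt d, ℂ)) {k : ℕ} (α : Fin (k + 1)) (x' : Pt d) :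
    slot α ψ (tensorPow φ (k + 1)) x' = φ x' • insertPow φ α ψ := by
  ext y
  rw [slot_apply, tensorPow_apply, Fin.prod_univ_succAbove _ α, smul_apply, insertPow_apply]
  simp [mul_left_comm]

/-- Normalized at the origin, θ is a dummy factor: evaluation at x' = 0 removes it and leaves a test
function with a free first slot. -/
theorem slot_zero_consS (θ ψ : 𝓢(Pt d, ℂ)) (hθ : θ 0 = 1) {k : ℕ} (g : Sch d k) :
    slot 0 ψ (consS θ g) 0 = consS ψ g := by
  ext y
  rw [slot_apply, consS_apply, consS_apply]
  simp [hθ]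

theorem exists_schwartz_apply_zero : ∃ θ : 𝓢(Pt d, ℂ), θ 0 = 1 := by
  let b : ContDiffBump (0 : Pt d) := ⟨1, 2, one_pos, one_lt_two⟩
  refine ⟨HasCompactSupport.toSchwartzMap (f := fun x => ((b x : ℝ) : ℂ))
    (b.hasCompactSupport.comp_left Complex.ofReal_zero)
    (Complex.ofRealCLM.contDiff.comp b.contDiff), ?_⟩
  change ((b 0 : ℝ) : ℂ) = 1
  rw [b.one_of_mem_closedBall (by simp [b])]
  simp

end Products

/-! ### Smoothness of the embedding -/

section Smooth

/-- Complex conjugation as a real continuous linear map. -/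
def conjCLM (E : Type*) [NormedAddCommGroup E] [NormedSpace ℝ E] : 𝓢(E, ℂ) →L[ℝ] 𝓢(E, ℂ) :=
  SchwartzMap.postcompCLM (𝕜 := ℝ) (Complex.conjCLE : ℂ →L[ℝ] ℂ)

theorem isCk_tensorPow (k n : ℕ) : IsCk n fun φ : 𝓢(Pt d, ℂ) => tensorPow φ k := by
  induction k with
  | zero => exact isCk_const n oneS
  | succ k ih =>
    exact IsCk.bilinear (consLM d k) (continuous_consLM d k)
      (isCk_clm n (ContinuousLinearMap.id ℝ _)) ih

theorem isCk_conj_tensorPow (k n : ℕ) : IsCk n fun φ : 𝓢(Pt d, ℂ) => conjS (tensorPow φ k) :=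
  (isCk_tensorPow k n).clm_comp (conjCLM _)

theorem continuous_tensorPow (k : ℕ) : Continuous fun φ : 𝓢(Pt d, ℂ) => tensorPow φ k :=
  (isCk_tensorPow k 0).continuous

/-- Leibniz rule by peeling off the first factor: its variation is the term α = 0, and the others
are shifted by one place. -/
theorem hasGateauxDeriv_tensorPow (k : ℕ) (φ δ : 𝓢(Pt d, ℂ)) :
    HasGateauxDeriv (fun φ : 𝓢(Pt d, ℂ) => tensorPow φ k) φ δ (∑ α, insertPow φ α δ) := by
  induction k with
  | zero =>
    rw [Finset.univ_eq_empty, Finset.sum_empty]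
    exact hasGateauxDeriv_const (X := 𝓢(Pt d, ℂ)) (oneS : Sch d 0) φ δ
  | succ k ih =>
    have h := (hasGateauxDeriv_clm (ContinuousLinearMap.id ℝ 𝓢(Pt d, ℂ)) φ δ).bilinear
      (consLM d k) (continuous_consLM d k) ih (continuous_tensorPow k)
    rw [map_sum] at h
    rw [Fin.sum_univ_succ, insertPow_zero]
    simp only [← consS_insertPow]
    exact h

theorem hasGateauxDeriv_conj_tensorPow (k : ℕ) (φ δ : 𝓢(Pt d, ℂ)) :
    HasGateauxDeriv (fun φ : 𝓢(Pt d, ℂ) => conjS (tensorPow φ k)) φ δ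
      (∑ α, conjS (insertPow φ α δ)) := by
  have := (hasGateauxDeriv_tensorPow k φ δ).clm_comp (conjCLM _)
  rwa [map_sum] at this

variable (d) in
theorem isClosed_GInfStar : IsClosed (GInfStar d : Set (∀ n, Ker d (n + 1))) := by
  have hev : ∀ n (p : Conf d (n + 1) × Conf d (n + 1)),
      Continuous fun Γ : ∀ n, Ker d (n + 1) => Γ n p := fun n p =>
    (evalS _ p).continuous.comp (continuous_apply n)
  have e : (GInfStar d : Set (∀ n, Ker d (n + 1))) =
      {Γ | ∀ (n : ℕ) (x x' : Conf d (n + 1)),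
        (∀ π : Equiv.Perm (Fin (n + 1)),
          Γ n (fun i => x (π i), x') = Γ n (x, x') ∧ Γ n (x, fun i => x' (π i)) = Γ n (x, x')) ∧
        Γ n (x', x) = (starRingEnd ℂ) (Γ n (x, x'))} := rfl
  rw [e]
  simp only [Set.ofPred_forall, Set.ofPred_and]
  refine isClosed_iInter fun n => isClosed_iInter fun x => isClosed_iInter fun x' => ?_
  refine IsClosed.inter (isClosed_iInter fun π => IsClosed.inter ?_ ?_) ?_
  · exact isClosed_eq (hev n _) (hev n _)
  · exact isClosed_eq (hev n _) (hev n _)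
  · exact isClosed_eq (hev n _) (Complex.continuous_conj.comp (hev n _))

/-- The tensor product as a real bilinear map. -/
def tensorRealLM (E F : Type*) [NormedAddCommGroup E] [NormedSpace ℝ E] [NormedAddCommGroup F]
    [NormedSpace ℝ F] : 𝓢(E, ℂ) →ₗ[ℝ] 𝓢(F, ℂ) →ₗ[ℝ] 𝓢(E × F, ℂ) :=
  LinearMap.restrictScalars₁₂ ℝ ℝ (tensorLM E F)

theorem isCk_iota (n : ℕ) : IsCk n (iota (d := d)) := by
  refine IsCk.codRestrict (isClosed_GInfStar d) (isCk_pi fun m => ?_)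
  exact IsCk.bilinear (tensorRealLM _ _) (continuous_tensor _ _) (isCk_tensorPow _ n)
    (isCk_conj_tensorPow _ n)

end Smooth

/-! ### The symplectic form -/

section Symplectic

theorem integrable_schwartz_mul (f g : 𝓢(Pt d, ℂ)) : Integrable fun x => f x * g x := by
  have := (SchwartzMap.pairing (ContinuousLinearMap.mul ℂ ℂ) f g).integrable (μ := volume)
  exact this.congr (Eventually.of_forall fun x => by simp)

/-- `∫ f conj(g)` -/
def pairConj (f g : 𝓢(Pt d, ℂ)) : ℂ := ∫ x, f x * conjS g x

theorem conj_pairConj (f g : 𝓢(Pt d, ℂ)) : (starRingEnd ℂ) (pairConj f g) = pairConj g f := by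
  rw [pairConj, pairConj, ← integral_conj]
  refine integral_congr_ae (Eventually.of_forall fun x => ?_)
  simp [mul_comm]

theorem omegaL2_eq (f g : 𝓢(Pt d, ℂ)) : omegaL2 f g = 2 * (pairConj g f).im := by
  rw [omegaL2, pairConj]
  simp only [conjS_apply, mul_comm]

theorem pairConj_add_left (f f' g : 𝓢(Pt d, ℂ)) :
    pairConj (f + f') g = pairConj f g + pairConj f' g := by
  simp only [pairConj, add_apply, add_mul]
  exact integral_add (integrable_schwartz_mul _ _) (integrable_schwartz_mul _ _)

theorem pairConj_smul_left (c : ℝ) (f g : 𝓢(Pt d, ℂ)) :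
    pairConj (c • f) g = c * pairConj f g := by
  simp only [pairConj, smul_apply, Complex.real_smul, mul_assoc]
  exact integral_const_mul _ _

/-- The symplectic form as a real bilinear map. -/
def omegaLM (d : ℕ) : 𝓢(Pt d, ℂ) →ₗ[ℝ] 𝓢(Pt d, ℂ) →ₗ[ℝ] ℝ :=
  LinearMap.mk₂ ℝ omegaL2
    (fun f f' g => by
      rw [omegaL2_eq, omegaL2_eq, omegaL2_eq, ← conj_pairConj, pairConj_add_left, map_add,
        conj_pairConj, conj_pairConj, Complex.add_im]
      ring)
    (fun c f g => by
      rw [omegaL2_eq, omegaL2_eq, ← conj_pairConj, pairConj_smul_left, map_mul, conj_pairConj,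
        Complex.conj_ofReal, Complex.im_ofReal_mul, smul_eq_mul]
      ring)
    (fun f g g' => by
      rw [omegaL2_eq, omegaL2_eq, omegaL2_eq, pairConj_add_left, Complex.add_im]
      ring)
    (fun c f g => by
      rw [omegaL2_eq, omegaL2_eq, pairConj_smul_left, Complex.im_ofReal_mul, smul_eq_mul]
      ring)

theorem omegaLM_apply (f g : 𝓢(Pt d, ℂ)) : omegaLM d f g = omegaL2 f g := rfl

/-- Nondegeneracy of ω: testing with δ and iδ recovers the imaginary and the real part of the L²
pairing. -/
theorem eq_of_forall_omegaL2_eq {f g : 𝓢(Pt d, ℂ)} (h : ∀ δ, omegaL2 f δ = omegaL2 g δ) :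
    f = g := by
  have him : ∀ δ, (pairConj δ (f - g)).im = 0 := fun δ => by
    have e : omegaL2 (f - g) δ = 0 := by
      rw [← omegaLM_apply, map_sub, LinearMap.sub_apply, omegaLM_apply, omegaLM_apply, h, sub_self]
    rw [omegaL2_eq] at e
    linarith
  refine sub_eq_zero.1 (eq_of_forall_integral_mul_eq fun φ => ?_)
  have e : ∀ φ, ∫ x, (f - g) x * φ x = (starRingEnd ℂ) (pairConj (conjS φ) (f - g)) := fun φ => by
    rw [conj_pairConj, pairConj]
    simp
  have h1 := him (conjS φ)
  have h2 := him (Complex.I • conjS φ)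
  have h3 : pairConj (Complex.I • conjS φ) (f - g) = Complex.I * pairConj (conjS φ) (f - g) := by
    simp only [pairConj, smul_apply, smul_eq_mul, mul_assoc]
    exact integral_const_mul _ _
  rw [h3] at h2
  have h4 : pairConj (conjS φ) (f - g) = 0 := Complex.ext (by simpa using h2) h1
  rw [e, h4]
  simp

end Symplectic

/-! ### One-particle gradients -/

section Gradient

open scoped Classical in
/-- The Schwartz function `u` with `⟨A φ^{⊗(n+1)}, ψ ⊗ conj(φ)^{⊗n}⟩ = ∫ u ψ`. -/
def oneBody {n : ℕ} (A : DVO d (n + 1)) (φ : 𝓢(Pt d, ℂ)) : 𝓢(Pt d, ℂ) :=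
  if h : ∃ u : 𝓢(Pt d, ℂ), ∀ ψ, A (tensorPow φ (n + 1)) (insertPow (conjS φ) 0 ψ) = ∫ x, u x * ψ x
  then h.choose else 0

theorem oneBody_eq {n : ℕ} {A : DVO d (n + 1)} {φ u : 𝓢(Pt d, ℂ)}
    (h : ∀ ψ, A (tensorPow φ (n + 1)) (insertPow (conjS φ) 0 ψ) = ∫ x, u x * ψ x) :
    oneBody A φ = u := by
  have hex : ∃ u : 𝓢(Pt d, ℂ), ∀ ψ,
      A (tensorPow φ (n + 1)) (insertPow (conjS φ) 0 ψ) = ∫ x, u x * ψ x := ⟨u, h⟩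
  rw [oneBody, dif_pos hex]
  exact eq_of_forall_integral_mul_eq fun ψ => by rw [← hex.choose_spec ψ, ← h ψ]

/-- The good mapping property is applied in the first slot to θ ⊗ conj(φ)^{⊗n} and evaluated at x' =
0. The result is a continuous bilinear map of smooth functions of φ, hence smooth. -/
theorem HasGMP.exists_oneBody {n : ℕ} {A : DVO d (n + 1)} (hA : HasGMP A) :
    ∃ X : 𝓢(Pt d, ℂ) → 𝓢(Pt d, ℂ), (∀ m, IsCk m X) ∧ ∀ φ ψ,
      A (tensorPow φ (n + 1)) (insertPow (conjS φ) 0 ψ) = ∫ x, X φ x * ψ x := by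
  obtain ⟨Φ, hΦc, hΦ⟩ := hA 0
  obtain ⟨θ, hθ⟩ := exists_schwartz_apply_zero (d := d)
  refine ⟨fun φ => sliceSnd (Pt d) (0 : Pt d)
    (Φ (tensorPow φ (n + 1)) (consS θ (conjS (tensorPow φ n)))), fun m => ?_, fun φ ψ => ?_⟩
  · have h1 : IsCk m fun φ : 𝓢(Pt d, ℂ) => consS θ (conjS (tensorPow φ n)) :=
      IsCk.bilinear (consLM d n) (continuous_consLM d n) (isCk_const m θ) (isCk_conj_tensorPow n m)
    exact (IsCk.bilinear (LinearMap.restrictScalars₁₂ ℝ ℝ Φ) hΦc (isCk_tensorPow _ m) h1).clm_comp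
      ((sliceSnd (Pt d) (0 : Pt d)).restrictScalars ℝ)
  · simp only [sliceSnd_apply]
    rw [← hΦ, slot_zero_consS θ ψ hθ, insertPow_zero, conjS_tensorPow]

theorem HasGMP.apply_insertPow_zero {n : ℕ} {A : DVO d (n + 1)} (hA : HasGMP A)
    (φ ψ : 𝓢(Pt d, ℂ)) :
    A (tensorPow φ (n + 1)) (insertPow (conjS φ) 0 ψ) = ∫ x, oneBody A φ x * ψ x := by
  obtain ⟨X, -, hX⟩ := hA.exists_oneBody
  rw [oneBody_eq (hX φ), hX]

theorem HasGMP.isCk_oneBody {n : ℕ} {A : DVO d (n + 1)} (hA : HasGMP A) (m : ℕ) :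
    IsCk m (oneBody A) := by
  obtain ⟨X, hXs, hX⟩ := hA.exists_oneBody
  rw [show oneBody A = X from funext fun φ => oneBody_eq (hX φ)]
  exact hXs m

/-- By bosonic symmetry of the output, a transposition moves any slot to the first. -/
theorem IsObservable.apply_insertPow {n : ℕ} {A : DVO d (n + 1)} (hA : IsObservable A)
    (φ ψ : 𝓢(Pt d, ℂ)) (α : Fin (n + 1)) :
    A (tensorPow φ (n + 1)) (insertPow (conjS φ) α ψ) = ∫ x, oneBody A φ x * ψ x := by
  rw [← hA.gmp.apply_insertPow_zero, ← hA.symm_left (Equiv.swap 0 α) _ (insertPow _ 0 ψ),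
    permS_insertPow, Equiv.swap_apply_left]

theorem IsObservable.apply_conj_insertPow {n : ℕ} {A : DVO d (n + 1)} (hA : IsObservable A)
    (φ ψ : 𝓢(Pt d, ℂ)) (α : Fin (n + 1)) :
    A (tensorPow φ (n + 1)) (conjS (insertPow φ α ψ)) = pairConj (oneBody A φ) ψ := by
  rw [conjS_insertPow, hA.apply_insertPow, pairConj]

theorem IsObservable.insertPow_apply {n : ℕ} {A : DVO d (n + 1)} (hA : IsObservable A)
    (φ ψ : 𝓢(Pt d, ℂ)) (α : Fin (n + 1)) :
    A (insertPow φ α ψ) (conjS (tensorPow φ (n + 1))) = -pairConj ψ (oneBody A φ) := by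
  rw [hA.skew, hA.apply_conj_insertPow, conj_pairConj]

theorem oneBody_zero {n : ℕ} (φ : 𝓢(Pt d, ℂ)) : oneBody (0 : DVO d (n + 1)) φ = 0 :=
  oneBody_eq fun ψ => by simp

theorem oneBody_add {n : ℕ} {A B : DVO d (n + 1)} (hA : HasGMP A) (hB : HasGMP B)
    (φ : 𝓢(Pt d, ℂ)) : oneBody (A + B) φ = oneBody A φ + oneBody B φ :=
  oneBody_eq fun ψ => by
    simp only [add_apply, hA.apply_insertPow_zero, hB.apply_insertPow_zero,
      add_mul]
    exact (integral_add (integrable_schwartz_mul _ _) (integrable_schwartz_mul _ _)).symm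

theorem oneBody_smul {n : ℕ} {A : DVO d (n + 1)} (hA : HasGMP A) (c : ℝ)
    (φ : 𝓢(Pt d, ℂ)) : oneBody ((c : ℂ) • A) φ = c • oneBody A φ :=
  oneBody_eq fun ψ => by
    simp only [smul_apply, hA.apply_insertPow_zero,
      Complex.real_smul, smul_eq_mul, mul_assoc]
    exact (integral_const_mul _ _).symm

/-- The derivative of the expectation value `i ⟨A φ^{⊗(n+1)}, conj(φ)^{⊗(n+1)}⟩`. -/
theorem IsObservable.hasGateauxDeriv {n : ℕ} {A : DVO d (n + 1)} (hA : IsObservable A)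
    (φ δ : 𝓢(Pt d, ℂ)) :
    HasGateauxDeriv (fun φ => (Complex.I * A (tensorPow φ (n + 1))
      (conjS (tensorPow φ (n + 1)))).re)
      φ δ (omegaL2 ((n + 1 : ℝ) • oneBody A φ) δ) := by
  have h := (hasGateauxDeriv_tensorPow (n + 1) φ δ).bilinear
    (LinearMap.restrictScalars₁₂ ℝ ℝ (DVO.bilin A)) A.continuous_uncurry
    (hasGateauxDeriv_conj_tensorPow (n + 1) φ δ) (isCk_conj_tensorPow (n + 1) 0).continuous
  have h' := h.clm_comp (Complex.reCLM.comp ((ContinuousLinearMap.mul ℝ ℂ) Complex.I))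
  rw [map_sum, map_sum, LinearMap.sum_apply] at h'
  refine (congrArg (HasGateauxDeriv _ φ δ) ?_).mpr h'
  change _ = (Complex.I * (∑ α, A (insertPow φ α δ) (conjS (tensorPow φ (n + 1))) +
    ∑ α, A (tensorPow φ (n + 1)) (conjS (insertPow φ α δ)))).re
  -- With z = ∫ u conj(δ), the variations in φ and in conj(φ) contribute -conj(z) and z for each
  -- particle; i(z - conj z) = -2 Im z = ω(u, δ).
  simp only [hA.insertPow_apply, hA.apply_conj_insertPow]
  rw [← omegaLM_apply, map_smul, LinearMap.smul_apply, omegaLM_apply, omegaL2_eq,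
    ← conj_pairConj δ]
  simp
  ring

end Gradient

/-! ### Observable hierarchies form a real vector space -/

section Hierarchies

theorem HasGMP.add {k : ℕ} {A B : DVO d k} (hA : HasGMP A) (hB : HasGMP B) : HasGMP (A + B) := by
  intro α
  obtain ⟨Φ, hΦc, hΦ⟩ := hA α
  obtain ⟨Ψ, hΨc, hΨ⟩ := hB α
  refine ⟨Φ + Ψ, hΦc.add hΨc, fun f g φ x' => ?_⟩
  have h1 := integrable_schwartz_mul (sliceSnd (Pt d) x' (Φ f g)) φ
  have h2 := integrable_schwartz_mul (sliceSnd (Pt d) x' (Ψ f g)) φ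
  simp only [sliceSnd_apply] at h1 h2
  simp only [add_apply, LinearMap.add_apply, hΦ, hΨ, add_mul]
  exact (integral_add h1 h2).symm

theorem HasGMP.smul {k : ℕ} {A : DVO d k} (hA : HasGMP A) (c : ℂ) : HasGMP (c • A) := by
  intro α
  obtain ⟨Φ, hΦc, hΦ⟩ := hA α
  refine ⟨c • Φ, hΦc.const_smul c, fun f g φ x' => ?_⟩
  simp only [smul_apply, LinearMap.smul_apply, hΦ, smul_eq_mul, mul_assoc]
  exact (integral_const_mul _ _).symm

theorem IsObservable.add {k : ℕ} {A B : DVO d k} (hA : IsObservable A) (hB : IsObservable B) :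
    IsObservable (A + B) where
  gmp := hA.gmp.add hB.gmp
  symm_right π f g := by simp [hA.symm_right, hB.symm_right]
  symm_left π f g := by simp [hA.symm_left, hB.symm_left]
  skew f g := by
    simp only [add_apply, map_add, hA.skew f g, hB.skew f g, neg_add]

theorem IsObservable.smul {k : ℕ} {A : DVO d k} (hA : IsObservable A) (c : ℝ) :
    IsObservable ((c : ℂ) • A) where
  gmp := hA.gmp.smul c
  symm_right π f g := by simp [hA.symm_right]
  symm_left π f g := by simp [hA.symm_left]
  skew f g := by
    simp only [smul_apply, smul_eq_mul, map_mul, Complex.conj_ofReal, hA.skew f g, mul_neg]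

theorem isObservable_zero {k : ℕ} : IsObservable (0 : DVO d k) where
  gmp _ := ⟨0, continuous_const, fun f g φ x' => by simp⟩
  symm_right π f g := by simp
  symm_left π f g := by simp
  skew f g := by simp

theorem DVO.zero_add_zero {k : ℕ} : (0 + 0 : DVO d k) = 0 :=
  ContinuousLinearMap.ext fun _ => ContinuousLinearMap.ext fun _ => add_zero (0 : ℂ)

theorem DVO.smul_zero {k : ℕ} (c : ℂ) : c • (0 : DVO d k) = 0 :=
  ContinuousLinearMap.ext fun f => ContinuousLinearMap.ext fun g => by
    simp only [smul_apply, zero_apply, _root_.smul_zero]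

theorem zero_mem_GInf : (0 : ∀ n, DVO d (n + 1)) ∈ GInf d :=
  ⟨fun _ => isObservable_zero, by simp⟩

theorem add_mem_GInf {A B : ∀ n, DVO d (n + 1)} (hA : A ∈ GInf d) (hB : B ∈ GInf d) :
    A + B ∈ GInf d := by
  refine ⟨fun n => (hA.1 n).add (hB.1 n), (hA.2.union hB.2).subset fun n hn => ?_⟩
  by_contra h
  simp only [Set.mem_union, Set.mem_ofPred_eq, not_or, not_not] at h
  exact hn (by rw [Pi.add_apply, h.1, h.2, DVO.zero_add_zero])

theorem smul_mem_GInf {A : ∀ n, DVO d (n + 1)} (c : ℝ) (hA : A ∈ GInf d) :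
    (fun n => (c : ℂ) • A n) ∈ GInf d := by
  refine ⟨fun n => (hA.1 n).smul c, hA.2.subset fun n hn h => hn ?_⟩
  simp only [h, DVO.smul_zero]

theorem exists_eq_zero_of_le_of_mem_GInf {A : ∀ n, DVO d (n + 1)} (hA : A ∈ GInf d) :
    ∃ N, ∀ n, N ≤ n → A n = 0 := by
  obtain ⟨N, hN⟩ := hA.2.bddAbove
  refine ⟨N + 1, fun n hn => ?_⟩
  by_contra h
  have := hN h
  omega

theorem traceHier_eq_sum {A : ∀ n, DVO d (n + 1)} {N : ℕ} (hN : ∀ n, N ≤ n → A n = 0)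
    (Γ : GInfStar d) : traceHier A Γ = ∑ n ∈ Finset.range N, genTrace (A n) (Γ.1 n) := by
  refine finsum_eq_sum_of_support_subset _ fun n hn => ?_
  by_contra h
  refine hn ?_
  simp only [genTrace_eq, hN n (by simpa using h), schwartzKernel_zero]
  rfl

theorem traceHier_zero (Γ : GInfStar d) : traceHier 0 Γ = 0 := by
  rw [traceHier_eq_sum (A := 0) (N := 0) (fun _ _ => rfl), Finset.sum_range_zero]

theorem traceHier_add {A B : ∀ n, DVO d (n + 1)} (hA : A ∈ GInf d) (hB : B ∈ GInf d)
    (Γ : GInfStar d) : traceHier (A + B) Γ = traceHier A Γ + traceHier B Γ := by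
  obtain ⟨N, hN⟩ := exists_eq_zero_of_le_of_mem_GInf hA
  obtain ⟨M, hM⟩ := exists_eq_zero_of_le_of_mem_GInf hB
  have hN' : ∀ n, max N M ≤ n → A n = 0 := fun n hn => hN n (le_of_max_le_left hn)
  have hM' : ∀ n, max N M ≤ n → B n = 0 := fun n hn => hM n (le_of_max_le_right hn)
  rw [traceHier_eq_sum hN', traceHier_eq_sum hM', traceHier_eq_sum (N := max N M)
    (fun n hn => by rw [Pi.add_apply, hN' n hn, hM' n hn, DVO.zero_add_zero]),
    ← Finset.sum_add_distrib]
  simp only [genTrace, Pi.add_apply, schwartzKernel_add, add_apply]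

theorem traceHier_smul {A : ∀ n, DVO d (n + 1)} (hA : A ∈ GInf d) (c : ℂ)
    (Γ : GInfStar d) : traceHier (fun n => c • A n) Γ = c * traceHier A Γ := by
  obtain ⟨N, hN⟩ := exists_eq_zero_of_le_of_mem_GInf hA
  rw [traceHier_eq_sum hN, traceHier_eq_sum (N := N) (fun n hn => by rw [hN n hn, DVO.smul_zero]),
    Finset.mul_sum]
  simp only [genTrace, schwartzKernel_smul, smul_apply, smul_eq_mul]

theorem traceHier_add_smul {A : ∀ n, DVO d (n + 1)} (hA : A ∈ GInf d) (Γ v : GInfStar d) (t : ℝ) :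
    traceHier A (Γ + t • v) = traceHier A Γ + t * traceHier A v := by
  obtain ⟨N, hN⟩ := exists_eq_zero_of_le_of_mem_GInf hA
  simp only [traceHier_eq_sum hN, Finset.mul_sum, ← Finset.sum_add_distrib]
  refine Finset.sum_congr rfl fun n _ => ?_
  simp only [genTrace_eq]
  have : (Γ + t • v).1 n = Γ.1 n + (t : ℂ) • v.1 n := by
    ext p
    simp
  rw [this, map_add, map_smul, smul_eq_mul]

theorem hasGateauxDeriv_trace {A : ∀ n, DVO d (n + 1)} (hA : A ∈ GInf d) (Γ v : GInfStar d) :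
    HasGateauxDeriv (fun Γ => Complex.I * traceHier A Γ) Γ v (Complex.I * traceHier A v) := by
  refine tendsto_const_nhds.congr' ?_
  filter_upwards [self_mem_nhdsWithin] with t ht
  have ht' : (t : ℂ) ≠ 0 := by exact_mod_cast ht
  rw [traceHier_add_smul hA, Complex.real_smul, Complex.ofReal_inv]
  field_simp
  ring

theorem genTrace_iota {n : ℕ} (A : DVO d (n + 1)) (φ : 𝓢(Pt d, ℂ)) :
    genTrace A ((iota φ).1 n) = A (tensorPow φ (n + 1)) (conjS (tensorPow φ (n + 1))) :=
  genTrace_tensor A _ _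

end Hierarchies

/-! ### Gradients of expectation values -/

section GradField

/-- The symplectic gradient at `φ` of `φ ↦ i Tr(A · ι(φ))`. -/
def gradField (A : ∀ n, DVO d (n + 1)) (φ : 𝓢(Pt d, ℂ)) : 𝓢(Pt d, ℂ) :=
  ∑ᶠ n : ℕ, ((n : ℝ) + 1) • oneBody (A n) φ

theorem gradField_eq_sum {A : ∀ n, DVO d (n + 1)} {N : ℕ} (hN : ∀ n, N ≤ n → A n = 0)
    (φ : 𝓢(Pt d, ℂ)) :
    gradField A φ = ∑ n ∈ Finset.range N, ((n : ℝ) + 1) • oneBody (A n) φ := by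
  refine finsum_eq_sum_of_support_subset _ fun n hn => ?_
  by_contra h
  refine hn ?_
  simp only [hN n (by simpa using h), oneBody_zero, smul_zero]

theorem gradField_zero (φ : 𝓢(Pt d, ℂ)) : gradField 0 φ = 0 := by
  rw [gradField_eq_sum (A := 0) (N := 0) (fun _ _ => rfl), Finset.sum_range_zero]

theorem gradField_add {A B : ∀ n, DVO d (n + 1)} (hA : A ∈ GInf d) (hB : B ∈ GInf d)
    (φ : 𝓢(Pt d, ℂ)) : gradField (A + B) φ = gradField A φ + gradField B φ := by
  obtain ⟨N, hN⟩ := exists_eq_zero_of_le_of_mem_GInf hA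
  obtain ⟨M, hM⟩ := exists_eq_zero_of_le_of_mem_GInf hB
  have hN' : ∀ n, max N M ≤ n → A n = 0 := fun n hn => hN n (le_of_max_le_left hn)
  have hM' : ∀ n, max N M ≤ n → B n = 0 := fun n hn => hM n (le_of_max_le_right hn)
  rw [gradField_eq_sum hN', gradField_eq_sum hM', gradField_eq_sum (N := max N M)
    (fun n hn => by rw [Pi.add_apply, hN' n hn, hM' n hn, DVO.zero_add_zero]),
    ← Finset.sum_add_distrib]
  simp only [Pi.add_apply, oneBody_add (hA.1 _).gmp (hB.1 _).gmp, smul_add]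

theorem gradField_smul {A : ∀ n, DVO d (n + 1)} (hA : A ∈ GInf d) (c : ℝ)
    (φ : 𝓢(Pt d, ℂ)) : gradField (fun n => (c : ℂ) • A n) φ = c • gradField A φ := by
  obtain ⟨N, hN⟩ := exists_eq_zero_of_le_of_mem_GInf hA
  rw [gradField_eq_sum hN, gradField_eq_sum (N := N) (fun n hn => by rw [hN n hn, DVO.smul_zero]),
    Finset.smul_sum]
  simp only [oneBody_smul (hA.1 _).gmp, smul_comm c]

theorem isCk_sum {ι : Type*} {X : Type*} {Y : Type*} [AddCommGroup X] [Module ℝ X]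
    [TopologicalSpace X] [AddCommGroup Y] [Module ℝ Y] [TopologicalSpace Y] [ContinuousAdd Y]
    {m : ℕ} (s : Finset ι) {f : ι → X → Y} (h : ∀ i, IsCk m (f i)) :
    IsCk m fun x => ∑ i ∈ s, f i x := by
  classical
  induction s using Finset.induction_on with
  | empty => simpa using isCk_const m (0 : Y)
  | insert i s hi ih =>
    simp only [Finset.sum_insert hi]
    exact (h i).add ih

theorem HasGateauxDeriv.sum {ι : Type*} {X : Type*} {Y : Type*} [AddCommGroup X] [Module ℝ X]
    [AddCommGroup Y] [Module ℝ Y] [TopologicalSpace Y] [ContinuousAdd Y]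
    (s : Finset ι) {f : ι → X → Y} {x v : X} {y : ι → Y}
    (h : ∀ i, HasGateauxDeriv (f i) x v (y i)) :
    HasGateauxDeriv (fun x => ∑ i ∈ s, f i x) x v (∑ i ∈ s, y i) := by
  classical
  induction s using Finset.induction_on with
  | empty => simpa using hasGateauxDeriv_const (0 : Y) x v
  | insert i s hi ih =>
    simp only [Finset.sum_insert hi]
    exact (h i).add ih

theorem isCk_gradField {A : ∀ n, DVO d (n + 1)} (hA : A ∈ GInf d) (m : ℕ) :
    IsCk m (gradField A) := by
  obtain ⟨N, hN⟩ := exists_eq_zero_of_le_of_mem_GInf hA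
  rw [show gradField A = _ from funext (gradField_eq_sum hN)]
  exact isCk_sum _ fun n => ((hA.1 n).gmp.isCk_oneBody m).clm_comp
    (((n : ℝ) + 1) • ContinuousLinearMap.id ℝ 𝓢(Pt d, ℂ))

theorem re_trace_iota_eq_sum {A : ∀ n, DVO d (n + 1)} {N : ℕ} (hN : ∀ n, N ≤ n → A n = 0)
    (φ : 𝓢(Pt d, ℂ)) : (Complex.I * traceHier A (iota φ)).re = ∑ n ∈ Finset.range N,
      (Complex.I * A n (tensorPow φ (n + 1)) (conjS (tensorPow φ (n + 1)))).re := by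
  rw [traceHier_eq_sum hN, Finset.mul_sum, Complex.re_sum]
  simp only [genTrace_iota]

theorem isCk_re_trace_iota {A : ∀ n, DVO d (n + 1)} (hA : A ∈ GInf d) (m : ℕ) :
    IsCk m fun φ : 𝓢(Pt d, ℂ) => (Complex.I * traceHier A (iota φ)).re := by
  obtain ⟨N, hN⟩ := exists_eq_zero_of_le_of_mem_GInf hA
  simp only [re_trace_iota_eq_sum hN]
  exact isCk_sum _ fun n => (IsCk.bilinear (LinearMap.restrictScalars₁₂ ℝ ℝ (DVO.bilin (A n)))
    (A n).continuous_uncurry (isCk_tensorPow _ m) (isCk_conj_tensorPow _ m)).clm_comp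
    (Complex.reCLM.comp ((ContinuousLinearMap.mul ℝ ℂ) Complex.I))

theorem hasGateauxDeriv_re_trace_iota {A : ∀ n, DVO d (n + 1)} (hA : A ∈ GInf d)
    (φ δ : 𝓢(Pt d, ℂ)) :
    HasGateauxDeriv (fun φ : 𝓢(Pt d, ℂ) => (Complex.I * traceHier A (iota φ)).re) φ δ
      (omegaL2 (gradField A φ) δ) := by
  obtain ⟨N, hN⟩ := exists_eq_zero_of_le_of_mem_GInf hA
  simp only [re_trace_iota_eq_sum hN, gradField_eq_sum hN]
  rw [← omegaLM_apply, map_sum, LinearMap.sum_apply]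
  exact HasGateauxDeriv.sum _ fun n => (hA.1 n).hasGateauxDeriv φ δ

/-- The gradient depends only on the linear functional represented by the hierarchy. -/
theorem gradField_congr {A B : ∀ n, DVO d (n + 1)} (hA : A ∈ GInf d) (hB : B ∈ GInf d)
    (h : ∀ v, traceHier A v = traceHier B v) (φ : 𝓢(Pt d, ℂ)) : gradField A φ = gradField B φ := by
  -- Both fields are symplectic gradients of the same function of φ.
  refine eq_of_forall_omegaL2_eq fun δ => (hasGateauxDeriv_re_trace_iota hA φ δ).unique ?_
  simp only [h]
  exact hasGateauxDeriv_re_trace_iota hB φ δ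

end GradField

/-! ### Functionals in the algebra `𝒜_∞` -/

section Algebra

theorem hasGateauxDeriv_iff_hasDerivAt {X Y : Type*} [AddCommGroup X] [Module ℝ X]
    [NormedAddCommGroup Y] [NormedSpace ℝ Y] {f : X → Y} {x v : X} {y : Y} :
    HasGateauxDeriv f x v y ↔ HasDerivAt (fun t : ℝ => f (x + t • v)) y 0 := by
  rw [hasDerivAt_iff_tendsto_slope_zero]
  simp [HasGateauxDeriv]

theorem HasGateauxDeriv.mul {X 𝔸 : Type*} [AddCommGroup X] [Module ℝ X]
    [NormedCommRing 𝔸] [NormedAlgebra ℝ 𝔸] {f g : X → 𝔸} {x v : X} {a b : 𝔸}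
    (hf : HasGateauxDeriv f x v a) (hg : HasGateauxDeriv g x v b) :
    HasGateauxDeriv (fun x => f x * g x) x v (a * g x + f x * b) := by
  rw [hasGateauxDeriv_iff_hasDerivAt] at hf hg ⊢
  have h := hf.mul hg
  rw [zero_smul, add_zero] at h
  exact h

/-- `F ∘ ι` is smooth with smooth symplectic gradient `X`, and `F` has at `ι(φ)` a derivative
represented by a hierarchy whose gradient at `φ` is `X(φ)`. -/
def HasGradient (F : GInfStar d → ℝ) (X : 𝓢(Pt d, ℂ) → 𝓢(Pt d, ℂ)) : Prop :=
  (∀ m, IsCk m (F ∘ iota)) ∧ (∀ m, IsCk m X) ∧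
    (∀ φ δ, HasGateauxDeriv (F ∘ iota) φ δ (omegaL2 (X φ) δ)) ∧
    ∀ φ, ∃ D ∈ GInf d, (∀ v, HasGateauxDeriv (fun Γ => (F Γ : ℂ)) (iota φ) v
      (Complex.I * traceHier D v)) ∧ gradField D φ = X φ

theorem hasGradient_trace {F : GInfStar d → ℝ} {A : ∀ n, DVO d (n + 1)} (hA : A ∈ GInf d)
    (h : ∀ Γ, (F Γ : ℂ) = Complex.I * traceHier A Γ) : HasGradient F (gradField A) := by
  have e : F ∘ iota = fun φ : 𝓢(Pt d, ℂ) => (Complex.I * traceHier A (iota φ)).re := by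
    funext φ
    rw [← h, Complex.ofReal_re, Function.comp_apply]
  refine ⟨fun m => e ▸ isCk_re_trace_iota hA m, isCk_gradField hA,
    fun φ δ => e ▸ hasGateauxDeriv_re_trace_iota hA φ δ, fun φ => ⟨A, hA, fun v => ?_, rfl⟩⟩
  simp only [h]
  exact hasGateauxDeriv_trace hA _ v

theorem hasGradient_const (c : ℝ) : HasGradient (d := d) (fun _ => c) 0 := by
  refine ⟨fun m => isCk_const m c, fun m => isCk_const m 0, fun φ δ => ?_,
    fun φ => ⟨0, zero_mem_GInf, fun v => ?_, gradField_zero φ⟩⟩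
  · rw [Pi.zero_apply, ← omegaLM_apply, map_zero, LinearMap.zero_apply]
    exact hasGateauxDeriv_const c φ δ
  · rw [traceHier_zero, mul_zero]
    exact hasGateauxDeriv_const (c : ℂ) (iota φ) v

theorem HasGradient.add {F G : GInfStar d → ℝ} {X Y : 𝓢(Pt d, ℂ) → 𝓢(Pt d, ℂ)}
    (hF : HasGradient F X) (hG : HasGradient G Y) : HasGradient (F + G) (X + Y) := by
  obtain ⟨hF1, hF2, hF3, hF4⟩ := hF
  obtain ⟨hG1, hG2, hG3, hG4⟩ := hG
  refine ⟨fun m => (hF1 m).add (hG1 m), fun m => (hF2 m).add (hG2 m), fun φ δ => ?_, fun φ => ?_⟩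
  · rw [Pi.add_apply, ← omegaLM_apply, map_add, LinearMap.add_apply]
    exact (hF3 φ δ).add (hG3 φ δ)
  · obtain ⟨D, hD, hDF, hDX⟩ := hF4 φ
    obtain ⟨E, hE, hEG, hEY⟩ := hG4 φ
    refine ⟨D + E, add_mem_GInf hD hE, fun v => ?_, ?_⟩
    · rw [traceHier_add hD hE, mul_add]
      simp only [Pi.add_apply, Complex.ofReal_add]
      exact (hDF v).add (hEG v)
    · rw [gradField_add hD hE, hDX, hEY, Pi.add_apply]

/-- At a fixed state the values of `F` and `G` are real scalars, so Leibniz gives a real linear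
combination of the representing hierarchies, which again lies in `GInf`. -/
theorem HasGradient.mul {F G : GInfStar d → ℝ} {X Y : 𝓢(Pt d, ℂ) → 𝓢(Pt d, ℂ)}
    (hF : HasGradient F X) (hG : HasGradient G Y) :
    HasGradient (F * G) (fun φ => F (iota φ) • Y φ + G (iota φ) • X φ) := by
  obtain ⟨hF1, hF2, hF3, hF4⟩ := hF
  obtain ⟨hG1, hG2, hG3, hG4⟩ := hG
  refine ⟨fun m => IsCk.bilinear (LinearMap.mul ℝ ℝ) continuous_mul (hF1 m) (hG1 m), fun m => ?_,
    fun φ δ => ?_, fun φ => ?_⟩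
  · exact (IsCk.bilinear (LinearMap.lsmul ℝ 𝓢(Pt d, ℂ)) continuous_smul (hF1 m)
      (hG2 m)).add (IsCk.bilinear (LinearMap.lsmul ℝ 𝓢(Pt d, ℂ)) continuous_smul (hG1 m)
      (hF2 m))
  · have h := (hF3 φ δ).mul (hG3 φ δ)
    rw [← omegaLM_apply, map_add, map_smul, map_smul, LinearMap.add_apply, LinearMap.smul_apply,
      LinearMap.smul_apply, omegaLM_apply, omegaLM_apply, smul_eq_mul, smul_eq_mul, add_comm,
      mul_comm (G (iota φ))]
    exact h
  · obtain ⟨D, hD, hDF, hDX⟩ := hF4 φ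
    obtain ⟨E, hE, hEG, hEY⟩ := hG4 φ
    have hE' := smul_mem_GInf (F (iota φ)) hE
    have hD' := smul_mem_GInf (G (iota φ)) hD
    refine ⟨_, add_mem_GInf hE' hD', fun v => ?_, ?_⟩
    · rw [traceHier_add hE' hD', traceHier_smul hE, traceHier_smul hD]
      simp only [Pi.mul_apply, Complex.ofReal_mul]
      refine (congrArg (HasGateauxDeriv _ (iota φ) v) ?_).mpr ((hDF v).mul (hEG v))
      ring
    · rw [gradField_add hE' hD', gradField_smul hE, gradField_smul hD, hDX, hEY]

theorem exists_hasGradient {F : GInfStar d → ℝ} (hF : F ∈ AInf d) : ∃ X, HasGradient F X := by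
  induction hF using Algebra.adjoin_induction with
  | mem F hF =>
    rcases hF with ⟨-, A, hA, h⟩ | ⟨-, c, h⟩
    · exact ⟨_, hasGradient_trace hA h⟩
    · obtain rfl : F = fun _ => c := funext h
      exact ⟨_, hasGradient_const c⟩
  | algebraMap c => exact ⟨_, hasGradient_const c⟩
  | add F G _ _ hF hG => exact ⟨_, hF.choose_spec.add hG.choose_spec⟩
  | mul F G _ _ hF hG => exact ⟨_, hF.choose_spec.mul hG.choose_spec⟩

theorem HasGradient.mem_AS {F : GInfStar d → ℝ} {X : 𝓢(Pt d, ℂ) → 𝓢(Pt d, ℂ)}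
    (h : HasGradient F X) : F ∘ iota ∈ AS d :=
  ⟨isSmooth_of_forall_isCk h.1, X, isSmooth_of_forall_isCk h.2.1, h.2.2.1⟩

theorem HasGradient.symGrad_eq {F : GInfStar d → ℝ} {X : 𝓢(Pt d, ℂ) → 𝓢(Pt d, ℂ)}
    (h : HasGradient F X) (φ : 𝓢(Pt d, ℂ)) : symGrad (F ∘ iota) φ = X φ := by
  have hex : ∃ g : 𝓢(Pt d, ℂ), ∀ δ, HasGateauxDeriv (F ∘ iota) φ δ (omegaL2 g δ) :=
    ⟨X φ, h.2.2.1 φ⟩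
  rw [symGrad, dif_pos hex]
  exact eq_of_forall_omegaL2_eq fun δ => (hex.choose_spec δ).unique (h.2.2.1 φ δ)

/-- The chosen representative and the one from the induction have the same trace pairing, by
uniqueness of derivatives, hence the same gradient. -/
theorem HasGradient.diffRep {F : GInfStar d → ℝ} {X : 𝓢(Pt d, ℂ) → 𝓢(Pt d, ℂ)}
    (h : HasGradient F X) (φ : 𝓢(Pt d, ℂ)) :
    diffRep F (iota φ) ∈ GInf d ∧ gradField (diffRep F (iota φ)) φ = X φ := by
  obtain ⟨D, hD, hDF, hDX⟩ := h.2.2.2 φ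
  have hex : ∃ D ∈ GInf d, ∀ v : GInfStar d,
      HasGateauxDeriv (fun Γ => (F Γ : ℂ)) (iota φ) v (Complex.I * traceHier D v) := ⟨D, hD, hDF⟩
  rw [GPPoisson.diffRep, dif_pos hex]
  refine ⟨hex.choose_spec.1, ?_⟩
  rw [← hDX]
  refine gradField_congr hex.choose_spec.1 hD (fun v => ?_) φ
  exact mul_left_cancel₀ Complex.I_ne_zero ((hex.choose_spec.2 v).unique (hDF v))

end Algebra

/-! ### The bracket of hierarchies on factorized states -/

section Bracket

theorem freeze_tensorPow {a b n : ℕ} (h : a + b = n) (α : Fin (a + 1)) (β : Fin (b + 1))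
    (x : Conf d (a + 1)) (φ : 𝓢(Pt d, ℂ)) :
    freeze h α β x (tensorPow φ (n + 1)) =
      (∏ j, φ (x (α.succAbove j))) • tensorPow φ (b + 1) := by
  subst h
  ext y
  rw [freeze_apply, tensorPow_apply, smul_apply, tensorPow_apply, smul_eq_mul,
    Fin.prod_univ_succAbove _ β, ← mul_assoc, mul_comm (∏ j, φ (x (α.succAbove j)))]
  -- The product over all particles splits into the first a + 1 and the last b; the former contains
  -- y_β at place α.
  have e : ∀ g : Fin (a + b + 1) → ℂ, ∏ i, g i =
      (∏ i : Fin (a + 1), g (Fin.cast (by omega) (Fin.castAdd b i))) *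
        ∏ j : Fin b, g (Fin.cast (by omega) (Fin.natAdd (a + 1) j)) := fun g => by
    rw [← Fin.prod_univ_add (fun i : Fin (a + 1 + b) => g (Fin.cast (by omega) i))]
    exact (Equiv.prod_comp (finCongr (by omega : a + 1 + b = a + b + 1)) g).symm
  rw [e, Fin.prod_univ_succAbove _ α]
  congr 1
  · congr 1
    · simp [glue, Nat.lt_succ_iff.1 α.2]
    · refine Finset.prod_congr rfl fun j _ => ?_
      have hj := (α.succAbove j).2
      simp [glue, Fin.succAbove_ne, Nat.lt_succ_iff.1 hj]
  · refine Finset.prod_congr rfl fun j _ => ?_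
    have hj : ¬ a + 1 + (j : ℕ) ≤ a := by omega
    simp [glue, hj]

theorem IsObservable.partialKernel_eq {b : ℕ} {B : DVO d (b + 1)} (hB : IsObservable B)
    (β : Fin (b + 1)) (φ : 𝓢(Pt d, ℂ)) (c c' : ℂ) :
    partialKernel B β (c • tensorPow φ (b + 1)) (c' • tensorPow (conjS φ) (b + 1)) =
      (c * c') • tensor (oneBody B φ) (conjS φ) := by
  refine GPPoisson.partialKernel_eq fun ψ x' => ?_
  have e : slot β ψ (c' • tensorPow (conjS φ) (b + 1)) x' =
      (c' * conjS φ x') • insertPow (conjS φ) β ψ := by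
    rw [mul_smul, ← slot_tensorPow]
    ext y
    simp only [slot_apply, smul_apply, smul_eq_mul, mul_left_comm]
  rw [e, map_smul, map_smul, smul_apply, hB.apply_insertPow, smul_eq_mul, smul_eq_mul,
    ← integral_const_mul, ← integral_const_mul]
  refine integral_congr_ae (Eventually.of_forall fun x => ?_)
  simp only [smul_apply, tensor_apply, smul_eq_mul]
  ring

/-- Freezing leaves the scalars ∏_{j ≠ α} φ(x_j) and ∏_{j ≠ α} conj(φ(x'_j)), and the partial
pairing gives u_B(x_α) conj(φ(x'_α)). The primed factors rebuild the full tensor power. -/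
theorem IsObservable.contrKernel_tensorPow {a b n : ℕ} (h : a + b = n) {B : DVO d (b + 1)}
    (hB : IsObservable B) (α : Fin (a + 1)) (β : Fin (b + 1)) (φ : 𝓢(Pt d, ℂ)) :
    contrKernel h B α β (tensorPow φ (n + 1)) (conjS (tensorPow φ (n + 1))) =
      tensor (insertPow φ α (oneBody B φ)) (conjS (tensorPow φ (a + 1))) := by
  ext ⟨x, x'⟩
  rw [contrKernel_apply h hB.gmp, conjS_tensorPow, freeze_tensorPow, freeze_tensorPow,
    hB.partialKernel_eq, tensor_apply, GPPoisson.insertPow_apply, conjS_tensorPow, tensorPow_apply,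
    Fin.prod_univ_succAbove (fun i => conjS φ (x' i)) α, smul_apply, tensor_apply, smul_eq_mul]
  ring

theorem IsObservable.contraction_tensorPow {a b n : ℕ} (h : a + b = n) {A : DVO d (a + 1)}
    {B : DVO d (b + 1)} (hA : IsObservable A) (hB : IsObservable B) (α : Fin (a + 1))
    (β : Fin (b + 1)) (φ : 𝓢(Pt d, ℂ)) :
    contraction h A B α β (tensorPow φ (n + 1)) (conjS (tensorPow φ (n + 1))) =
      -pairConj (oneBody B φ) (oneBody A φ) := by
  rw [contraction_apply h A hB.gmp, hB.contrKernel_tensorPow, ← genTrace, genTrace_tensor,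
    hA.insertPow_apply]

/-- All (a + 1)(b + 1) commutator terms are equal, and each is z - conj(z) with z = ∫ u_A conj(u_B).
The particle numbers become the factors of the two gradients. -/
theorem IsObservable.comm1_tensorPow {a b n : ℕ} (h : a + b = n) {A : DVO d (a + 1)}
    {B : DVO d (b + 1)} (hA : IsObservable A) (hB : IsObservable B) (φ : 𝓢(Pt d, ℂ)) :
    Complex.I * comm1 h A B (tensorPow φ (n + 1)) (conjS (tensorPow φ (n + 1))) =
      omegaL2 (((a : ℝ) + 1) • oneBody A φ) (((b : ℝ) + 1) • oneBody B φ) := by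
  simp only [comm1, sum_apply, sub_apply, hA.contraction_tensorPow h hB,
    hB.contraction_tensorPow _ hA, Finset.sum_const, Finset.card_univ, Fintype.card_fin]
  rw [← omegaLM_apply, map_smul, map_smul, LinearMap.smul_apply, omegaLM_apply, omegaL2_eq,
    ← conj_pairConj (oneBody B φ) (oneBody A φ)]
  apply Complex.ext
  · simp
    ring
  · simp

theorem trace_hierBracket_iota {A B : ∀ n, DVO d (n + 1)} (hA : A ∈ GInf d) (hB : B ∈ GInf d)
    (φ : 𝓢(Pt d, ℂ)) :
    Complex.I * traceHier (hierBracket A B) (iota φ) = omegaL2 (gradField A φ) (gradField B φ) := by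
  obtain ⟨N, hN⟩ := exists_eq_zero_of_le_of_mem_GInf hA
  obtain ⟨M, hM⟩ := exists_eq_zero_of_le_of_mem_GInf hB
  let c : ℕ × ℕ → ℂ := fun p => ((omegaL2 (((p.1 : ℝ) + 1) • oneBody (A p.1) φ)
    (((p.2 : ℝ) + 1) • oneBody (B p.2) φ) : ℝ) : ℂ)
  have hc : ∀ p : ℕ × ℕ, p ∉ Finset.range N ×ˢ Finset.range M → c p = 0 := fun p hp => by
    simp only [Finset.mem_product, Finset.mem_range, not_and_or, not_lt] at hp
    simp only [c, ← omegaLM_apply]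
    rcases hp with hp | hp
    · simp [hN _ hp, oneBody_zero]
    · simp [hM _ hp, oneBody_zero]
  have h1 : ∀ n, Complex.I * genTrace (hierBracket A B n) ((iota φ).1 n) =
      ∑ p ∈ Finset.HasAntidiagonal.antidiagonal n, c p := fun n => by
    -- The symmetrization drops out because both arguments are tensor powers.
    rw [genTrace_iota, hierBracket, conjS_tensorPow, symOp_tensorPow, sum_apply, sum_apply,
      Finset.mul_sum, ← Finset.sum_attach (Finset.HasAntidiagonal.antidiagonal n) c]
    refine Finset.sum_congr rfl fun p _ => ?_
    rw [← conjS_tensorPow]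
    exact (hA.1 _).comm1_tensorPow _ (hB.1 _) φ
  have h2 : Complex.I * traceHier (hierBracket A B) (iota φ) =
      ∑ᶠ n, ∑ p ∈ Finset.HasAntidiagonal.antidiagonal n, c p := by
    rw [traceHier, ← smul_eq_mul, smul_finsum]
    simp only [smul_eq_mul, h1]
  have h3 : ∀ n, ∑ p ∈ Finset.HasAntidiagonal.antidiagonal n, c p =
      ∑ p ∈ Finset.range N ×ˢ Finset.range M with p.1 + p.2 = n, c p := fun n => by
    symm
    refine Finset.sum_subset (fun p hp => ?_) fun p hp hp' => ?_
    · simpa using (Finset.mem_filter.1 hp).2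
    · refine hc p fun h => hp'
        (Finset.mem_filter.2 ⟨h, Finset.HasAntidiagonal.mem_antidiagonal.1 hp⟩)
  -- Nonzero terms have indices below N and M, so summing over antidiagonals amounts to summing over
  -- a finite rectangle, where bilinearity of ω applies.
  rw [h2, finsum_eq_sum_of_support_subset (s := Finset.range (N + M)) _ fun n hn => ?_]
  · simp only [h3]
    rw [Finset.sum_fiberwise_of_maps_to (fun p hp => ?_), Finset.sum_product_right,
      gradField_eq_sum hN,
      gradField_eq_sum hM, ← omegaLM_apply, map_sum]
    · simp only [map_sum, LinearMap.sum_apply, Complex.ofReal_sum, omegaLM_apply, c]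
    · simp only [Finset.mem_product, Finset.mem_range] at hp ⊢
      omega
  · by_contra h
    refine hn (Finset.sum_eq_zero fun p hp => hc p fun hp' => h ?_)
    simp only [Finset.mem_product, Finset.mem_range, Finset.HasAntidiagonal.mem_antidiagonal,
      Finset.coe_range,
      Set.mem_Iio] at hp hp' ⊢
    omega

end Bracket
end GPPoisson

end

/-! ### The Poisson morphism property. -/

theorem theorem2p3 (d : ℕ) :
    GPPoisson.IsSmooth (GPPoisson.iota (d := d)) ∧
    (∀ F ∈ GPPoisson.AInf d, F ∘ GPPoisson.iota ∈ GPPoisson.AS d) ∧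
    ∀ F ∈ GPPoisson.AInf d, ∀ G ∈ GPPoisson.AInf d, ∀ φ : SchwartzMap (GPPoisson.Pt d) ℂ,
      ((GPPoisson.poissonL2 (F ∘ GPPoisson.iota) (G ∘ GPPoisson.iota) φ : ℝ) : ℂ) =
        GPPoisson.poissonInf F G (GPPoisson.iota φ) := by
  refine ⟨GPPoisson.isSmooth_of_forall_isCk GPPoisson.isCk_iota, fun F hF => ?_,
    fun F hF G hG φ => ?_⟩
  · obtain ⟨X, hX⟩ := GPPoisson.exists_hasGradient hF
    exact hX.mem_AS
  · obtain ⟨X, hX⟩ := GPPoisson.exists_hasGradient hF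
    obtain ⟨Y, hY⟩ := GPPoisson.exists_hasGradient hG
    obtain ⟨hF1, hF2⟩ := hX.diffRep φ
    obtain ⟨hG1, hG2⟩ := hY.diffRep φ
    rw [GPPoisson.poissonInf, GPPoisson.trace_hierBracket_iota hF1 hG1, hF2, hG2,
      GPPoisson.poissonL2, hX.symGrad_eq, hY.symGrad_eq]
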